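/- **Setting.** Inner products are linear in the second variable. *0-cells.* A tracial $0$-cell $\Gamma_\bullet$ consists of finite semisimple C*-categories $\mathcal M_k$ ($k\ge 0$) with finite sets $V_{\mathcal M_k}$ of (representatives of isomorphism classes of) simple objects, weights $\mu^k : V_{\mathcal M_k}\to(0,\infty)$, and $*$-linear bi-faithful functors $\Gamma_k:\mathcal M_{k-1}\to\mathcal M_k$ ($k\ge 1$; the functor and its adjoint are faithful) such that $\sum_v\mu^0_v=1$ and $\sum_{w}\dim\mathcal M_k(w,\Gamma_k v)\,\mu^k_w=\mu^{k-1}_v$ for all $k\ge1$ and $v\in V_{\mathcal M_{k-1}}$. Put $m_0=\bigoplus_{v\in V_{\mathcal M_0}}v$ and $m_k=\Gamma_k\cdots\Gamma_1m_0$. On endomorphisms of $x\in\mathcal M_k$ let $\mathrm{Tr}_x(\alpha)=\sum_v\mu^k_v\,\mathrm{tr}\big(\sigma\mapsto\alpha\sigma \text{ on }\mathcal M_k(v,x)\big)$. Let $A_\infty=\bigcup_k\mathrm{End}(m_k)$ along $\alpha\mapsto\Gamma_{k+1}(\alpha)$, with the faithful tracial state $\mathrm{Tr}$; $\mathcal{PB}(\Gamma_\bullet)=A$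 is the von Neumann algebra generated by $A_\infty$ acting by left multiplication on $L^2(A_\infty,\mathrm{Tr})$. *1-cells.* Let $\Delta_\bullet$ be another $0$-cell, with data $\mathcal N_k,\nu^k,\Delta_k,n_0$, $B=\mathcal{PB}(\Delta_\bullet)$. A $1$-cell $\Lambda_\bullet:\Gamma_\bullet\to\Delta_\bullet$ consists of $*$-linear bi-faithful functors $\Lambda_k:\mathcal M_k\to\mathcal N_k$ and natural unitaries $W_k:\Delta_k\Lambda_{k-1}\to\Lambda_k\Gamma_k$ such that, for some constants $\varepsilon,K>0$, $\varepsilon\,\mu^k_v\le\sum_w\dim\mathcal N_k(w,\Lambda_kv)\,\nu^k_w\le K\mu^k_v$ for all $k,v$. Put $H_\infty=\bigcup_k\mathcal N_k(\Delta_k\cdots\Delta_1n_0,\Lambda_km_k)$ along the inclusions $\xi\mapsto W_{k+1}\circ\Delta_{k+1}(\xi)$, with the inner product $\langle\xi,\eta\rangle=\mathrm{Tr}(\xi^*\eta)$. $\mathcal{PB}(\Lambda_\bullet)$ is its completion $H$, an $A$-$B$-bimodule with the normal extensions of the actions $a\cdot\xi=\Lambda_k(a)\circ\xi$ and $\xi\cdot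 b=\xi\circ b$ of $A_\infty$ and $B_\infty$. For a $1$-cell $\Omega_\bullet:\Delta_\bullet\to\Theta_\bullet$, $(\Omega\boxtimes\Lambda)_\bullet$ has the functors $\Omega_k\Lambda_k$ and the unitaries $\Omega_k(W^\Lambda_k)\circ (W^\Omega_k)_{\Lambda_{k-1}}$. Put $C=\mathcal{PB}(\Theta_\bullet)$. *2-cells.* For each $k$ let $(\rho,\rho')$ be a solution of the conjugate equations for $\Delta_k$ and a $*$-linear adjoint $\Delta_k'$, $\rho:\mathrm{id}\to\Delta_k\Delta'_k$, $\rho':\mathrm{id}\to\Delta'_k\Delta_k$, which is tracial and commensurate with the weights: $(\rho'_v)^*\Delta'_k(\sigma\tau^*)\rho'_v=\frac{\nu^k_w}{\nu^{k-1}_v}\langle\tau,\sigma\rangle 1_v$ for simple $v,w$ and $\sigma,\tau:w\to\Delta_kv$, where $\langle\tau,\sigma\rangle1_w=\tau^*\sigma$. For $1$-cells $\Lambda_\bullet,\Lambda^2_\bullet:\Gamma_\bullet\to\Delta_\bullet$ the loop operator $S_k:\mathrm{NT}(\Lambda_k,\Lambda^2_k)\to\mathrm{NT}(\Lambda_{k-1},\Lambda^2_{k-1})$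 is $$(S_k\eta)_x=(\rho'_{\Lambda^2_{k-1}x})^*\circ\Delta_k'\big((W^{\Lambda^2}_k)_x^*\circ\eta_{\Gamma_kx}\circ(W^{\Lambda}_k)_x\big)\circ\rho'_{\Lambda_{k-1}x}.$$ A *bounded quasi-flat sequence* (BQFS) from $\Lambda_\bullet$ to $\Lambda^2_\bullet$ is a sequence $\eta^{(k)}\in\mathrm{NT}(\Lambda_k,\Lambda^2_k)$, $k\ge0$, bounded in C*-norm, with $S_{k+1}\eta^{(k+1)}=\eta^{(k)}$ for all $k$. Each $\gamma\in\mathcal N_k(\Lambda_km_k,\Lambda^2_km_k)$ acts by composition as a bounded operator $\Phi_\gamma:\mathcal{PB}(\Lambda_\bullet)\to\mathcal{PB}(\Lambda^2_\bullet)$, and $\mathcal{PB}(\eta)$ is the bounded $A$-$B$-bimodule map that is the strong operator limit of $\Phi_{\eta^{(k)}_{m_k}}$ as $k\to\infty$. *Connes fusion.* For an $A$-$B$-bimodule $X$ and a $B$-$C$-bimodule $Y$, $X\otimes_BY$ is the Hilbert space generated by the elementary tensors $R\otimes\zeta$, where $R:L^2(B)\to X$ is bounded and right $B$-linear and $\zeta\in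 Y$, with $\langle R\otimes\zeta,R'\otimes\zeta'\rangle=\langle\zeta,(R^*R')\zeta'\rangle$, where $R^*R'\in B$; $A$ and $C$ act by $a(R\otimes\zeta)c=aR\otimes\zeta c$, and for intertwiners $T,T'$ one has $(T\otimes T')(R\otimes\zeta)=TR\otimes T'\zeta$. For $\xi\in H_\infty$, $\Phi_\xi:L^2(B)\to H$ denotes the bounded operator extending $b\mapsto\xi\circ b$. **Statement.** Let $\Gamma_\bullet,\Delta_\bullet,\Theta_\bullet$ be $0$-cells. (i) For all $1$-cells $\Lambda_\bullet:\Gamma_\bullet\to\Delta_\bullet$ and $\Omega_\bullet:\Delta_\bullet\to\Theta_\bullet$ there is a unitary isomorphism of $A$-$C$-bimodules $$U_{\Lambda,\Omega}:\mathcal{PB}(\Lambda_\bullet)\otimes_B\mathcal{PB}(\Omega_\bullet)\to\mathcal{PB}(\Omega_\bullet\boxtimes\Lambda_\bullet)$$ such that $U_{\Lambda,\Omega}(\Phi_\xi\otimes\zeta)=\Omega_k(\xi)\circ\zeta$ for all $k$, $\xi\in\mathcal N_k(\Delta_k\cdots\Delta_1n_0,\Lambda_km_k)$ and every $\zeta$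 in the $k$-th space of the union defining the dense subspace of $\mathcal{PB}(\Omega_\bullet)$. (ii) Let $\eta$ be a BQFS from $\Lambda^1_\bullet$ to $\Lambda^2_\bullet$ ($1$-cells $\Gamma_\bullet\to\Delta_\bullet$) and $\kappa$ a BQFS from $\Omega^1_\bullet$ to $\Omega^2_\bullet$ ($1$-cells $\Delta_\bullet\to\Theta_\bullet$). Then: (a) for each $k\ge0$ the limit $$(\kappa\boxtimes\eta)^{(k)}=\lim_{l\to\infty}S_{k+1}\cdots S_{k+l}\Big(\Omega^2_{k+l}\big(\eta^{(k+l)}\big)\circ\kappa^{(k+l)}_{\Lambda^1_{k+l}}\Big)$$ exists in $\mathrm{NT}(\Omega^1_k\Lambda^1_k,\Omega^2_k\Lambda^2_k)$ in C*-norm, where $S$ is the loop operator from $\Omega^1_\bullet\boxtimes\Lambda^1_\bullet$ to $\Omega^2_\bullet\boxtimes\Lambda^2_\bullet$, and $\kappa\boxtimes\eta$ is a BQFS from $\Omega^1_\bullet\boxtimes\Lambda^1_\bullet$ to $\Omega^2_\bullet\boxtimes\Lambda^2_\bullet$; (b) the operators $\mathcal{PB}(\eta)$, $\mathcal{PB}(\kappa)$,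 $\mathcal{PB}(\kappa\boxtimes\eta)$ exist and $$\mathcal{PB}(\kappa\boxtimes\eta)\circ U_{\Lambda^1,\Omega^1}=U_{\Lambda^2,\Omega^2}\circ\big(\mathcal{PB}(\eta)\otimes\mathcal{PB}(\kappa)\big).$$ -/

import Mathlib

open CategoryTheory Filter Topology
open scoped ComplexConjugate

universe u w u₁ w₁ u₂ w₂ u₃ w₃ v₁ v₂ v₃ v₄

namespace UC

/-! ### Semisimple C*-categories -/

/-- A C*-category with finite-dimensional morphism spaces.  `dag f` is the adjoint `f*`,
`nrm f` the C*-norm (completeness is automatic in finite dimension); `pos` says that `f* f` is a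
positive element of the C*-algebra of endomorphisms.  Compositions are written in
diagrammatic order, `f ≫ g = g ∘ f`. -/
class CStarCat (C : Type u) [Category.{w} C] [Preadditive C] [Linear ℂ C] where
  dag : ∀ {X Y : C}, (X ⟶ Y) → (Y ⟶ X)
  dag_dag : ∀ {X Y : C} (f : X ⟶ Y), dag (dag f) = f
  dag_comp : ∀ {X Y Z : C} (f : X ⟶ Y) (g : Y ⟶ Z), dag (f ≫ g) = dag g ≫ dag f
  dag_add : ∀ {X Y : C} (f g : X ⟶ Y), dag (f + g) = dag f + dag g
  dag_smul : ∀ {X Y : C} (c : ℂ) (f : X ⟶ Y), dag (c • f) = conj c • dag f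
  nrm : ∀ {X Y : C}, (X ⟶ Y) → ℝ
  nrm_add_le : ∀ {X Y : C} (f g : X ⟶ Y), nrm (f + g) ≤ nrm f + nrm g
  nrm_smul : ∀ {X Y : C} (c : ℂ) (f : X ⟶ Y), nrm (c • f) = ‖c‖ * nrm f
  eq_zero_of_nrm : ∀ {X Y : C} (f : X ⟶ Y), nrm f = 0 → f = 0
  nrm_comp_le : ∀ {X Y Z : C} (f : X ⟶ Y) (g : Y ⟶ Z), nrm (f ≫ g) ≤ nrm f * nrm g
  nrm_cstar : ∀ {X Y : C} (f : X ⟶ Y), nrm (f ≫ dag f) = nrm f ^ 2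
  pos : ∀ {X Y : C} (f : X ⟶ Y), ∃ g : X ⟶ X, f ≫ dag f = g ≫ dag g
  finite_hom : ∀ X Y : C, Module.Finite ℂ (X ⟶ Y)

open CStarCat

section Basic

variable {C : Type u} [Category.{w} C] [Preadditive C] [Linear ℂ C] [CStarCat C]

/-- `x` is an orthogonal direct sum of the objects `z i`, with isometric inclusions `inc i`. -/
structure OrthSum {ι : Type} [Fintype ι] (z : ι → C) (x : C) where
  inc : ∀ i, z i ⟶ x
  isom : ∀ i, inc i ≫ dag (inc i) = 𝟙 (z i)
  orth : ∀ i j, i ≠ j → inc i ≫ dag (inc j) = 0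
  total : ∑ i, dag (inc i) ≫ inc i = 𝟙 x

variable (C) in
/-- Finite semisimplicity: a finite family `s v` (`v ∈ V`) of pairwise non-isomorphic simple
objects, finite orthogonal direct sums, and every object is an orthogonal direct sum of copies of
the `s v`.  So `s` is a maximal family of mutually non-isomorphic simple objects. -/
class FinSS where
  V : Type
  fintypeV : Fintype V
  s : V → C
  finrank_end : ∀ v, Module.finrank ℂ (s v ⟶ s v) = 1
  hom_zero : ∀ v v', v ≠ v' → ∀ f : s v ⟶ s v', f = 0
  directSum : ∀ {ι : Type} [Fintype ι] (z : ι → C), ∃ x, Nonempty (OrthSum z x)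
  decomp : ∀ x : C, ∃ (n : ℕ) (i : Fin n → V), Nonempty (OrthSum (fun j => s (i j)) x)

end Basic

attribute [instance] FinSS.fintypeV

/-- A weighted finite semisimple C*-category. -/
structure WSSC where
  Obj : Type u
  [cat : Category.{w} Obj]
  [preadditive : Preadditive Obj]
  [linear : Linear ℂ Obj]
  [cstar : CStarCat Obj]
  [semisimple : FinSS Obj]
  wt : FinSS.V Obj → ℝ
  wt_pos : ∀ v, 0 < wt v

attribute [instance] WSSC.cat WSSC.preadditive WSSC.linear WSSC.cstar WSSC.semisimple

/-- The simple objects of a weighted finite semisimple C*-category. -/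
abbrev WSSC.s (M : WSSC.{u, w}) (v : FinSS.V M.Obj) : M.Obj := FinSS.s v

/-- The index set of the simple objects. -/
abbrev WSSC.V (M : WSSC.{u, w}) : Type := FinSS.V M.Obj

section Functors

variable {C : Type u₁} [Category.{w₁} C] [Preadditive C] [Linear ℂ C] [CStarCat C]
  {D : Type u₂} [Category.{w₂} D] [Preadditive D] [Linear ℂ D] [CStarCat D]
  {E : Type u₃} [Category.{w₃} E] [Preadditive E] [Linear ℂ E] [CStarCat E]

/-- `*`-linear functors. -/
class StarLinear (F : C ⥤ D) : Prop where
  map_add : ∀ {X Y : C} (f g : X ⟶ Y), F.map (f + g) = F.map f + F.map g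
  map_smul : ∀ {X Y : C} (c : ℂ) (f : X ⟶ Y), F.map (c • f) = c • F.map f
  map_dag : ∀ {X Y : C} (f : X ⟶ Y), F.map (dag f) = dag (F.map f)

/-- Bi-faithful functors: the functor and its adjoint are both faithful. -/
class BiFaithful (F : C ⥤ D) : Prop where
  faithful : F.Faithful
  adjoint_faithful : ∃ G : D ⥤ C, Nonempty (F ⊣ G) ∧ G.Faithful

end Functors

section BasicFacts

variable {C : Type u} [Category.{w} C] [Preadditive C] [Linear ℂ C] [CStarCat C]

attribute [local instance] CStarCat.finite_hom

theorem dag_zero {X Y : C} : dag (0 : X ⟶ Y) = 0 := by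
  have h := dag_add (0 : X ⟶ Y) 0
  simpa using h

theorem dag_sum {X Y : C} {ι : Type*} (t : Finset ι) (f : ι → (X ⟶ Y)) :
    dag (∑ i ∈ t, f i) = ∑ i ∈ t, dag (f i) := by
  classical
  induction t using Finset.induction_on with
  | empty => simpa using dag_zero
  | insert a t ha ih => rw [Finset.sum_insert ha, Finset.sum_insert ha, dag_add, ih]

theorem dag_id (X : C) : dag (𝟙 X) = 𝟙 X := by
  have h := dag_comp (dag (𝟙 X)) (𝟙 X)
  rw [Category.comp_id, dag_dag, Category.comp_id] at h
  exact h.symm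

theorem nrm_zero {X Y : C} : nrm (0 : X ⟶ Y) = 0 := by
  have h := nrm_smul (0 : ℂ) (0 : X ⟶ Y)
  simpa using h

theorem nrm_neg {X Y : C} (f : X ⟶ Y) : nrm (-f) = nrm f := by
  have h := nrm_smul (-1 : ℂ) f
  simpa using h

theorem nrm_nonneg {X Y : C} (f : X ⟶ Y) : 0 ≤ nrm f := by
  have h := nrm_add_le f (-f)
  rw [add_neg_cancel, nrm_zero, nrm_neg] at h
  linarith

theorem nrm_dag_le {X Y : C} (f : X ⟶ Y) : nrm f ≤ nrm (dag f) := by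
  by_contra! h
  have h1 := nrm_cstar f
  have h2 := nrm_comp_le f (dag f)
  have h3 := nrm_nonneg (dag f)
  nlinarith

theorem nrm_dag {X Y : C} (f : X ⟶ Y) : nrm (dag f) = nrm f :=
  le_antisymm (by simpa [dag_dag] using nrm_dag_le (dag f)) (nrm_dag_le f)

theorem nrm_isom {X Y : C} (f : X ⟶ Y) (h : f ≫ dag f = 𝟙 X) : nrm f ≤ 1 := by
  have h1 := nrm_cstar f
  have h2 := nrm_cstar (𝟙 X)
  rw [dag_id, Category.comp_id] at h2
  rw [h, h2] at h1
  by_contra! h3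
  have h4 : nrm (𝟙 X) = nrm f := (pow_left_inj₀ (nrm_nonneg _) (nrm_nonneg _) two_ne_zero).1 h1
  rw [h4] at h2
  nlinarith

end BasicFacts

/-! ### The categorical trace -/

section Trace

attribute [local instance] CStarCat.finite_hom

variable (M : WSSC.{u, w})

/-- The categorical trace associated with the weights: `Tr_x(α)` is the sum over the simple
objects `v` of `μ_v` times the trace of `σ ↦ α ∘ σ` on the morphism space `M(v, x)`, i.e.
`∑ v, ∑ σ ∈ ONB(v, x), μ_v ⟨α σ, σ⟩`. -/
noncomputable def Tr {x : M.Obj} (α : x ⟶ x) : ℂ :=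
  ∑ v, (M.wt v : ℂ) * LinearMap.trace ℂ (M.s v ⟶ x) (Linear.rightComp ℂ (M.s v) α)

variable {M}

theorem Tr_add {x : M.Obj} (α β : x ⟶ x) : Tr M (α + β) = Tr M α + Tr M β := by
  simp only [Tr, ← Finset.sum_add_distrib, ← mul_add, ← map_add]
  congr! with v
  ext f; simp

theorem Tr_smul {x : M.Obj} (c : ℂ) (α : x ⟶ x) : Tr M (c • α) = c * Tr M α := by
  rw [Tr, Tr, Finset.mul_sum]
  refine Finset.sum_congr rfl fun v _ => ?_
  have : Linear.rightComp ℂ (M.s v) (c • α) = c • Linear.rightComp ℂ (M.s v) α := by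
    ext f; simp
  rw [this, map_smul, smul_eq_mul]; ring

theorem Tr_zero {x : M.Obj} : Tr M (0 : x ⟶ x) = 0 := by
  simpa using Tr_smul 0 (0 : x ⟶ x)

theorem Tr_sum {x : M.Obj} {ι : Type*} (t : Finset ι) (f : ι → (x ⟶ x)) :
    Tr M (∑ i ∈ t, f i) = ∑ i ∈ t, Tr M (f i) := by
  classical
  induction t using Finset.induction_on with
  | empty => simpa using Tr_zero
  | insert a t ha ih => rw [Finset.sum_insert ha, Finset.sum_insert ha, Tr_add, ih]

theorem Tr_comm {x y : M.Obj} (f : x ⟶ y) (g : y ⟶ x) : Tr M (f ≫ g) = Tr M (g ≫ f) := by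
  simp only [Tr]
  refine Finset.sum_congr rfl fun v _ => ?_
  have h1 : Linear.rightComp ℂ (M.s v) (f ≫ g) =
      Linear.rightComp ℂ (M.s v) g ∘ₗ Linear.rightComp ℂ (M.s v) f := by ext; simp
  have h2 : Linear.rightComp ℂ (M.s v) (g ≫ f) =
      Linear.rightComp ℂ (M.s v) f ∘ₗ Linear.rightComp ℂ (M.s v) g := by ext; simp
  rw [h1, h2, LinearMap.trace_comp_comm']

theorem exists_scalar {v : M.V} (f : M.s v ⟶ M.s v) : ∃ c : ℂ, f = c • 𝟙 (M.s v) := by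
  have h1 := FinSS.finrank_end (C := M.Obj) v
  have hne : (𝟙 (M.s v)) ≠ 0 := by
    intro h0
    obtain ⟨g, hg⟩ := (Module.finrank_pos_iff_exists_ne_zero (R := ℂ) (M := FinSS.s v ⟶ FinSS.s v)).1
      (by rw [h1]; exact one_pos)
    apply hg
    have : g = 𝟙 (M.s v) ≫ g := (Category.id_comp g).symm
    rw [this, h0, Limits.zero_comp]
  obtain ⟨c, hc⟩ := (finrank_eq_one_iff_of_nonzero' (𝟙 (M.s v)) hne).1 h1 f
  exact ⟨c, hc.symm⟩

theorem id_s_ne_zero (v : M.V) : 𝟙 (M.s v) ≠ 0 := by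
  intro h0
  have h1 := FinSS.finrank_end (C := M.Obj) v
  obtain ⟨g, hg⟩ := (Module.finrank_pos_iff_exists_ne_zero (R := ℂ) (M := FinSS.s v ⟶ FinSS.s v)).1
      (by rw [h1]; exact one_pos)
  apply hg
  have : g = 𝟙 (M.s v) ≫ g := (Category.id_comp g).symm
  rw [this, h0, Limits.zero_comp]

theorem Tr_id_s (v : M.V) : Tr M (𝟙 (M.s v)) = M.wt v := by
  classical
  have h : ∀ v' : M.V, Linear.rightComp ℂ (M.s v') (𝟙 (M.s v)) = LinearMap.id := by
    intro v'; ext; simp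
  simp only [Tr, h, LinearMap.trace_id]
  rw [Finset.sum_eq_single v]
  · have := FinSS.finrank_end (C := M.Obj) v
    rw [this]; simp
  · intro v' _ hv
    have : Subsingleton (M.s v' ⟶ M.s v) :=
      ⟨fun a b => by rw [FinSS.hom_zero v' v hv a, FinSS.hom_zero v' v hv b]⟩
    rw [Module.finrank_zero_of_subsingleton]; simp
  · simp

theorem Tr_id (x : M.Obj) :
    Tr M (𝟙 x) = ∑ v, (M.wt v : ℂ) * Module.finrank ℂ (M.s v ⟶ x) := by
  have h : ∀ v' : M.V, Linear.rightComp ℂ (M.s v') (𝟙 x) = LinearMap.id := by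
    intro v'; ext; simp
  simp only [Tr, h, LinearMap.trace_id]

theorem Tr_decomp {x y : M.Obj} {n : ℕ} {i : Fin n → M.V}
    (S : OrthSum (fun j => M.s (i j)) x) (f : x ⟶ y) (g : y ⟶ x) :
    Tr M (f ≫ g) = ∑ j, Tr M ((S.inc j ≫ f) ≫ (g ≫ dag (S.inc j))) := by
  have h : f ≫ g = ∑ j, dag (S.inc j) ≫ (S.inc j ≫ f ≫ g) := by
    conv_lhs => rw [← Category.id_comp (f ≫ g), ← S.total, Preadditive.sum_comp]
    simp
  rw [h, Tr_sum]
  refine Finset.sum_congr rfl fun j _ => ?_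
  rw [Tr_comm]; simp

/-- the trace of an endomorphism, computed along a decomposition into simple objects -/
theorem Tr_coeff {x : M.Obj} {n : ℕ} {i : Fin n → M.V}
    (S : OrthSum (fun j => M.s (i j)) x) (α : x ⟶ x) (c : Fin n → ℂ)
    (hc : ∀ j, S.inc j ≫ α ≫ dag (S.inc j) = c j • 𝟙 (M.s (i j))) :
    Tr M α = ∑ j, c j * M.wt (i j) := by
  have h := Tr_decomp S α (𝟙 x)
  rw [Category.comp_id] at h
  rw [h]
  refine Finset.sum_congr rfl fun j _ => ?_
  rw [Category.id_comp, Category.assoc, hc, Tr_smul, Tr_id_s]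

theorem exists_coeff {x : M.Obj} {n : ℕ} {i : Fin n → M.V}
    (S : OrthSum (fun j => M.s (i j)) x) (α : x ⟶ x) :
    ∃ c : Fin n → ℂ, ∀ j, S.inc j ≫ α ≫ dag (S.inc j) = c j • 𝟙 (M.s (i j)) := by
  choose c hc using fun j => exists_scalar (S.inc j ≫ α ≫ dag (S.inc j))
  exact ⟨c, hc⟩

theorem Tr_dag {x : M.Obj} (α : x ⟶ x) : Tr M (dag α) = conj (Tr M α) := by
  obtain ⟨n, i, ⟨S⟩⟩ := FinSS.decomp x
  obtain ⟨c, hc⟩ := exists_coeff S α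
  rw [Tr_coeff S α c hc, Tr_coeff S (dag α) (fun j => conj (c j)), map_sum]
  · simp
  · intro j
    have := congrArg dag (hc j)
    rwa [dag_comp, dag_comp, dag_dag, dag_smul, dag_id, Category.assoc] at this

theorem nrm_id_s (v : M.V) : nrm (𝟙 (M.s v)) = 1 := by
  have h2 := nrm_cstar (𝟙 (M.s v))
  rw [dag_id, Category.comp_id] at h2
  have h3 : nrm (𝟙 (M.s v)) ≠ 0 := fun h => id_s_ne_zero v (eq_zero_of_nrm _ h)
  field_simp at h2
  nlinarith [h2, sq_nonneg (nrm (𝟙 (M.s v)))]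

/-- for a morphism `g` out of a simple object, `g* g = ‖g‖² 1` -/
theorem comp_dag_simple {v : M.V} {y : M.Obj} (g : M.s v ⟶ y) :
    g ≫ dag g = ((nrm g ^ 2 : ℝ) : ℂ) • 𝟙 (M.s v) := by
  obtain ⟨h, hh⟩ := CStarCat.pos g
  obtain ⟨c, rfl⟩ := exists_scalar h
  have h1 : g ≫ dag g = ((‖c‖ ^ 2 : ℝ) : ℂ) • 𝟙 (M.s v) := by
    rw [hh, dag_smul, dag_id]
    simp [smul_smul]
    rw [mul_comm, Complex.mul_conj, Complex.normSq_eq_norm_sq]; simp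
  have h2 := nrm_cstar g
  rw [h1, nrm_smul, nrm_id_s, mul_one, Complex.norm_real, Real.norm_of_nonneg (by positivity)] at h2
  rw [h1, h2]

theorem Tr_pos_eq {x y : M.Obj} {n : ℕ} {i : Fin n → M.V}
    (S : OrthSum (fun j => M.s (i j)) x) (f : x ⟶ y) :
    Tr M (f ≫ dag f) = ((∑ j, nrm (S.inc j ≫ f) ^ 2 * M.wt (i j) : ℝ) : ℂ) := by
  rw [Tr_coeff S (f ≫ dag f) (fun j => ((nrm (S.inc j ≫ f) ^ 2 : ℝ) : ℂ))]
  · push_cast; rfl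
  · intro j
    rw [← comp_dag_simple, dag_comp]; simp

theorem Tr_nonneg {x y : M.Obj} (f : x ⟶ y) : 0 ≤ (Tr M (f ≫ dag f)).re := by
  obtain ⟨n, i, ⟨S⟩⟩ := FinSS.decomp x
  rw [Tr_pos_eq S, Complex.ofReal_re]
  exact Finset.sum_nonneg fun j _ => mul_nonneg (sq_nonneg _) (M.wt_pos _).le

theorem Tr_bound {x y z : M.Obj} (f : x ⟶ y) (g : y ⟶ z) :
    (Tr M ((f ≫ g) ≫ dag (f ≫ g))).re ≤ nrm g ^ 2 * (Tr M (f ≫ dag f)).re := by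
  obtain ⟨n, i, ⟨S⟩⟩ := FinSS.decomp x
  rw [Tr_pos_eq S, Tr_pos_eq S, Complex.ofReal_re, Complex.ofReal_re, Finset.mul_sum]
  refine Finset.sum_le_sum fun j _ => ?_
  have h := nrm_comp_le (S.inc j ≫ f) g
  rw [Category.assoc] at h
  have h1 : nrm (S.inc j ≫ f ≫ g) ^ 2 ≤ (nrm (S.inc j ≫ f) * nrm g) ^ 2 :=
    pow_le_pow_left₀ (nrm_nonneg _) h 2
  have h2 := mul_le_mul_of_nonneg_right h1 (M.wt_pos (i j)).le
  calc _ ≤ _ := h2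
    _ = _ := by ring

end Trace

section EndAlgebra

variable {C : Type u₁} [Category.{w₁} C] [Preadditive C] [Linear ℂ C] [CStarCat C]
  {D : Type u₂} [Category.{w₂} D] [Preadditive D] [Linear ℂ D] [CStarCat D]

/-- The C*-algebra of endomorphisms of an object. -/
@[reducible] noncomputable def endCStarAlgebra (x : C) : CStarAlgebra (End x) :=
  letI n : NormedRing (End x) := RingNorm.toNormedRing
    { toFun := fun f => nrm (X := x) (Y := x) f
      map_zero' := nrm_zero
      add_le' := fun f g => nrm_add_le (X := x) (Y := x) f g
      neg' := fun f => nrm_neg (X := x) (Y := x) f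
      mul_le' := fun f g => by
        rw [mul_comm (nrm (X := x) (Y := x) f)]
        exact nrm_comp_le (X := x) (Y := x) (Z := x) g f
      eq_zero_of_map_eq_zero' := fun f h => eq_zero_of_nrm (X := x) (Y := x) f h }
  letI a : NormedAlgebra ℂ (End x) :=
    { (inferInstance : Algebra ℂ (End x)) with
      norm_smul_le := fun c f => (nrm_smul (X := x) (Y := x) c f).le }
  letI s : StarRing (End x) :=
    { star := fun f => dag (X := x) (Y := x) f
      star_involutive := fun f => dag_dag (X := x) (Y := x) f
      star_mul := fun f g => dag_comp (X := x) (Y := x) (Z := x) g f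
      star_add := fun f g => dag_add (X := x) (Y := x) f g }
  haveI m : StarModule ℂ (End x) := ⟨fun c f => dag_smul (X := x) (Y := x) c f⟩
  haveI c : CStarRing (End x) := ⟨fun {f} => by
    have h := nrm_cstar (X := x) (Y := x) f
    have h2 := nrm_cstar (X := x) (Y := x) (dag (X := x) (Y := x) f)
    rw [nrm_dag, dag_dag] at h2
    change nrm (X := x) (Y := x) f * nrm (X := x) (Y := x) f ≤
      nrm (X := x) (Y := x) (f ≫ dag (X := x) (Y := x) f)
    rw [h, sq]⟩
  haveI f : FiniteDimensional ℂ (End x) := finite_hom x x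
  { n, a, s, m, c with
    complete := (FiniteDimensional.complete ℂ (End x)).complete }

theorem StarLinear.nrm_map_le (F : C ⥤ D) [StarLinear F] {x y : C} (f : x ⟶ y) :
    nrm (F.map f) ≤ nrm f := by
  have key : ∀ (h : x ⟶ x), nrm (F.map h) ≤ nrm h := by
    intro h
    let _ := endCStarAlgebra x
    let _ := endCStarAlgebra (F.obj x)
    let φ : End x →⋆ₙₐ[ℂ] End (F.obj x) :=
      { toFun := fun h => F.map h
        map_smul' := fun c h => StarLinear.map_smul (F := F) (X := x) (Y := x) c h
        map_zero' := by
          have := StarLinear.map_smul (F := F) (X := x) (Y := x) 0 0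
          simpa using this
        map_add' := fun f g => StarLinear.map_add (F := F) (X := x) (Y := x) f g
        map_mul' := fun f g => F.map_comp (X := x) (Y := x) (Z := x) g f
        map_star' := fun f => StarLinear.map_dag (F := F) (X := x) (Y := x) f }
    exact NonUnitalStarAlgHom.norm_apply_le (A := End x) (B := End (F.obj x)) φ h
  have h1 := nrm_cstar f
  have h2 := nrm_cstar (F.map f)
  rw [← StarLinear.map_dag, ← F.map_comp] at h2
  have h3 := key (f ≫ dag f)
  rw [h1, h2] at h3
  exact (pow_le_pow_iff_left₀ (nrm_nonneg _) (nrm_nonneg _) two_ne_zero).1 h3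

theorem StarLinear.map_zero (F : C ⥤ D) [StarLinear F] {x y : C} :
    F.map (0 : x ⟶ y) = 0 := by
  have := StarLinear.map_smul (F := F) (X := x) (Y := y) 0 0
  simpa using this

theorem StarLinear.map_sum (F : C ⥤ D) [StarLinear F] {x y : C} {ι : Type*} (t : Finset ι)
    (f : ι → (x ⟶ y)) : F.map (∑ i ∈ t, f i) = ∑ i ∈ t, F.map (f i) := by
  classical
  induction t using Finset.induction_on with
  | empty => simpa using StarLinear.map_zero F
  | insert a t ha ih =>
    rw [Finset.sum_insert ha, Finset.sum_insert ha, StarLinear.map_add, ih]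

theorem StarLinear.comp {E : Type u₃} [Category.{w₃} E] [Preadditive E] [Linear ℂ E] [CStarCat E]
    (F : C ⥤ D) (G : D ⥤ E) [StarLinear F] [StarLinear G] : StarLinear (F ⋙ G) where
  map_add f g := by simp [StarLinear.map_add]
  map_smul c f := by simp [StarLinear.map_smul]
  map_dag f := by simp [StarLinear.map_dag]

end EndAlgebra

theorem BiFaithful.comp {C : Type u₁} [Category.{w₁} C] {D : Type u₂} [Category.{w₂} D]
    {E : Type u₃} [Category.{w₃} E] {F : C ⥤ D} {G : D ⥤ E} (hF : BiFaithful F)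
    (hG : BiFaithful G) : BiFaithful (F ⋙ G) where
  faithful := by
    have := hF.faithful
    have := hG.faithful
    infer_instance
  adjoint_faithful := by
    obtain ⟨F', ⟨aF⟩, fF⟩ := hF.adjoint_faithful
    obtain ⟨G', ⟨aG⟩, fG⟩ := hG.adjoint_faithful
    exact ⟨G' ⋙ F', ⟨aF.comp aG⟩, inferInstance⟩

/-! ### Weighted multiplicities -/

/-- The entry `[F' ν]_v = ∑ w, N_{w,v} ν_w` of the transposed adjacency matrix of `F` applied to
the weight vector of the target category; `N_{w,v} = dim N(w, F v)` is the number of edges. -/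
noncomputable def adjWt (M : WSSC.{u₁, w₁}) (N : WSSC.{u₂, w₂}) (F : M.Obj ⥤ N.Obj) (v : M.V) : ℝ :=
  ∑ v' : N.V, (Module.finrank ℂ (N.s v' ⟶ F.obj (M.s v)) : ℝ) * N.wt v'

section MapTrace

variable {M : WSSC.{u₁, w₁}} {N : WSSC.{u₂, w₂}} (F : M.Obj ⥤ N.Obj) [StarLinear F]

theorem Tr_id_map (v : M.V) : Tr N (𝟙 (F.obj (M.s v))) = adjWt M N F v := by
  rw [Tr_id, adjWt]; push_cast
  exact Finset.sum_congr rfl fun _ _ => mul_comm _ _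

theorem Tr_map_coeff {x : M.Obj} {n : ℕ} {i : Fin n → M.V}
    (S : OrthSum (fun j => M.s (i j)) x) (α : x ⟶ x) (c : Fin n → ℂ)
    (hc : ∀ j, S.inc j ≫ α ≫ dag (S.inc j) = c j • 𝟙 (M.s (i j))) :
    Tr N (F.map α) = ∑ j, c j * adjWt M N F (i j) := by
  have h : F.map α = ∑ j, F.map (dag (S.inc j)) ≫ F.map (S.inc j ≫ α) := by
    conv_lhs => rw [← Category.id_comp α, ← S.total, Preadditive.sum_comp, StarLinear.map_sum]
    simp
  rw [h, Tr_sum]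
  refine Finset.sum_congr rfl fun j _ => ?_
  rw [Tr_comm, ← F.map_comp, Category.assoc, hc, StarLinear.map_smul, Tr_smul, F.map_id, Tr_id_map]

theorem Tr_map_eq (h : ∀ v, adjWt M N F v = M.wt v) {x : M.Obj} (α : x ⟶ x) :
    Tr N (F.map α) = Tr M α := by
  obtain ⟨n, i, ⟨S⟩⟩ := FinSS.decomp x
  obtain ⟨c, hc⟩ := exists_coeff S α
  rw [Tr_map_coeff F S α c hc, Tr_coeff S α c hc]
  simp only [h]

theorem Tr_map_le {K : ℝ} (h : ∀ v, adjWt M N F v ≤ K * M.wt v) {x y : M.Obj} (f : x ⟶ y) :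
    (Tr N (F.map (f ≫ dag f))).re ≤ K * (Tr M (f ≫ dag f)).re := by
  obtain ⟨n, i, ⟨S⟩⟩ := FinSS.decomp x
  have hc : ∀ j, S.inc j ≫ (f ≫ dag f) ≫ dag (S.inc j) =
      ((nrm (S.inc j ≫ f) ^ 2 : ℝ) : ℂ) • 𝟙 (M.s (i j)) := fun j => by
    rw [← comp_dag_simple, dag_comp]; simp
  rw [Tr_map_coeff F S _ _ hc, Tr_pos_eq S]
  have h1 : ∀ j, ((nrm (S.inc j ≫ f) ^ 2 : ℝ) : ℂ) * (adjWt M N F (i j) : ℂ) =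
      ((nrm (S.inc j ≫ f) ^ 2 * adjWt M N F (i j) : ℝ) : ℂ) := fun j => by push_cast; rfl
  rw [Finset.sum_congr rfl fun j _ => h1 j, ← Complex.ofReal_sum, Complex.ofReal_re,
    Complex.ofReal_re, Finset.mul_sum]
  refine Finset.sum_le_sum fun j _ => ?_
  have := mul_le_mul_of_nonneg_left (h (i j)) (sq_nonneg (nrm (S.inc j ≫ f)))
  calc _ ≤ _ := this
    _ = _ := by ring

theorem adjWt_comp_eq {P : WSSC.{u₃, w₃}} (G : N.Obj ⥤ P.Obj) [StarLinear G] (v : M.V) :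
    ∃ (n : ℕ) (i : Fin n → N.V), adjWt M P (F ⋙ G) v = ∑ j, adjWt N P G (i j) ∧
      adjWt M N F v = ∑ j, N.wt (i j) := by
  haveI := StarLinear.comp F G
  obtain ⟨n, i, ⟨S⟩⟩ := FinSS.decomp (F.obj (M.s v))
  have hc : ∀ j, S.inc j ≫ 𝟙 _ ≫ dag (S.inc j) = (1 : ℂ) • 𝟙 (N.s (i j)) := fun j => by
    rw [Category.id_comp, S.isom, one_smul]
  refine ⟨n, i, ?_, ?_⟩
  · have h1 := Tr_id_map (F ⋙ G) v
    have h2 := Tr_map_coeff G S (𝟙 _) _ hc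
    rw [G.map_id] at h2
    have h3 := h1.symm.trans h2
    simp only [one_mul] at h3
    exact_mod_cast h3
  · have h1 := Tr_id_map F v
    have h2 := Tr_coeff S (𝟙 _) _ hc
    have h3 := h1.symm.trans h2
    simp only [one_mul] at h3
    exact_mod_cast h3

theorem adjWt_comp_le {P : WSSC.{u₃, w₃}} (G : N.Obj ⥤ P.Obj) [StarLinear G] {K : ℝ}
    (h : ∀ v, adjWt N P G v ≤ K * N.wt v) (v : M.V) :
    adjWt M P (F ⋙ G) v ≤ K * adjWt M N F v := by
  obtain ⟨n, i, h1, h2⟩ := adjWt_comp_eq F G v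
  rw [h1, h2, Finset.mul_sum]
  exact Finset.sum_le_sum fun j _ => h (i j)

theorem le_adjWt_comp {P : WSSC.{u₃, w₃}} (G : N.Obj ⥤ P.Obj) [StarLinear G] {K : ℝ}
    (h : ∀ v, K * N.wt v ≤ adjWt N P G v) (v : M.V) :
    K * adjWt M N F v ≤ adjWt M P (F ⋙ G) v := by
  obtain ⟨n, i, h1, h2⟩ := adjWt_comp_eq F G v
  rw [h1, h2, Finset.mul_sum]
  exact Finset.sum_le_sum fun j _ => h (i j)

end MapTrace

/-! ### Cells -/

/-- A tracial `0`-cell: weighted finite semisimple C*-categories `M k` and `*`-linear bi-faithful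
functors `F k : M k ⥤ M (k + 1)`, with `∑ v, μ⁰_v = 1` and `(F k)' μ^(k+1) = μ^k`. -/
structure ZeroCell where
  M : ℕ → WSSC.{u, w}
  F : ∀ k, (M k).Obj ⥤ (M (k + 1)).Obj
  star : ∀ k, StarLinear (F k)
  bifaithful : ∀ k, BiFaithful (F k)
  wt_zero : ∑ v, (M 0).wt v = 1
  wt_succ : ∀ k v, adjWt (M k) (M (k + 1)) (F k) v = (M k).wt v

attribute [instance] ZeroCell.star

namespace ZeroCell

/-- The object `m₀ = ⨁ v`, the sum running over the simple objects of `M 0`. -/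
noncomputable def m₀ (Γ : ZeroCell.{u, w}) : (Γ.M 0).Obj := (FinSS.directSum (Γ.M 0).s).choose

/-- The object `Γ_k ⋯ Γ_1 m₀` of `M k`. -/
noncomputable def x (Γ : ZeroCell.{u, w}) : ∀ k, (Γ.M k).Obj
  | 0 => Γ.m₀
  | k + 1 => (Γ.F k).obj (Γ.x k)

end ZeroCell

/-- A `1`-cell `Γ → Δ`: `*`-linear bi-faithful functors `L k : Γ.M k ⥤ Δ.M k`, natural unitaries
`W k : Δ_k L_k → L_(k+1) Γ_k`, and the boundedness condition
`ε μ^k_v ≤ [(L k)' ν^k]_v ≤ K μ^k_v`. -/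
structure OneCell (Γ : ZeroCell.{u₁, w₁}) (Δ : ZeroCell.{u₂, w₂}) where
  L : ∀ k, (Γ.M k).Obj ⥤ (Δ.M k).Obj
  star : ∀ k, StarLinear (L k)
  bifaithful : ∀ k, BiFaithful (L k)
  W : ∀ k, L k ⋙ Δ.F k ⟶ Γ.F k ⋙ L (k + 1)
  W_isom : ∀ k x, (W k).app x ≫ dag ((W k).app x) = 𝟙 _
  W_coisom : ∀ k x, dag ((W k).app x) ≫ (W k).app x = 𝟙 _
  bdd : ∃ ε K : ℝ, 0 < ε ∧ 0 < K ∧ ∀ k v, ε * (Γ.M k).wt v ≤ adjWt (Γ.M k) (Δ.M k) (L k) v ∧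
    adjWt (Γ.M k) (Δ.M k) (L k) v ≤ K * (Γ.M k).wt v

attribute [instance] OneCell.star

/-- The tensor product `Ω ⊠ Λ` of `1`-cells `Λ : Γ → Δ` and `Ω : Δ → Θ`: the functors are the
composites `Ω_k Λ_k` and the unitaries are `Θ_k Ω_k Λ_k → Ω_(k+1) Δ_k Λ_k → Ω_(k+1) Λ_(k+1) Γ_k`. -/
def OneCell.box {Γ : ZeroCell.{u₁, w₁}} {Δ : ZeroCell.{u₂, w₂}} {Θ : ZeroCell.{u₃, w₃}}
    (Ω : OneCell Δ Θ) (Λ : OneCell Γ Δ) : OneCell Γ Θ where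
  L k := Λ.L k ⋙ Ω.L k
  star k := StarLinear.comp (Λ.L k) (Ω.L k)
  bifaithful k := (Λ.bifaithful k).comp (Ω.bifaithful k)
  W k :=
    { app := fun x => (Ω.W k).app ((Λ.L k).obj x) ≫ (Ω.L (k + 1)).map ((Λ.W k).app x)
      naturality := fun x y f => by
        have h1 := (Ω.W k).naturality ((Λ.L k).map f)
        have h2 := congrArg (Ω.L (k + 1)).map ((Λ.W k).naturality f)
        simp only [Functor.comp_map, Functor.comp_obj, Functor.map_comp] at h1 h2 ⊢
        rw [reassoc_of% h1, h2, Category.assoc] }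
  W_isom k x := by
    have h1 := (Ω.W_isom k) ((Λ.L k).obj x)
    have h2 := congrArg (Ω.L (k + 1)).map (Λ.W_isom k x)
    have h3 := (Ω.L (k + 1)).map_id ((Λ.L k ⋙ Δ.F k).obj x)
    rw [h3, Functor.map_comp, StarLinear.map_dag] at h2
    simp only [dag_comp, Category.assoc]
    rw [reassoc_of% h2]
    exact h1
  W_coisom k x := by
    have h1 := (Ω.W_coisom k) ((Λ.L k).obj x)
    have h2 := congrArg (Ω.L (k + 1)).map (Λ.W_coisom k x)
    have h3 := (Ω.L (k + 1)).map_id ((Γ.F k ⋙ Λ.L (k + 1)).obj x)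
    rw [h3, Functor.map_comp, StarLinear.map_dag] at h2
    simp only [dag_comp, Category.assoc]
    rw [reassoc_of% h1]
    exact h2
  bdd := by
    obtain ⟨ε₁, K₁, hε₁, hK₁, h₁⟩ := Λ.bdd
    obtain ⟨ε₂, K₂, hε₂, hK₂, h₂⟩ := Ω.bdd
    refine ⟨ε₂ * ε₁, K₂ * K₁, by positivity, by positivity, fun k v => ⟨?_, ?_⟩⟩
    · refine le_trans ?_ (le_adjWt_comp (Λ.L k) (Ω.L k) (fun v => (h₂ k v).1) v)
      rw [mul_assoc]
      exact mul_le_mul_of_nonneg_left (h₁ k v).1 hε₂.le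
    · refine le_trans (adjWt_comp_le (Λ.L k) (Ω.L k) (fun v => (h₂ k v).2) v) ?_
      rw [mul_assoc]
      exact mul_le_mul_of_nonneg_left (h₁ k v).2 hK₂.le

/-- A solution `(ρ, ρ')` of the conjugate equations for a `*`-linear functor `F` with a `*`-linear
adjoint `adj`, tracial and commensurate with the weights `(μ, ν)`: for the simple objects `v`, `v'`
and `σ, τ : v' ⟶ F v` one has `(ρ'_v)* adj(σ τ*) ρ'_v = (ν_v' / μ_v) ⟨σ, τ⟩ 1_v`, where
`⟨σ, τ⟩ 1_v' = τ* σ`. -/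
structure TracialSolution (M : WSSC.{u₁, w₁}) (N : WSSC.{u₂, w₂}) (F : M.Obj ⥤ N.Obj) where
  adj : N.Obj ⥤ M.Obj
  star : StarLinear adj
  ρ : 𝟭 N.Obj ⟶ adj ⋙ F
  ρ' : 𝟭 M.Obj ⟶ F ⋙ adj
  conj₁ : ∀ x, F.map (ρ'.app x) ≫ dag (ρ.app (F.obj x)) = 𝟙 (F.obj x)
  conj₂ : ∀ y, ρ'.app (adj.obj y) ≫ adj.map (dag (ρ.app y)) = 𝟙 (adj.obj y)
  tracial : ∀ (v : M.V) (v' : N.V) (σ τ : N.s v' ⟶ F.obj (M.s v)) (c : ℂ),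
    σ ≫ dag τ = c • 𝟙 (N.s v') →
    ρ'.app (M.s v) ≫ adj.map (dag τ ≫ σ) ≫ dag (ρ'.app (M.s v)) =
      (((N.wt v' / M.wt v : ℝ) : ℂ) * c) • 𝟙 (M.s v)

attribute [instance] TracialSolution.star

section Loop

variable {Γ : ZeroCell.{u₁, w₁}} {Δ : ZeroCell.{u₂, w₂}} {Λ Ω : OneCell Γ Δ}

/-- The loop operator `S : NT(Λ_(k+1), Ω_(k+1)) → NT(Λ_k, Ω_k)`, the cup and the cap being those
of a tracial solution `t` for `Δ_k`. -/
def loop (k : ℕ) (t : TracialSolution (Δ.M k) (Δ.M (k + 1)) (Δ.F k))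
    (η : Λ.L (k + 1) ⟶ Ω.L (k + 1)) : Λ.L k ⟶ Ω.L k where
  app x := t.ρ'.app ((Λ.L k).obj x) ≫
    t.adj.map ((Λ.W k).app x ≫ η.app ((Γ.F k).obj x) ≫ dag ((Ω.W k).app x)) ≫
    dag (t.ρ'.app ((Ω.L k).obj x))
  naturality x y f := by
    have h1 := t.ρ'.naturality ((Λ.L k).map f)
    have h2 := (Λ.W k).naturality f
    have h3 := η.naturality ((Γ.F k).map f)
    have h4 := congrArg dag ((Ω.W k).naturality (dag f))
    have h5 := congrArg dag (t.ρ'.naturality ((Ω.L k).map (dag f)))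
    simp only [Functor.comp_map, Functor.comp_obj, Functor.id_map, Functor.id_obj, dag_comp,
      ← StarLinear.map_dag, dag_dag] at h1 h2 h3 h4 h5 ⊢
    rw [reassoc_of% h1, Category.assoc, Category.assoc, h5]
    congr 1
    rw [← Functor.map_comp_assoc, ← Functor.map_comp_assoc]
    congr 2
    rw [reassoc_of% h2, reassoc_of% h3]
    simp only [Category.assoc]
    rw [h4]

variable (t : ∀ k, TracialSolution (Δ.M k) (Δ.M (k + 1)) (Δ.F k))

/-- The iterated loop operator `S_(k+1) ⋯ S_(k+l) : NT(Λ_(k+l), Ω_(k+l)) → NT(Λ_k, Ω_k)`. -/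
def loopIter (k : ℕ) : ∀ l : ℕ, (Λ.L (k + l) ⟶ Ω.L (k + l)) → (Λ.L k ⟶ Ω.L k)
  | 0, η => η
  | l + 1, η => loopIter k l (loop (k + l) (t (k + l)) η)

/-- Bounded quasi-flat sequences (BQFS) from `Λ` to `Ω`; the C*-norm of a natural transformation
is the supremum of the norms of its components. -/
structure IsBQFS (η : ∀ k, Λ.L k ⟶ Ω.L k) : Prop where
  quasiflat : ∀ k, loop k (t k) (η (k + 1)) = η k
  bounded : ∃ K : ℝ, ∀ k x, nrm ((η k).app x) ≤ K

end Loop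

/-- Convergence `a l → b` in the C*-norm of a space `NT(F, G)` of natural transformations. -/
def NTTendsto {M : WSSC.{u₁, w₁}} {N : WSSC.{u₂, w₂}} {F G : M.Obj ⥤ N.Obj}
    (a : ℕ → (F ⟶ G)) (b : F ⟶ G) : Prop :=
  ∀ ε > 0, ∃ l₀, ∀ l ≥ l₀, ∀ x, nrm ((a l).app x - b.app x) ≤ ε

/-! ### Towers and the Hilbert spaces attached to them -/

/-- A sequence of objects `y k` of `Δ.M k` with unitaries `Δ_k (y k) → y (k + 1)`. -/
structure Tower (Δ : ZeroCell.{u, w}) where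
  obj : ∀ k, (Δ.M k).Obj
  u : ∀ k, (Δ.F k).obj (obj k) ⟶ obj (k + 1)
  u_isom : ∀ k, u k ≫ dag (u k) = 𝟙 _
  u_coisom : ∀ k, dag (u k) ≫ u k = 𝟙 _

/-- The tower `Δ_k ⋯ Δ_1 n₀`. -/
noncomputable def ZeroCell.base (Δ : ZeroCell.{u, w}) : Tower Δ where
  obj := Δ.x
  u k := 𝟙 (Δ.x (k + 1))
  u_isom k := (congrArg (fun z => 𝟙 (Δ.x (k + 1)) ≫ z) (dag_id _)).trans (Category.comp_id _)
  u_coisom k := (congrArg (fun z => z ≫ 𝟙 (Δ.x (k + 1))) (dag_id _)).trans (Category.comp_id _)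

/-- The tower `Λ_k Γ_k ⋯ Γ_1 m₀` of a `1`-cell, with the unitaries of the connection. -/
noncomputable def OneCell.tower {Γ : ZeroCell.{u₁, w₁}} {Δ : ZeroCell.{u₂, w₂}}
    (Λ : OneCell Γ Δ) : Tower Δ where
  obj k := (Λ.L k).obj (Γ.x k)
  u k := (Λ.W k).app (Γ.x k)
  u_isom k := Λ.W_isom k _
  u_coisom k := Λ.W_coisom k _

section Towers

variable {Δ : ZeroCell.{u, w}}

/-- Sequences of morphisms `γ k : y k ⟶ y' k` which are eventually compatible with the
inclusions `γ ↦ u' ∘ Δ_k(γ) ∘ u*`.  Modulo the sequences which are eventually `0`, this is the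
inductive limit of the spaces `Hom(y k, y' k)` along these inclusions.  In particular
`EvHom base base` represents `B_∞ = ⋃ End(Δ_k ⋯ Δ_1 n₀)` and `EvHom base Λ.tower`
represents `H_∞ = ⋃ Hom(Δ_k ⋯ Δ_1 n₀, Λ_k Γ_k ⋯ Γ_1 m₀)`. -/
def evHomSub (y y' : Tower Δ) : Submodule ℂ (∀ k, y.obj k ⟶ y'.obj k) where
  carrier := {γ | ∀ᶠ k in atTop, y.u k ≫ γ (k + 1) = (Δ.F k).map (γ k) ≫ y'.u k}
  add_mem' := fun {a b} ha hb => by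
    filter_upwards [ha, hb] with k h1 h2
    simp only [Pi.add_apply, Preadditive.comp_add, h1, h2, StarLinear.map_add,
      Preadditive.add_comp]
  zero_mem' := by
    refine Eventually.of_forall fun k => ?_
    simp only [Pi.zero_apply, StarLinear.map_zero, Limits.zero_comp, Limits.comp_zero]
  smul_mem' := fun c a ha => by
    filter_upwards [ha] with k h1
    simp only [Pi.smul_apply, Linear.comp_smul, h1, StarLinear.map_smul, Linear.smul_comp]

/-- The space `evHomSub y y'` of eventually compatible sequences, as a type. -/
def EvHom (y y' : Tower Δ) : Type w := evHomSub y y'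

instance (y y' : Tower Δ) : AddCommGroup (EvHom y y') := inferInstanceAs (AddCommGroup (evHomSub y y'))

instance (y y' : Tower Δ) : Module ℂ (EvHom y y') := inferInstanceAs (Module ℂ (evHomSub y y'))

variable {y y' y'' y₃ : Tower Δ}

namespace EvHom

/-- The terms of the sequence. -/
def val (γ : EvHom y y') (k : ℕ) : y.obj k ⟶ y'.obj k := γ.1 k

@[simp] theorem add_val (a b : EvHom y y') (k : ℕ) : (a + b).val k = a.val k + b.val k := rfl

@[simp] theorem smul_val (c : ℂ) (a : EvHom y y') (k : ℕ) : (c • a).val k = c • a.val k := rfl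

theorem ev (γ : EvHom y y') :
    ∀ᶠ k in atTop, y.u k ≫ γ.val (k + 1) = (Δ.F k).map (γ.val k) ≫ y'.u k := γ.2

@[ext] theorem ext {γ δ : EvHom y y'} (h : ∀ k, γ.val k = δ.val k) : γ = δ := Subtype.ext (funext h)

/-- Levelwise composition `δ ∘ γ`. -/
def comp (γ : EvHom y y') (δ : EvHom y' y'') : EvHom y y'' :=
  ⟨fun k => γ.val k ≫ δ.val k, by
    filter_upwards [γ.ev, δ.ev] with k h1 h2
    rw [reassoc_of% h1, h2, Functor.map_comp, Category.assoc]⟩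

@[simp] theorem comp_val (γ : EvHom y y') (δ : EvHom y' y'') (k : ℕ) :
    (γ.comp δ).val k = γ.val k ≫ δ.val k := rfl

/-- Levelwise adjoint. -/
def dag (γ : EvHom y y') : EvHom y' y :=
  ⟨fun k => CStarCat.dag (γ.val k), by
    filter_upwards [γ.ev] with k h1
    have h2 := congrArg CStarCat.dag h1
    rw [dag_comp, dag_comp, ← StarLinear.map_dag] at h2
    calc y'.u k ≫ CStarCat.dag (γ.val (k + 1))
        = y'.u k ≫ (CStarCat.dag (γ.val (k + 1)) ≫ CStarCat.dag (y.u k)) ≫ y.u k := by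
          simp only [Category.assoc, y.u_coisom, Category.comp_id]
      _ = _ := by
          rw [h2, ← Category.assoc, ← Category.assoc, y'.u_isom, Category.id_comp]⟩

@[simp] theorem dag_val (γ : EvHom y y') (k : ℕ) : γ.dag.val k = CStarCat.dag (γ.val k) := rfl

/-- The identity. -/
def id (y : Tower Δ) : EvHom y y :=
  ⟨fun k => 𝟙 (y.obj k), Eventually.of_forall fun k => by simp⟩

@[simp] theorem id_val (k : ℕ) : (id y).val k = 𝟙 (y.obj k) := rfl

theorem comp_assoc (a : EvHom y y') (b : EvHom y' y'') (c : EvHom y'' y₃) :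
    (a.comp b).comp c = a.comp (b.comp c) := by ext k; simp

theorem dag_dag (a : EvHom y y') : a.dag.dag = a := by ext k; simp [CStarCat.dag_dag]

theorem dag_comp (a : EvHom y y') (b : EvHom y' y'') :
    (a.comp b).dag = b.dag.comp a.dag := by ext k; simp [CStarCat.dag_comp]

theorem id_comp (a : EvHom y y') : (id y).comp a = a := by ext k; simp

theorem comp_id (a : EvHom y y') : a.comp (id y') = a := by ext k; simp

theorem dag_id : (id y).dag = id y := by ext k; simp [UC.dag_id]

theorem dag_add (a b : EvHom y y') : (a + b).dag = a.dag + b.dag := by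
  ext k; simp [CStarCat.dag_add]

theorem dag_smul (c : ℂ) (a : EvHom y y') : (c • a).dag = conj c • a.dag := by
  ext k; simp [CStarCat.dag_smul]

theorem comp_add (a : EvHom y y') (b c : EvHom y' y'') :
    a.comp (b + c) = a.comp b + a.comp c := by ext k; simp

theorem add_comp (a b : EvHom y y') (c : EvHom y' y'') :
    (a + b).comp c = a.comp c + b.comp c := by ext k; simp

theorem comp_smul (r : ℂ) (a : EvHom y y') (b : EvHom y' y'') :
    a.comp (r • b) = r • a.comp b := by ext k; simp

theorem smul_comp (r : ℂ) (a : EvHom y y') (b : EvHom y' y'') :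
    (r • a).comp b = r • a.comp b := by ext k; simp

/-- eventually compatible sequences are eventually bounded in norm -/
theorem exists_bound (γ : EvHom y y') : ∃ K : ℝ, 0 ≤ K ∧ ∀ᶠ k in atTop, nrm (γ.val k) ≤ K := by
  obtain ⟨N, hN⟩ := eventually_atTop.1 γ.ev
  refine ⟨nrm (γ.val N), nrm_nonneg _, eventually_atTop.2 ⟨N, fun k hk => ?_⟩⟩
  induction k, hk using Nat.le_induction with
  | base => exact le_rfl
  | succ k hk ih =>
    have h : γ.val (k + 1) = CStarCat.dag (y.u k) ≫ (Δ.F k).map (γ.val k) ≫ y'.u k := by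
      rw [← hN k hk, ← Category.assoc, y.u_coisom, Category.id_comp]
    have h1 : nrm (CStarCat.dag (y.u k)) ≤ 1 := by rw [nrm_dag]; exact nrm_isom _ (y.u_isom k)
    have h2 : nrm (y'.u k) ≤ 1 := nrm_isom _ (y'.u_isom k)
    have h3 := StarLinear.nrm_map_le (Δ.F k) (γ.val k)
    rw [h]
    refine (nrm_comp_le _ _).trans ((mul_le_of_le_one_left (nrm_nonneg _) h1).trans ?_)
    refine (nrm_comp_le _ _).trans ((mul_le_of_le_one_right (nrm_nonneg _) h2).trans ?_)
    exact h3.trans ih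

theorem Tr_map_isom {M : WSSC.{u₁, w₁}} {N : WSSC.{u₂, w₂}} (F : M.Obj ⥤ N.Obj) [StarLinear F]
    (h : ∀ v, adjWt M N F v = M.wt v) {x y : M.Obj} {z : N.Obj} (a b : x ⟶ y)
    (u : F.obj y ⟶ z) (hu : u ≫ CStarCat.dag u = 𝟙 _) :
    Tr N ((F.map a ≫ u) ≫ CStarCat.dag (F.map b ≫ u)) = Tr M (a ≫ CStarCat.dag b) := by
  rw [← Tr_map_eq F h, CStarCat.dag_comp, Category.assoc, ← Category.assoc u, hu,
    Category.id_comp, Functor.map_comp, StarLinear.map_dag]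

/-- The sequence `k ↦ Tr(ξ_k* η_k)` is eventually constant; `form` is its limit. -/
noncomputable def form (ξ η : EvHom Δ.base y) : ℂ :=
  limUnder atTop fun k => Tr (Δ.M k) (η.val k ≫ CStarCat.dag (ξ.val k))

theorem form_eq (ξ η : EvHom Δ.base y) :
    ∀ᶠ k in atTop, form ξ η = Tr (Δ.M k) (η.val k ≫ CStarCat.dag (ξ.val k)) := by
  obtain ⟨N, hN⟩ := eventually_atTop.1 (ξ.ev.and η.ev)
  have hc : ∀ k ≥ N, Tr (Δ.M k) (η.val k ≫ CStarCat.dag (ξ.val k)) =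
      Tr (Δ.M N) (η.val N ≫ CStarCat.dag (ξ.val N)) := by
    intro k hk
    induction k, hk using Nat.le_induction with
    | base => rfl
    | succ k hk ih =>
      rw [← ih]
      obtain ⟨h1, h2⟩ := hN k hk
      have hu : ∀ (f : Δ.x (k + 1) ⟶ y.obj (k + 1)), Δ.base.u k ≫ f = f :=
        fun f => Category.id_comp f
      have h1' : ξ.val (k + 1) = (Δ.F k).map (ξ.val k) ≫ y.u k := (hu _).symm.trans h1
      have h2' : η.val (k + 1) = (Δ.F k).map (η.val k) ≫ y.u k := (hu _).symm.trans h2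
      rw [h1', h2']
      exact Tr_map_isom (Δ.F k) (Δ.wt_succ k) (η.val k) (ξ.val k) (y.u k) (y.u_isom k)
  have hl : Tendsto (fun k => Tr (Δ.M k) (η.val k ≫ CStarCat.dag (ξ.val k))) atTop
      (𝓝 (Tr (Δ.M N) (η.val N ≫ CStarCat.dag (ξ.val N)))) :=
    tendsto_const_nhds.congr' (by
      filter_upwards [eventually_ge_atTop N] with k hk using (hc k hk).symm)
  filter_upwards [eventually_ge_atTop N] with k hk
  rw [form, hl.limUnder_eq, hc k hk]

end EvHom

/-- The pre-Hilbert space `⋃ Hom(Δ_k ⋯ Δ_1 n₀, y k)` with the inner product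
`⟪ξ, η⟫ = Tr(ξ* η)` (linear in the second variable). -/
def PreH (y : Tower Δ) : Type w := EvHom Δ.base y

noncomputable instance (y : Tower Δ) : AddCommGroup (PreH y) :=
  inferInstanceAs (AddCommGroup (EvHom Δ.base y))

noncomputable instance (y : Tower Δ) : Module ℂ (PreH y) :=
  inferInstanceAs (Module ℂ (EvHom Δ.base y))

/-- The positive semidefinite form on `PreH y`. -/
@[reducible] noncomputable def PreH.core (y : Tower Δ) : PreInnerProductSpace.Core ℂ (PreH y) where
  inner ξ η := EvHom.form (y := y) ξ η
  conj_inner_symm ξ η := by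
    obtain ⟨k, h1, h2⟩ := ((EvHom.form_eq (y := y) ξ η).and (EvHom.form_eq (y := y) η ξ)).exists
    rw [h1, h2, ← Tr_dag, dag_comp, dag_dag]
  re_inner_nonneg ξ := by
    obtain ⟨k, h⟩ := (EvHom.form_eq (y := y) ξ ξ).exists
    rw [h]
    exact Tr_nonneg _
  add_left ξ ξ' η := by
    obtain ⟨k, h1, h2, h3⟩ := ((EvHom.form_eq (y := y) (ξ + ξ') η).and
      ((EvHom.form_eq (y := y) ξ η).and (EvHom.form_eq (y := y) ξ' η))).exists
    rw [h1, h2, h3, ← Tr_add, ← Preadditive.comp_add, ← dag_add]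
    rfl
  smul_left ξ η c := by
    obtain ⟨k, h1, h2⟩ := ((EvHom.form_eq (y := y) (c • ξ) η).and
      (EvHom.form_eq (y := y) ξ η)).exists
    rw [h1, h2, ← Tr_smul, ← Linear.comp_smul, ← dag_smul]
    rfl

noncomputable instance (y : Tower Δ) : SeminormedAddCommGroup (PreH y) :=
  letI := PreH.core y
  InnerProductSpace.Core.toSeminormedAddCommGroup (𝕜 := ℂ)

noncomputable instance (y : Tower Δ) : InnerProductSpace ℂ (PreH y) :=
  InnerProductSpace.ofCore (PreH.core y)

theorem PreH.inner_def (ξ η : PreH y) : inner ℂ ξ η = EvHom.form (y := y) ξ η := rfl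

/-- The Hilbert space completion of `⋃ Hom(Δ_k ⋯ Δ_1 n₀, y k)`. -/
abbrev Hilb (y : Tower Δ) : Type w := UniformSpace.Completion (PreH y)

/-- The canonical map `⋃ Hom(Δ_k ⋯ Δ_1 n₀, y k) → Hilb y`, with dense range. -/
noncomputable def ι (y : Tower Δ) : EvHom Δ.base y →ₗ[ℂ] Hilb y where
  toFun := ((↑) : PreH y → UniformSpace.Completion (PreH y))
  map_add' ξ η := UniformSpace.Completion.coe_add (α := PreH y) ξ η
  map_smul' c ξ := UniformSpace.Completion.coe_smul (X := PreH y) c ξ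

theorem ι_dense (y : Tower Δ) : DenseRange (ι y) :=
  UniformSpace.Completion.denseRange_coe (α := PreH y)

theorem inner_ι (ξ η : EvHom Δ.base y) : inner ℂ (ι y ξ) (ι y η) = EvHom.form ξ η :=
  UniformSpace.Completion.inner_coe (𝕜 := ℂ) (E := PreH y) ξ η

theorem inner_ι_comp (ξ : EvHom Δ.base y) (η : EvHom Δ.base y') (γ : EvHom y y') :
    inner ℂ (ι y' (ξ.comp γ)) (ι y' η) = inner ℂ (ι y ξ) (ι y (η.comp γ.dag)) := by
  rw [inner_ι, inner_ι]
  obtain ⟨k, h1, h2⟩ := ((EvHom.form_eq (ξ.comp γ) η).and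
    (EvHom.form_eq ξ (η.comp γ.dag))).exists
  rw [h1, h2]
  simp [CStarCat.dag_comp]

theorem norm_ι_sq (ξ : EvHom Δ.base y) : ‖ι y ξ‖ ^ 2 = (EvHom.form ξ ξ).re := by
  rw [← inner_ι, ← inner_self_eq_norm_sq (𝕜 := ℂ)]; rfl

theorem norm_ι_comp_le (γ : EvHom y y') {K : ℝ} (hK : 0 ≤ K)
    (h : ∀ᶠ k in atTop, nrm (γ.val k) ≤ K) (ξ : EvHom Δ.base y) :
    ‖ι y' (ξ.comp γ)‖ ≤ K * ‖ι y ξ‖ := by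
  refine (pow_le_pow_iff_left₀ (norm_nonneg _) (by positivity) two_ne_zero).1 ?_
  rw [mul_pow, norm_ι_sq, norm_ι_sq]
  obtain ⟨k, h0, h1, h2⟩ := (h.and ((EvHom.form_eq (ξ.comp γ) (ξ.comp γ)).and
    (EvHom.form_eq ξ ξ))).exists
  rw [h1, h2]
  refine (Tr_bound (ξ.val k) (γ.val k)).trans ?_
  exact mul_le_mul_of_nonneg_right (pow_le_pow_left₀ (nrm_nonneg _) h0 2) (Tr_nonneg _)

/-- `ξ ↦ γ ∘ ξ` on the dense subspace. -/
noncomputable def Φ₀ (γ : EvHom y y') : EvHom Δ.base y →ₗ[ℂ] Hilb y' where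
  toFun ξ := ι y' (ξ.comp γ)
  map_add' a b := by rw [EvHom.add_comp, map_add]
  map_smul' r a := by rw [EvHom.smul_comp, map_smul]; rfl

/-- The bounded operator `Φ_γ : Hilb y → Hilb y'`, `ξ ↦ γ ∘ ξ`. -/
noncomputable def Φ (γ : EvHom y y') : Hilb y →L[ℂ] Hilb y' :=
  (Φ₀ γ).extendOfNorm (ι y)

theorem norm_Φ_aux (γ : EvHom y y') : ∃ K, ∀ ξ : EvHom Δ.base y,
    ‖ι y' (ξ.comp γ)‖ ≤ K * ‖ι y ξ‖ := by
  obtain ⟨K, hK, h⟩ := γ.exists_bound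
  exact ⟨K, fun ξ => norm_ι_comp_le γ hK h ξ⟩

theorem Φ_ι (γ : EvHom y y') (ξ : EvHom Δ.base y) : Φ γ (ι y ξ) = ι y' (ξ.comp γ) := by
  exact LinearMap.extendOfNorm_eq (f := Φ₀ γ) (ι_dense y) (norm_Φ_aux γ) ξ

/-- two bounded operators on `Hilb y` agreeing on the canonical dense subspace are equal -/
theorem Hilb.ext {G : Type*} [NormedAddCommGroup G] [NormedSpace ℂ G] {S T : Hilb y →L[ℂ] G}
    (h : ∀ ξ, S (ι y ξ) = T (ι y ξ)) : S = T :=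
  ContinuousLinearMap.coeFn_injective ((ι_dense y).equalizer S.continuous T.continuous (funext h))

theorem Hilb.ext_inner {a b : Hilb y} (h : ∀ ξ, inner ℂ (ι y ξ) a = inner ℂ (ι y ξ) b) : a = b := by
  refine ext_inner_left ℂ fun v => ?_
  have h1 : Continuous fun v : Hilb y => inner ℂ v a := by fun_prop
  have h2 : Continuous fun v : Hilb y => inner ℂ v b := by fun_prop
  exact congrFun ((ι_dense y).equalizer h1 h2 (funext h)) v

theorem Φ_comp (γ : EvHom y y') (δ : EvHom y' y'') : Φ (γ.comp δ) = Φ δ ∘L Φ γ :=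
  Hilb.ext fun ξ => by
    rw [ContinuousLinearMap.comp_apply, Φ_ι, Φ_ι, Φ_ι, EvHom.comp_assoc]

theorem Φ_id : Φ (EvHom.id y) = ContinuousLinearMap.id ℂ (Hilb y) :=
  Hilb.ext fun ξ => by rw [Φ_ι, EvHom.comp_id]; rfl

theorem Φ_dag (γ : EvHom y y') : Φ γ.dag = ContinuousLinearMap.adjoint (Φ γ) :=
  Hilb.ext fun ξ => Hilb.ext_inner fun η => by
    rw [ContinuousLinearMap.adjoint_inner_right, Φ_ι, Φ_ι, inner_ι_comp]

end Towers

/-! ### Operators on Hilbert spaces -/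

open ContinuousLinearMap (adjoint)
open scoped InnerProductSpace

section Operators

variable {L : Type v₁} [NormedAddCommGroup L] [InnerProductSpace ℂ L] [CompleteSpace L]
  {H : Type v₂} [NormedAddCommGroup H] [InnerProductSpace ℂ H] [CompleteSpace H]
  {K : Type v₃} [NormedAddCommGroup K] [InnerProductSpace ℂ K] [CompleteSpace K]

theorem isPositive_adjoint_comp (T : L →L[ℂ] H) : 0 ≤ adjoint T ∘L T := by
  rw [ContinuousLinearMap.nonneg_iff_isPositive]
  exact ContinuousLinearMap.isPositive_adjoint_comp_self T

/-- a positive operator has a self-adjoint square root commuting with everything that it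
commutes with -/
theorem exists_sqrt (a : L →L[ℂ] L) (ha : 0 ≤ a) :
    ∃ q : L →L[ℂ] L, adjoint q = q ∧ q * q = a ∧ ∀ x, Commute a x → Commute q x := by
  refine ⟨CFC.sqrt a, ?_, CFC.sqrt_mul_sqrt_self a ha, fun x hx => ?_⟩
  · exact (IsSelfAdjoint.of_nonneg (CFC.sqrt_nonneg a)).star_eq
  · rw [CFC.sqrt_eq_cfc]
    exact hx.cfc_nnreal _

theorem exists_factor (T : L →L[ℂ] H) :
    ∃ q : L →L[ℂ] L, adjoint q = q ∧ q * q = adjoint T ∘L T ∧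
      ∀ x, Commute (adjoint T ∘L T) x → Commute q x :=
  exists_sqrt _ (isPositive_adjoint_comp T)

/-- a square root of `‖T‖² - T* T` -/
theorem exists_defect (T : L →L[ℂ] H) :
    ∃ q : L →L[ℂ] L, adjoint q = q ∧
      q * q = ((‖T‖ ^ 2 : ℝ) : ℂ) • (1 : L →L[ℂ] L) - adjoint T ∘L T ∧
      ∀ x, Commute (adjoint T ∘L T) x → Commute q x := by
  obtain ⟨q, h1, h2, h3⟩ := exists_sqrt
    (((‖T‖ ^ 2 : ℝ) : ℂ) • (1 : L →L[ℂ] L) - adjoint T ∘L T) (by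
      rw [ContinuousLinearMap.nonneg_iff_isPositive, ContinuousLinearMap.isPositive_def']
      refine ⟨?_, fun v => ?_⟩
      · rw [IsSelfAdjoint, star_sub, star_smul, star_one,
          (IsSelfAdjoint.of_nonneg (isPositive_adjoint_comp T)).star_eq]
        congr 2
        exact Complex.conj_ofReal _
      · have h : ‖T v‖ ^ 2 ≤ (‖T‖ * ‖v‖) ^ 2 :=
          pow_le_pow_left₀ (norm_nonneg _) (T.le_opNorm v) 2
        rw [ContinuousLinearMap.reApplyInnerSelf_apply, sub_apply,
          inner_sub_left, ContinuousLinearMap.comp_apply, ContinuousLinearMap.adjoint_inner_left,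
          smul_apply, one_apply_eq_self, inner_smul_left,
          map_sub, inner_self_eq_norm_sq, Complex.conj_ofReal]
        simp only [RCLike.re_to_complex, Complex.re_ofReal_mul]
        have h' := inner_self_eq_norm_sq (𝕜 := ℂ) v
        rw [RCLike.re_to_complex] at h'
        rw [h']
        nlinarith)
  refine ⟨q, h1, h2, fun x hx => h3 x ?_⟩
  refine Commute.sub_left ?_ hx
  exact (Commute.one_left x).smul_left _

theorem norm_apply_le_of_commute (T : L →L[ℂ] H) (x : L →L[ℂ] L)
    (h : Commute (adjoint T ∘L T) x) (v : L) : ‖T (x v)‖ ≤ ‖x‖ * ‖T v‖ := by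
  obtain ⟨q, h1, h2, h3⟩ := exists_factor T
  have hq : ∀ w, ‖q w‖ = ‖T w‖ := fun w => by
    rw [← sq_eq_sq₀ (norm_nonneg _) (norm_nonneg _), ← inner_self_eq_norm_sq (𝕜 := ℂ),
      ← inner_self_eq_norm_sq (𝕜 := ℂ), ← ContinuousLinearMap.adjoint_inner_right,
      ← ContinuousLinearMap.adjoint_inner_right T, h1]
    have := congrArg (fun z : L →L[ℂ] L => z w) h2
    simp only [mul_apply_eq_comp, ContinuousLinearMap.comp_apply] at this
    rw [this]
  have hc := congrArg (fun z : L →L[ℂ] L => z v) (h3 x h).eq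
  simp only [mul_apply_eq_comp] at hc
  rw [← hq, hc, ← hq]
  exact x.le_opNorm _

/-- Data for extending an action along a dense subspace `e : E → H` of "bounded vectors": every
`ξ ∈ E` has a bounded operator `R ξ : L → H` with `R ξ ω = e ξ`, and the operators
`(R ζ)* R ξ` commute with the star-closed set `S` of operators on `L`. -/
structure ExtDatum (L : Type v₁) [NormedAddCommGroup L] [InnerProductSpace ℂ L] [CompleteSpace L]
    (H : Type v₂) [NormedAddCommGroup H] [InnerProductSpace ℂ H] [CompleteSpace H]
    (E : Type v₃) [AddCommGroup E] [Module ℂ E] where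
  e : E →ₗ[ℂ] H
  dense : DenseRange e
  R : E →ₗ[ℂ] (L →L[ℂ] H)
  ω : L
  R_ω : ∀ ξ, R ξ ω = e ξ
  S : Set (L →L[ℂ] L)
  S_star : ∀ x ∈ S, adjoint x ∈ S
  comm : ∀ ξ ζ, ∀ x ∈ S, Commute (adjoint (R ζ) ∘L R ξ) x

namespace ExtDatum

variable {E : Type v₃} [AddCommGroup E] [Module ℂ E] (X : ExtDatum L H E)

/-- The double commutant of `S`. -/
def SS : Set (L →L[ℂ] L) := Set.centralizer (Set.centralizer X.S)

theorem comm' {x : L →L[ℂ] L} (hx : x ∈ X.SS) {T : L →L[ℂ] L} (hT : ∀ s ∈ X.S, Commute T s) :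
    Commute T x :=
  hx T fun s hs => (hT s hs).eq.symm

theorem star_SS {x : L →L[ℂ] L} (hx : x ∈ X.SS) : adjoint x ∈ X.SS := by
  intro T hT
  have h1 : adjoint T ∈ Set.centralizer X.S := fun s hs => by
    have := congrArg star (hT _ (X.S_star s hs))
    rw [star_mul, star_mul, ContinuousLinearMap.star_eq_adjoint,
      ContinuousLinearMap.star_eq_adjoint, ContinuousLinearMap.adjoint_adjoint] at this
    exact this.symm
  have := congrArg star (hx _ h1)
  rw [star_mul, star_mul, ContinuousLinearMap.star_eq_adjoint,
    ContinuousLinearMap.star_eq_adjoint, ContinuousLinearMap.adjoint_adjoint] at this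
  exact this.symm

/-- `ξ ↦ R ξ (x ω)`. -/
def act₀ (x : L →L[ℂ] L) : E →ₗ[ℂ] H where
  toFun ξ := X.R ξ (x X.ω)
  map_add' a b := by rw [map_add]; rfl
  map_smul' c a := by rw [map_smul]; rfl

/-- The operator on `H` determined by `R ξ ω ↦ R ξ (x ω)`. -/
noncomputable def act (x : L →L[ℂ] L) : H →L[ℂ] H := (X.act₀ x).extendOfNorm X.e

theorem act_bound {x : L →L[ℂ] L} (hx : x ∈ X.SS) (ξ : E) :
    ‖X.act₀ x ξ‖ ≤ ‖x‖ * ‖X.e ξ‖ := by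
  rw [← X.R_ω]
  exact norm_apply_le_of_commute _ _ (X.comm' hx (X.comm ξ ξ)) _

theorem act_e {x : L →L[ℂ] L} (hx : x ∈ X.SS) (ξ : E) : X.act x (X.e ξ) = X.R ξ (x X.ω) :=
  LinearMap.extendOfNorm_eq (f := X.act₀ x) X.dense ⟨‖x‖, X.act_bound hx⟩ ξ

theorem norm_act_le {x : L →L[ℂ] L} (hx : x ∈ X.SS) : ‖X.act x‖ ≤ ‖x‖ :=
  LinearMap.opNorm_extendOfNorm_le X.dense (norm_nonneg _) (X.act_bound hx)

theorem ext_e {G : Type*} [NormedAddCommGroup G] [NormedSpace ℂ G] {S T : H →L[ℂ] G}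
    (h : ∀ ξ, S (X.e ξ) = T (X.e ξ)) : S = T :=
  ContinuousLinearMap.coeFn_injective (X.dense.equalizer S.continuous T.continuous (funext h))

theorem ext_inner {a b : H} (h : ∀ ξ, ⟪X.e ξ, a⟫_ℂ = ⟪X.e ξ, b⟫_ℂ) : a = b := by
  refine ext_inner_left ℂ fun v => ?_
  have h1 : Continuous fun v : H => ⟪v, a⟫_ℂ := by fun_prop
  have h2 : Continuous fun v : H => ⟪v, b⟫_ℂ := by fun_prop
  exact congrFun (X.dense.equalizer h1 h2 (funext h)) v

theorem move {x : L →L[ℂ] L} (hx : x ∈ X.SS) (ξ ζ : E) {T : H →L[ℂ] H}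
    (hT : ∀ s ∈ X.S, Commute (adjoint (X.R ζ) ∘L T ∘L X.R ξ) s) (v w : L) :
    ⟪X.R ζ w, T (X.R ξ (x v))⟫_ℂ = ⟪X.R ζ (adjoint x w), T (X.R ξ v)⟫_ℂ := by
  have h := congrArg (fun z : L →L[ℂ] L => z v) (X.comm' hx hT).eq
  simp only [mul_apply_eq_comp, ContinuousLinearMap.comp_apply] at h
  rw [← ContinuousLinearMap.adjoint_inner_right, h, ← ContinuousLinearMap.adjoint_inner_left,
    ContinuousLinearMap.adjoint_inner_right]

theorem move' {x : L →L[ℂ] L} (hx : x ∈ X.SS) (ξ ζ : E) (v w : L) :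
    ⟪X.R ζ w, X.R ξ (x v)⟫_ℂ = ⟪X.R ζ (adjoint x w), X.R ξ v⟫_ℂ :=
  X.move hx ξ ζ (T := ContinuousLinearMap.id ℂ H) (X.comm ξ ζ) v w

theorem act_adjoint {x : L →L[ℂ] L} (hx : x ∈ X.SS) : X.act (adjoint x) = adjoint (X.act x) :=
  X.ext_e fun ξ => X.ext_inner fun ζ => by
    rw [ContinuousLinearMap.adjoint_inner_right, X.act_e hx, X.act_e (X.star_SS hx), ← X.R_ω ζ,
      ← X.R_ω ξ, X.move' (X.star_SS hx), ContinuousLinearMap.adjoint_adjoint]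

theorem act_R {x : L →L[ℂ] L} (hx : x ∈ X.SS) (ξ : E) (v : L) :
    X.act x (X.R ξ v) = X.R ξ (x v) := X.ext_inner fun ζ => by
  rw [← ContinuousLinearMap.adjoint_inner_left, ← X.act_adjoint hx, X.act_e (X.star_SS hx),
    ← X.R_ω ζ, X.move' hx]

theorem act_one : X.act 1 = 1 := X.ext_e fun ξ => by
  rw [X.act_e (x := 1) (fun T _ => by simp)]; exact X.R_ω ξ

theorem act_mul {x y : L →L[ℂ] L} (hx : x ∈ X.SS) (hy : y ∈ X.SS) :
    X.act (x * y) = X.act x * X.act y := X.ext_e fun ξ => by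
  rw [X.act_e (Set.mul_mem_centralizer hx hy), mul_apply_eq_comp, mul_apply_eq_comp, X.act_e hy,
    X.act_R hx]

theorem act_add {x y : L →L[ℂ] L} (hx : x ∈ X.SS) (hy : y ∈ X.SS) :
    X.act (x + y) = X.act x + X.act y := X.ext_e fun ξ => by
  rw [X.act_e (Set.add_mem_centralizer hx hy), add_apply, add_apply, X.act_e hx,
    X.act_e hy, map_add]

theorem act_smul {x : L →L[ℂ] L} (c : ℂ) (hx : x ∈ X.SS) : X.act (c • x) = c • X.act x :=
  X.ext_e fun ξ => by
    rw [X.act_e (x := c • x) (fun T hT => by rw [mul_smul_comm, smul_mul_assoc, hx T hT]),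
      smul_apply, smul_apply, X.act_e hx, map_smul]

/-- an operator on `H` commuting with the action of `S` commutes with the action of `S''` -/
theorem act_comm {T : H →L[ℂ] H} (hT : ∀ s ∈ X.S, Commute T (X.act s)) {x : L →L[ℂ] L}
    (hx : x ∈ X.SS) : Commute T (X.act x) := by
  have hS : X.S ⊆ X.SS := Set.subset_centralizer_centralizer
  refine X.ext_e fun ξ => X.ext_inner fun ζ => ?_
  rw [mul_apply_eq_comp, mul_apply_eq_comp, X.act_e hx, ← X.R_ω ζ,
    X.move hx ξ ζ ?_, ← X.R_ω ξ, ← ContinuousLinearMap.adjoint_inner_left (X.act x),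
    ← X.act_adjoint hx, X.act_R (X.star_SS hx)]
  intro s hs
  refine ContinuousLinearMap.ext fun v => ext_inner_left ℂ fun w => ?_
  have h := congrArg (fun z : H →L[ℂ] H => z (X.R ξ v)) (hT s hs).eq
  simp only [mul_apply_eq_comp] at h
  simp only [mul_apply_eq_comp, ContinuousLinearMap.comp_apply]
  rw [← X.act_R (hS hs), h, ContinuousLinearMap.adjoint_inner_right,
    ← ContinuousLinearMap.adjoint_inner_left (X.act s), ← X.act_adjoint (hS hs),
    X.act_R (X.star_SS (hS hs)), ← ContinuousLinearMap.adjoint_inner_left s,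
    ContinuousLinearMap.adjoint_inner_right]

end ExtDatum

end Operators

/-! ### Tracial von Neumann algebras and bimodules -/

/-- The von Neumann algebra generated by a set of operators: the double commutant of the set and
its adjoints. -/
noncomputable def vnGen {L : Type v₁} [NormedAddCommGroup L] [InnerProductSpace ℂ L]
    [CompleteSpace L] (S : Set (L →L[ℂ] L)) : VonNeumannAlgebra L where
  toStarSubalgebra := StarSubalgebra.centralizer ℂ (StarSubalgebra.centralizer ℂ S : Set (L →L[ℂ] L))
  centralizer_centralizer' := by
    change Set.centralizer (Set.centralizer ((StarSubalgebra.centralizer ℂ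
      (StarSubalgebra.centralizer ℂ S : Set (L →L[ℂ] L)) : StarSubalgebra ℂ (L →L[ℂ] L)) :
        Set (L →L[ℂ] L))) = ((StarSubalgebra.centralizer ℂ
      (StarSubalgebra.centralizer ℂ S : Set (L →L[ℂ] L)) : StarSubalgebra ℂ (L →L[ℂ] L)) :
        Set (L →L[ℂ] L))
    rw [StarSubalgebra.coe_centralizer_centralizer]
    simp

theorem mem_vnGen {L : Type v₁} [NormedAddCommGroup L] [InnerProductSpace ℂ L]
    [CompleteSpace L] {S : Set (L →L[ℂ] L)} (hS : ∀ x ∈ S, adjoint x ∈ S) {x : L →L[ℂ] L} :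
    x ∈ vnGen S ↔ x ∈ Set.centralizer (Set.centralizer S) := by
  have h : S ∪ star S = S := Set.union_eq_left.2 fun x hx => by
    have := hS _ hx
    rwa [← ContinuousLinearMap.star_eq_adjoint, star_star] at this
  change x ∈ ((StarSubalgebra.centralizer ℂ
      (StarSubalgebra.centralizer ℂ S : Set (L →L[ℂ] L)) : StarSubalgebra ℂ (L →L[ℂ] L)) :
        Set (L →L[ℂ] L)) ↔ _
  rw [StarSubalgebra.coe_centralizer_centralizer, h]

/-- A von Neumann algebra with a faithful normal trace `x ↦ ⟪ω, x ω⟫`, in its standard (GNS)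
representation on `L = L²`: `ω` is a cyclic trace vector. -/
structure TracialVN where
  L : Type v₁
  [normed : NormedAddCommGroup L]
  [ips : InnerProductSpace ℂ L]
  [complete : CompleteSpace L]
  alg : VonNeumannAlgebra L
  ω : L
  cyclic : Dense {v : L | ∃ x ∈ alg, x ω = v}
  trace : ∀ x ∈ alg, ∀ y ∈ alg, ⟪ω, x (y ω)⟫_ℂ = ⟪ω, y (x ω)⟫_ℂ

attribute [instance] TracialVN.normed TracialVN.ips TracialVN.complete

namespace TracialVN

variable (B : TracialVN.{v₁})

/-- The `*`-algebra of elements of the von Neumann algebra. -/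
abbrev E : Type v₁ := B.alg.toStarSubalgebra

instance : IsClosed (B.alg.toStarSubalgebra : Set (B.L →L[ℂ] B.L)) := by
  rw [VonNeumannAlgebra.coe_toStarSubalgebra, ← VonNeumannAlgebra.centralizer_centralizer]
  exact Set.isClosed_centralizer _

/-- `x ↦ x ω`. -/
noncomputable def vec : B.E →ₗ[ℂ] B.L where
  toFun x := x.1 B.ω
  map_add' _ _ := rfl
  map_smul' _ _ := rfl

theorem vec_dense : DenseRange B.vec := by
  have h : Set.range B.vec = {v : B.L | ∃ x ∈ B.alg, x B.ω = v} := by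
    ext v
    exact ⟨fun ⟨x, hx⟩ => ⟨x.1, x.2, hx⟩, fun ⟨x, hx, h⟩ => ⟨⟨x, hx⟩, h⟩⟩
  rw [DenseRange, h]
  exact B.cyclic

theorem ext_fun {f g : B.L → ℂ} (hf : Continuous f) (hg : Continuous g)
    (h : ∀ x, f (B.vec x) = g (B.vec x)) (v : B.L) : f v = g v :=
  congrFun (B.vec_dense.equalizer hf hg (funext h)) v

/-- `x ↦ x* ω`. -/
noncomputable def vecStar : B.E →ₛₗ[starRingEnd ℂ] B.L where
  toFun x := B.vec (star x)
  map_add' x y := by rw [star_add, map_add]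
  map_smul' c x := by rw [star_smul, map_smul]; rfl

/-- The modular conjugation `x ω ↦ x* ω`. -/
noncomputable def J : B.L →L⋆[ℂ] B.L := B.vecStar.extendOfNorm B.vec

theorem inner_vec (x y : B.E) : ⟪B.vec x, B.vec y⟫_ℂ = ⟪B.ω, (star x.1 * y.1) B.ω⟫_ℂ := by
  rw [mul_apply_eq_comp, ContinuousLinearMap.star_eq_adjoint,
    ContinuousLinearMap.adjoint_inner_right]
  rfl

theorem inner_vec_star (x y : B.E) :
    ⟪B.vec (star x), B.vec (star y)⟫_ℂ = ⟪B.vec y, B.vec x⟫_ℂ := by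
  rw [inner_vec, inner_vec]
  have h := B.trace x.1 x.2 (star y.1) (star_mem y.2)
  simpa using h

theorem norm_vecStar (x : B.E) : ‖B.vecStar x‖ = ‖B.vec x‖ := by
  rw [← sq_eq_sq₀ (norm_nonneg _) (norm_nonneg _), ← inner_self_eq_norm_sq (𝕜 := ℂ),
    ← inner_self_eq_norm_sq (𝕜 := ℂ)]
  exact congrArg _ (B.inner_vec_star x x)

theorem J_vec (x : B.E) : B.J (B.vec x) = B.vec (star x) :=
  LinearMap.extendOfNorm_eq (f := B.vecStar) B.vec_dense
    ⟨1, fun x => by rw [one_mul, norm_vecStar]⟩ x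

theorem J_J (v : B.L) : B.J (B.J v) = v := by
  refine congrFun (B.vec_dense.equalizer (B.J.continuous.comp B.J.continuous) continuous_id
    (funext fun x => ?_)) v
  simp only [Function.comp_apply, id_eq, J_vec, star_star]

theorem J_inner (v v' : B.L) : ⟪B.J v, B.J v'⟫_ℂ = ⟪v', v⟫_ℂ := by
  have hc := B.J.continuous
  have h1 : ∀ x, ⟪B.J (B.vec x), B.J v'⟫_ℂ = ⟪v', B.vec x⟫_ℂ := fun x => by
    refine B.ext_fun (f := fun v' => ⟪B.J (B.vec x), B.J v'⟫_ℂ)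
      (g := fun v' => ⟪v', B.vec x⟫_ℂ) (by fun_prop) (by fun_prop) (fun y => ?_) v'
    simp only [J_vec]
    exact B.inner_vec_star x y
  exact B.ext_fun (f := fun v => ⟪B.J v, B.J v'⟫_ℂ)
      (g := fun v => ⟪v', v⟫_ℂ) (by fun_prop) (by fun_prop) h1 v

/-- The right action of the algebra on `L²`, `ρ(b) = J b* J`, so `ρ(b) (x ω) = x b ω`. -/
noncomputable def ρ (b : B.E) : B.L →L[ℂ] B.L := B.J.comp ((star b).1.comp B.J)

theorem ρ_apply (b : B.E) (v : B.L) : B.ρ b v = B.J ((star b).1 (B.J v)) := rfl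

theorem vec_mul (x y : B.E) : B.vec (x * y) = x.1 (B.vec y) := rfl

theorem ρ_vec (b x : B.E) : B.ρ b (B.vec x) = x.1 (B.vec b) := by
  rw [ρ_apply, J_vec, ← vec_mul, J_vec, star_mul, star_star, star_star, vec_mul]

theorem ext_vec {G : Type*} [NormedAddCommGroup G] [NormedSpace ℂ G] {S T : B.L →L[ℂ] G}
    (h : ∀ x, S (B.vec x) = T (B.vec x)) : S = T :=
  ContinuousLinearMap.coeFn_injective (B.vec_dense.equalizer S.continuous T.continuous (funext h))

theorem ρ_comm (b x : B.E) : Commute (B.ρ b) x.1 := B.ext_vec fun y => by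
  rw [mul_apply_eq_comp, mul_apply_eq_comp, ← vec_mul, ρ_vec, ρ_vec]; rfl

theorem ρ_one : B.ρ 1 = 1 := B.ext_vec fun y => by
  rw [ρ_vec, ← vec_mul, mul_one]; rfl

theorem ρ_mul (a b : B.E) : B.ρ (a * b) = B.ρ b * B.ρ a := B.ext_vec fun y => by
  rw [ρ_vec, mul_apply_eq_comp, ρ_vec, ← vec_mul, ← vec_mul, ρ_vec, ← vec_mul, mul_assoc]

theorem ρ_add (a b : B.E) : B.ρ (a + b) = B.ρ a + B.ρ b := B.ext_vec fun y => by
  rw [ρ_vec, add_apply, ρ_vec, ρ_vec, map_add, map_add]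

theorem ρ_smul (c : ℂ) (a : B.E) : B.ρ (c • a) = c • B.ρ a := B.ext_vec fun y => by
  rw [ρ_vec, smul_apply, ρ_vec, map_smul, map_smul]

theorem ρ_star (b : B.E) : B.ρ (star b) = adjoint (B.ρ b) := by
  refine ContinuousLinearMap.ext fun v => ext_inner_left ℂ fun v' => ?_
  rw [ContinuousLinearMap.adjoint_inner_right, ρ_apply, ρ_apply]
  conv_lhs => rw [← B.J_J v', J_inner]
  conv_rhs => rw [← B.J_J v, J_inner]
  rw [star_star]
  exact (ContinuousLinearMap.adjoint_inner_right b.1 _ _).symm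

theorem ρ_ω (b : B.E) : B.ρ b B.ω = B.vec b := by
  have h := B.ρ_vec b 1
  exact h

theorem norm_ρ_le (b : B.E) : ‖B.ρ b‖ ≤ ‖b‖ := by
  have hJ : ∀ v, ‖B.J v‖ = ‖v‖ := fun v => by
    rw [← sq_eq_sq₀ (norm_nonneg _) (norm_nonneg _), ← inner_self_eq_norm_sq (𝕜 := ℂ),
      ← inner_self_eq_norm_sq (𝕜 := ℂ), J_inner]
  refine ContinuousLinearMap.opNorm_le_bound _ (norm_nonneg _) fun v => ?_
  rw [ρ_apply, hJ, ← hJ v, ← norm_star b]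
  exact (star b).1.le_opNorm _

/-- the commutation theorem: an operator commuting with the right action belongs to the algebra -/
theorem mem_of_comm {T : B.L →L[ℂ] B.L} (hT : ∀ b, Commute T (B.ρ b)) : T ∈ B.alg := by
  have hT' : ∀ b v, T (B.ρ b v) = B.ρ b (T v) := fun b v =>
    congrArg (fun z : B.L →L[ℂ] B.L => z v) (hT b).eq
  have hTs : ∀ b v, adjoint T (B.ρ b v) = B.ρ b (adjoint T v) := fun b v => by
    refine ext_inner_left ℂ fun z => ?_
    rw [ContinuousLinearMap.adjoint_inner_right, ← ContinuousLinearMap.adjoint_inner_left,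
      ← ρ_star, ← hT', ← ContinuousLinearMap.adjoint_inner_right, ρ_star,
      ContinuousLinearMap.adjoint_inner_left]
  have h1 : adjoint T B.ω = B.J (T B.ω) := by
    refine ext_inner_left ℂ fun v => ?_
    refine B.ext_fun (f := fun v => ⟪v, adjoint T B.ω⟫_ℂ)
      (g := fun v => ⟪v, B.J (T B.ω)⟫_ℂ) (by fun_prop) (by fun_prop) (fun b => ?_) v
    rw [ContinuousLinearMap.adjoint_inner_right, ← ρ_ω, hT', ← B.J_J (B.ρ b B.ω), J_inner,
      ρ_ω, J_vec, ← ContinuousLinearMap.adjoint_inner_right, ← ρ_star, ρ_ω]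
  rw [← B.alg.commutant_commutant, VonNeumannAlgebra.mem_commutant_iff]
  intro y hy
  rw [VonNeumannAlgebra.mem_commutant_iff] at hy
  have hy' : ∀ (b : B.E) v, y (b.1 v) = b.1 (y v) := fun b v =>
    (congrArg (fun z : B.L →L[ℂ] B.L => z v) (hy b.1 b.2)).symm
  have hys : ∀ (b : B.E) v, adjoint y (b.1 v) = b.1 (adjoint y v) := fun b v => by
    have hb : ((star b : B.E) : B.L →L[ℂ] B.L) = adjoint b.1 := rfl
    refine ext_inner_left ℂ fun z => ?_
    rw [ContinuousLinearMap.adjoint_inner_right, ← ContinuousLinearMap.adjoint_inner_left,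
      ← hb, ← hy', ← ContinuousLinearMap.adjoint_inner_right, hb,
      ContinuousLinearMap.adjoint_inner_left]
  have h2 : adjoint y B.ω = B.J (y B.ω) := by
    refine ext_inner_left ℂ fun v => ?_
    refine B.ext_fun (f := fun v => ⟪v, adjoint y B.ω⟫_ℂ)
      (g := fun v => ⟪v, B.J (y B.ω)⟫_ℂ) (by fun_prop) (by fun_prop) (fun b => ?_) v
    have hb : ((star b : B.E) : B.L →L[ℂ] B.L) = adjoint b.1 := rfl
    rw [ContinuousLinearMap.adjoint_inner_right]
    change ⟪y (b.1 B.ω), B.ω⟫_ℂ = _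
    rw [hy', ← B.J_J (B.vec b), J_inner, J_vec, ← ContinuousLinearMap.adjoint_inner_right, ← hb]
    rfl
  refine B.ext_vec fun c => ?_
  refine ext_inner_left ℂ fun v => ?_
  refine B.ext_fun (f := fun v => ⟪v, (y * T) (B.vec c)⟫_ℂ)
      (g := fun v => ⟪v, (T * y) (B.vec c)⟫_ℂ) (by fun_prop) (by fun_prop) (fun d => ?_) v
  simp only [mul_apply_eq_comp]
  have e1 : ⟪B.vec d, y (T (B.vec c))⟫_ℂ = ⟪d.1 (B.J (y B.ω)), B.ρ c (T B.ω)⟫_ℂ := by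
    rw [← ContinuousLinearMap.adjoint_inner_left, ← h2, ← hys, ← hT', ρ_ω]; rfl
  have e2 : ⟪B.vec d, T (y (B.vec c))⟫_ℂ = ⟪B.ρ d (B.J (T B.ω)), c.1 (y B.ω)⟫_ℂ := by
    rw [← ContinuousLinearMap.adjoint_inner_left, ← h1, ← hTs, ρ_ω, ← hy']; rfl
  have hc : ∀ v v', ⟪v, c.1 v'⟫_ℂ = ⟪(star c).1 v, v'⟫_ℂ := fun v v' =>
    (ContinuousLinearMap.adjoint_inner_left c.1 _ _).symm
  have hd : ∀ v v', ⟪d.1 v, v'⟫_ℂ = ⟪v, (star d).1 v'⟫_ℂ := fun v v' =>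
    (ContinuousLinearMap.adjoint_inner_right d.1 _ _).symm
  have h3 := congrArg (fun z : B.L →L[ℂ] B.L => z (B.J (T B.ω))) (B.ρ_comm d (star c)).eq
  simp only [mul_apply_eq_comp] at h3
  rw [e1, e2, hc, ← h3, B.ρ_apply c, B.ρ_apply d]
  conv_rhs => rw [← B.J_J (y B.ω), J_inner]
  rw [hd]

end TracialVN

/-- Normality of a functional on a von Neumann algebra: continuity in the weak operator topology
on bounded sets.  For linear functionals this is ultraweak continuity. -/
def IsNormal {A : TracialVN.{v₁}} (φ : A.E → ℂ) : Prop :=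
  ∀ (l : Filter A.E) (K : ℝ) (x₀ : A.E), (∀ᶠ x in l, ‖x‖ ≤ K) →
    (∀ v v' : A.L, Tendsto (fun x : A.E => ⟪v, x.1 v'⟫_ℂ) l (𝓝 ⟪v, x₀.1 v'⟫_ℂ)) →
    Tendsto φ l (𝓝 (φ x₀))

theorem IsNormal.of_dense {A : TracialVN.{v₁}} {H : Type v₂} [NormedAddCommGroup H]
    {F : H → A.E → ℂ} {C : ℝ} (hF : ∀ v v' x, ‖F v x - F v' x‖ ≤ C * ‖x‖ * ‖v - v'‖)
    {S : Set H} (hS : Dense S) (h : ∀ v ∈ S, IsNormal (F v)) (v : H) : IsNormal (F v) := by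
  intro l K x₀ hK hx
  rw [Metric.tendsto_nhds]
  intro ε hε
  set K' := |C| * (|K| + ‖x₀‖) + 1
  have hK' : 0 < K' := by positivity
  obtain ⟨v', hv', hd⟩ := Metric.mem_closure_iff.1 (hS v) (ε / 3 / K') (by positivity)
  rw [dist_eq_norm, lt_div_iff₀ hK'] at hd
  have hb : ∀ x : A.E, ‖x‖ ≤ |K| + ‖x₀‖ → ‖F v x - F v' x‖ < ε / 3 := fun x hx => by
    refine lt_of_le_of_lt (hF v v' x) (lt_of_le_of_lt ?_ hd)
    rw [mul_comm ‖v - v'‖]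
    refine mul_le_mul_of_nonneg_right ?_ (norm_nonneg _)
    have : C * ‖x‖ ≤ |C| * (|K| + ‖x₀‖) :=
      mul_le_mul (le_abs_self C) hx (norm_nonneg _) (abs_nonneg _)
    linarith
  filter_upwards [hK, Metric.tendsto_nhds.1 (h v' hv' l K x₀ hK hx) (ε / 3) (by positivity)]
    with x h1 h2
  have h3 := hb x (by linarith [le_abs_self K, norm_nonneg x₀])
  have h4 := hb x₀ (by linarith [abs_nonneg K])
  rw [dist_eq_norm] at h2 ⊢
  have : F v x - F v x₀ = (F v x - F v' x) + (F v' x - F v' x₀) - (F v x₀ - F v' x₀) := by ring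
  rw [this]
  refine lt_of_le_of_lt (norm_sub_le _ _) ?_
  have := norm_add_le (F v x - F v' x) (F v' x - F v' x₀)
  linarith

/-- normality of all coefficients follows from that on a dense set of vectors -/
theorem IsNormal.of_dense₂ {A : TracialVN.{v₁}} {H : Type v₂} [NormedAddCommGroup H]
    [InnerProductSpace ℂ H] {π : A.E → H →L[ℂ] H} (hπ : ∀ x, ‖π x‖ ≤ ‖x‖)
    {S : Set H} (hS : Dense S) (h : ∀ v ∈ S, ∀ v' ∈ S, IsNormal fun x => ⟪v, π x v'⟫_ℂ)
    (v v' : H) : IsNormal fun x => ⟪v, π x v'⟫_ℂ := by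
  have hb : ∀ x v v', ‖⟪v, π x v'⟫_ℂ‖ ≤ ‖v‖ * (‖x‖ * ‖v'‖) := fun x v v' =>
    (norm_inner_le_norm _ _).trans (mul_le_mul_of_nonneg_left
      ((ContinuousLinearMap.le_opNorm _ _).trans
        (mul_le_mul_of_nonneg_right (hπ x) (norm_nonneg _))) (norm_nonneg _))
  refine IsNormal.of_dense (F := fun v x => ⟪v, π x v'⟫_ℂ) (C := ‖v'‖) (fun v₁ v₂ x => ?_) hS
    (fun v hv => ?_) v
  · rw [← inner_sub_left]
    refine (hb _ _ _).trans (le_of_eq (by ring))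
  · refine IsNormal.of_dense (F := fun v' x => ⟪v, π x v'⟫_ℂ) (C := ‖v‖) (fun v₁ v₂ x => ?_) hS
      (fun v' hv' => h v hv v' hv') v'
    rw [← inner_sub_right, ← map_sub]
    refine (hb _ _ _).trans (le_of_eq (by ring))

/-- A (von Neumann) `A`-`B`-bimodule: a Hilbert space with commuting normal unital `*`-preserving
left action of `A` and right action of `B`. -/
structure VNBimod (A : TracialVN.{v₁}) (B : TracialVN.{v₂}) where
  H : Type v₃
  [normed : NormedAddCommGroup H]
  [ips : InnerProductSpace ℂ H]
  [complete : CompleteSpace H]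
  left : A.E →⋆ₐ[ℂ] (H →L[ℂ] H)
  right : B.Eᵐᵒᵖ →⋆ₐ[ℂ] (H →L[ℂ] H)
  comm : ∀ a b, Commute (left a) (right b)
  left_normal : ∀ v v', IsNormal fun a => ⟪v, left a v'⟫_ℂ
  right_normal : ∀ v v', IsNormal fun b => ⟪v, right (MulOpposite.op b) v'⟫_ℂ

attribute [instance] VNBimod.normed VNBimod.ips VNBimod.complete

/-- Intertwiners: bounded bimodule maps. -/
structure VNBimod.Hom {A : TracialVN.{v₁}} {B : TracialVN.{v₂}} (X : VNBimod.{v₁, v₂, v₃} A B)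
    (Y : VNBimod.{v₁, v₂, v₄} A B) where
  op : X.H →L[ℂ] Y.H
  map_left : ∀ a v, op (X.left a v) = Y.left a (op v)
  map_right : ∀ b v, op (X.right b v) = Y.right b (op v)

/-- Isomorphisms of bimodules: unitary bimodule maps. -/
structure VNBimod.Iso {A : TracialVN.{v₁}} {B : TracialVN.{v₂}} (X : VNBimod.{v₁, v₂, v₃} A B)
    (Y : VNBimod.{v₁, v₂, v₄} A B) where
  op : X.H ≃ₗᵢ[ℂ] Y.H
  map_left : ∀ a v, op (X.left a v) = Y.left a (op v)
  map_right : ∀ b v, op (X.right b v) = Y.right b (op v)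

/-! ### The functor `PB` on `0`-cells -/

section ZeroCells

variable (Δ : ZeroCell.{u, w})

/-- The trace vector `1 ∈ L²(B_∞)`. -/
noncomputable def Ωvec : Hilb Δ.base := ι Δ.base (EvHom.id Δ.base)

theorem Φ_Ωvec {y : Tower Δ} (γ : EvHom Δ.base y) : Φ γ (Ωvec Δ) = ι y γ := by
  rw [Ωvec, Φ_ι, EvHom.id_comp]

/-- `a ↦ a*` as a map to `L²(B_∞)`. -/
noncomputable def ιStar : EvHom Δ.base Δ.base →ₛₗ[starRingEnd ℂ] Hilb Δ.base where
  toFun a := ι Δ.base a.dag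
  map_add' a b := by rw [EvHom.dag_add, map_add]
  map_smul' c a := by rw [EvHom.dag_smul, map_smul]

theorem inner_ι_dag (a b : EvHom Δ.base Δ.base) :
    ⟪ι Δ.base a.dag, ι Δ.base b.dag⟫_ℂ = ⟪ι Δ.base b, ι Δ.base a⟫_ℂ := by
  rw [inner_ι, inner_ι]
  obtain ⟨k, h1, h2⟩ := ((EvHom.form_eq a.dag b.dag).and (EvHom.form_eq b a)).exists
  rw [h1, h2, EvHom.dag_val, EvHom.dag_val, CStarCat.dag_dag, Tr_comm]

/-- The conjugation `a ↦ a*` of `L²(B_∞)`. -/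
noncomputable def J₀ : Hilb Δ.base →L⋆[ℂ] Hilb Δ.base := (ιStar Δ).extendOfNorm (ι Δ.base)

theorem J₀_ι (a : EvHom Δ.base Δ.base) : J₀ Δ (ι Δ.base a) = ι Δ.base a.dag := by
  refine LinearMap.extendOfNorm_eq (f := ιStar Δ) (ι_dense Δ.base) ⟨1, fun x => le_of_eq ?_⟩ a
  rw [one_mul, ← sq_eq_sq₀ (norm_nonneg _) (norm_nonneg _), ← inner_self_eq_norm_sq (𝕜 := ℂ),
    ← inner_self_eq_norm_sq (𝕜 := ℂ)]
  exact congrArg _ (inner_ι_dag Δ x x)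

theorem ι_ext_fun {y : Tower Δ} {G : Type*} [TopologicalSpace G] [T2Space G] {f g : Hilb y → G}
    (hf : Continuous f) (hg : Continuous g)
    (h : ∀ ξ, f (ι y ξ) = g (ι y ξ)) (v : Hilb y) : f v = g v :=
  congrFun ((ι_dense y).equalizer hf hg (funext h)) v

theorem J₀_J₀ (v : Hilb Δ.base) : J₀ Δ (J₀ Δ v) = v :=
  ι_ext_fun Δ (g := fun v => v) ((J₀ Δ).continuous.comp (J₀ Δ).continuous) continuous_id
    (fun a => by simp only [Function.comp_apply, J₀_ι, EvHom.dag_dag]) v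

theorem J₀_inner (v v' : Hilb Δ.base) : ⟪J₀ Δ v, J₀ Δ v'⟫_ℂ = ⟪v', v⟫_ℂ := by
  have hc := (J₀ Δ).continuous
  refine ι_ext_fun Δ (f := fun v => ⟪J₀ Δ v, J₀ Δ v'⟫_ℂ) (g := fun v => ⟪v', v⟫_ℂ)
    (by fun_prop) (by fun_prop) (fun a => ?_) v
  refine ι_ext_fun Δ (f := fun v' => ⟪J₀ Δ (ι Δ.base a), J₀ Δ v'⟫_ℂ)
    (g := fun v' => ⟪v', ι Δ.base a⟫_ℂ)
    (by fun_prop) (by fun_prop) (fun b => ?_) v'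
  simp only [J₀_ι]
  exact inner_ι_dag Δ a b

/-- Right multiplication by `a` on `L²(B_∞)`. -/
noncomputable def ρ₀ (a : EvHom Δ.base Δ.base) : Hilb Δ.base →L[ℂ] Hilb Δ.base :=
  (J₀ Δ).comp ((Φ a.dag).comp (J₀ Δ))

theorem ρ₀_apply (a : EvHom Δ.base Δ.base) (v : Hilb Δ.base) :
    ρ₀ Δ a v = J₀ Δ (Φ a.dag (J₀ Δ v)) := rfl

theorem ρ₀_ι (a b : EvHom Δ.base Δ.base) : ρ₀ Δ a (ι Δ.base b) = ι Δ.base (a.comp b) := by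
  rw [ρ₀_apply, J₀_ι, Φ_ι, J₀_ι, EvHom.dag_comp, EvHom.dag_dag, EvHom.dag_dag]

theorem inner_ρ₀ (a : EvHom Δ.base Δ.base) (v v' : Hilb Δ.base) :
    ⟪v, ρ₀ Δ a v'⟫_ℂ = ⟪ρ₀ Δ a.dag v, v'⟫_ℂ := by
  rw [ρ₀_apply, ρ₀_apply]
  conv_lhs => rw [← J₀_J₀ Δ v, J₀_inner]
  conv_rhs => rw [← J₀_J₀ Δ v', J₀_inner]
  rw [Φ_dag, Φ_dag, ContinuousLinearMap.adjoint_inner_left, Φ_dag,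
    ContinuousLinearMap.adjoint_adjoint]

/-- The left multiplications by the elements of `B_∞`. -/
def leftMults : Set (Hilb Δ.base →L[ℂ] Hilb Δ.base) :=
  Set.range fun a : EvHom Δ.base Δ.base => Φ a

theorem leftMults_star : ∀ x ∈ leftMults Δ, adjoint x ∈ leftMults Δ := by
  rintro _ ⟨a, rfl⟩
  exact ⟨a.dag, Φ_dag a⟩

theorem adjoint_Ωvec {x : Hilb Δ.base →L[ℂ] Hilb Δ.base}
    (hx : x ∈ Set.centralizer (Set.centralizer (leftMults Δ))) :
    adjoint x (Ωvec Δ) = J₀ Δ (x (Ωvec Δ)) := by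
  refine Hilb.ext_inner fun a => ?_
  have hρ : ρ₀ Δ a ∈ Set.centralizer (leftMults Δ) := by
    rintro _ ⟨c, rfl⟩
    refine Hilb.ext fun b => ?_
    simp only [mul_apply_eq_comp, Φ_ι, ρ₀_ι, EvHom.comp_assoc]
  have h1 := congrArg (fun z : Hilb Δ.base →L[ℂ] Hilb Δ.base => z (Ωvec Δ)) (hx _ hρ)
  simp only [mul_apply_eq_comp] at h1
  have h2 : ρ₀ Δ a (Ωvec Δ) = ι Δ.base a := by rw [Ωvec, ρ₀_ι, EvHom.comp_id]
  have h3 : ρ₀ Δ a.dag (Ωvec Δ) = ι Δ.base a.dag := by rw [Ωvec, ρ₀_ι, EvHom.comp_id]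
  have h4 : ⟪Ωvec Δ, x (ι Δ.base a)⟫_ℂ = ⟪ι Δ.base a.dag, x (Ωvec Δ)⟫_ℂ := by
    rw [← h2, ← h1, inner_ρ₀, h3]
  rw [ContinuousLinearMap.adjoint_inner_right, ← J₀_J₀ Δ (ι Δ.base a), J₀_inner, J₀_ι,
    ← inner_conj_symm, J₀_ι, EvHom.dag_dag, h4, inner_conj_symm]

/-- The von Neumann algebra `PB(Δ) = B = B_∞''` acting on `L²(B_∞)`. -/
noncomputable abbrev ZeroCell.PB : TracialVN.{w} where
  L := Hilb Δ.base
  alg := vnGen (leftMults Δ)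
  ω := Ωvec Δ
  cyclic := by
    refine (ι_dense Δ.base).mono ?_
    rintro _ ⟨a, rfl⟩
    exact ⟨Φ a, (mem_vnGen (leftMults_star Δ)).2
      (Set.subset_centralizer_centralizer ⟨a, rfl⟩), Φ_Ωvec Δ a⟩
  trace x hx y hy := by
    rw [mem_vnGen (leftMults_star Δ)] at hx hy
    conv_lhs => rw [← ContinuousLinearMap.adjoint_inner_left, adjoint_Ωvec Δ hx]
    conv_rhs => rw [← ContinuousLinearMap.adjoint_inner_left, adjoint_Ωvec Δ hy]
    rw [← J₀_J₀ Δ (y _), J₀_inner, J₀_J₀]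

end ZeroCells

/-! ### The functor `PB` on `1`-cells -/

/-- The `*`-homomorphism given by an extended action. -/
noncomputable def ExtDatum.hom {L : Type v₁} [NormedAddCommGroup L] [InnerProductSpace ℂ L]
    [CompleteSpace L] {H : Type v₂} [NormedAddCommGroup H] [InnerProductSpace ℂ H]
    [CompleteSpace H] {E : Type v₃} [AddCommGroup E] [Module ℂ E] (X : ExtDatum L H E)
    (D : StarSubalgebra ℂ (L →L[ℂ] L)) (hD : ∀ x ∈ D, x ∈ X.SS) : D →⋆ₐ[ℂ] (H →L[ℂ] H) where
  toFun x := X.act x.1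
  map_one' := X.act_one
  map_mul' x y := X.act_mul (hD _ x.2) (hD _ y.2)
  map_zero' := by
    have h := X.act_smul 0 (hD _ D.one_mem)
    rw [zero_smul, zero_smul] at h
    exact h
  map_add' x y := X.act_add (hD _ x.2) (hD _ y.2)
  commutes' r := by
    have h := X.act_smul r (hD _ D.one_mem)
    rw [X.act_one] at h
    rw [Algebra.algebraMap_eq_smul_one]
    refine Eq.trans ?_ h
    congr 1
  map_star' x := X.act_adjoint (hD _ x.2)

section OneCells

variable {Γ : ZeroCell.{u₁, w₁}} {Δ : ZeroCell.{u₂, w₂}} (Λ : OneCell Γ Δ)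

namespace OneCell

/-- The inclusion `A_∞ → C_∞`, `a ↦ Λ_k(a)`. -/
noncomputable def lam (a : EvHom Γ.base Γ.base) : EvHom Λ.tower Λ.tower :=
  ⟨fun k => (Λ.L k).map (a.val k), by
    filter_upwards [a.ev] with k h
    have h1 : a.val (k + 1) = (Γ.F k).map (a.val k) :=
      (Category.id_comp (X := Γ.x (k + 1)) _).symm.trans
        (h.trans (Category.comp_id (Y := Γ.x (k + 1)) _))
    have h2 := (Λ.W k).naturality (a.val k)
    refine Eq.trans ?_ h2.symm
    exact congrArg (fun z => (Λ.W k).app (Γ.x k) ≫ (Λ.L (k + 1)).map z) h1⟩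

theorem lam_val (a : EvHom Γ.base Γ.base) (k : ℕ) : (Λ.lam a).val k = (Λ.L k).map (a.val k) := rfl

theorem lam_comp (a b : EvHom Γ.base Γ.base) : Λ.lam (a.comp b) = (Λ.lam a).comp (Λ.lam b) := by
  ext k
  exact (Λ.L k).map_comp _ _

theorem lam_dag (a : EvHom Γ.base Γ.base) : Λ.lam a.dag = (Λ.lam a).dag := by
  ext k
  exact StarLinear.map_dag _

theorem lam_add (a b : EvHom Γ.base Γ.base) : Λ.lam (a + b) = Λ.lam a + Λ.lam b := by
  ext k
  exact StarLinear.map_add _ _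

theorem lam_smul (c : ℂ) (a : EvHom Γ.base Γ.base) : Λ.lam (c • a) = c • Λ.lam a := by
  ext k
  exact StarLinear.map_smul _ _

theorem lam_id : Λ.lam (EvHom.id Γ.base) = EvHom.id Λ.tower := by
  ext k
  exact (Λ.L k).map_id _

/-- `a ↦ Λ(a) ξ` on `A_∞`. -/
noncomputable def R₀ (ξ : EvHom Δ.base Λ.tower) : EvHom Γ.base Γ.base →ₗ[ℂ] Hilb Λ.tower where
  toFun a := ι Λ.tower (ξ.comp (Λ.lam a))
  map_add' a b := by rw [lam_add, EvHom.comp_add, map_add]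
  map_smul' c a := by rw [lam_smul, EvHom.comp_smul, map_smul]; rfl

theorem Tr_R_le {M : WSSC.{u₁, w₁}} {N : WSSC.{u₂, w₂}} (F : M.Obj ⥤ N.Obj) [StarLinear F]
    {K : ℝ} (h : ∀ v, adjWt M N F v ≤ K * M.wt v) {x y : M.Obj} {z : N.Obj} (a : x ⟶ y)
    (ξ : z ⟶ F.obj x) :
    (Tr N ((ξ ≫ F.map a) ≫ dag (ξ ≫ F.map a))).re ≤ nrm ξ ^ 2 * (K * (Tr M (a ≫ dag a)).re) := by
  have h1 : Tr N ((ξ ≫ F.map a) ≫ dag (ξ ≫ F.map a)) =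
      Tr N ((dag (F.map a) ≫ dag ξ) ≫ dag (dag (F.map a) ≫ dag ξ)) := by
    rw [← dag_comp, dag_dag, Tr_comm]
  rw [h1]
  refine (Tr_bound _ _).trans ?_
  rw [nrm_dag]
  refine mul_le_mul_of_nonneg_left ?_ (sq_nonneg _)
  have h2 : dag (F.map a) ≫ dag (dag (F.map a)) = F.map (dag a ≫ dag (dag a)) := by
    rw [dag_dag, dag_dag, Functor.map_comp, StarLinear.map_dag]
  rw [h2]
  refine (Tr_map_le F h _).trans (le_of_eq ?_)
  rw [dag_dag, Tr_comm]

theorem R₀_bound (ξ : EvHom Δ.base Λ.tower) : ∃ C, ∀ a, ‖Λ.R₀ ξ a‖ ≤ C * ‖ι Γ.base a‖ := by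
  obtain ⟨ε, K, hε, hK, hb⟩ := Λ.bdd
  obtain ⟨C, hC, h⟩ := ξ.exists_bound
  refine ⟨C * √K, fun a => ?_⟩
  refine (pow_le_pow_iff_left₀ (norm_nonneg _) (by positivity) two_ne_zero).1 ?_
  rw [mul_pow, mul_pow, Real.sq_sqrt hK.le, norm_ι_sq]
  change ‖ι Λ.tower (ξ.comp (Λ.lam a))‖ ^ 2 ≤ _
  rw [norm_ι_sq]
  obtain ⟨k, h0, h1, h2⟩ := (h.and ((EvHom.form_eq (ξ.comp (Λ.lam a)) (ξ.comp (Λ.lam a))).and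
    (EvHom.form_eq a a))).exists
  rw [h1, h2]
  refine (Tr_R_le (Λ.L k) (fun v => (hb k v).2) (a.val k) (ξ.val k)).trans ?_
  rw [mul_assoc]
  refine mul_le_mul_of_nonneg_right (pow_le_pow_left₀ (nrm_nonneg _) h0 2) ?_
  exact mul_nonneg hK.le (Tr_nonneg _)

theorem R_ι_aux (ξ : EvHom Δ.base Λ.tower) (a : EvHom Γ.base Γ.base) :
    (Λ.R₀ ξ).extendOfNorm (ι Γ.base) (ι Γ.base a) = ι Λ.tower (ξ.comp (Λ.lam a)) :=
  LinearMap.extendOfNorm_eq (f := Λ.R₀ ξ) (ι_dense Γ.base) (Λ.R₀_bound ξ) a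

/-- The bounded operator `L²(A_∞) → H`, `a ↦ Λ(a) ξ`. -/
noncomputable def R : EvHom Δ.base Λ.tower →ₗ[ℂ] (Hilb Γ.base →L[ℂ] Hilb Λ.tower) where
  toFun ξ := (Λ.R₀ ξ).extendOfNorm (ι Γ.base)
  map_add' ξ ζ := Hilb.ext fun a => by
    rw [add_apply, R_ι_aux, R_ι_aux, R_ι_aux, EvHom.add_comp, map_add]
  map_smul' c ξ := Hilb.ext fun a => by
    rw [smul_apply, R_ι_aux, R_ι_aux, EvHom.smul_comp, map_smul]; rfl

theorem R_ι (ξ : EvHom Δ.base Λ.tower) (a : EvHom Γ.base Γ.base) :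
    Λ.R ξ (ι Γ.base a) = ι Λ.tower (ξ.comp (Λ.lam a)) := Λ.R_ι_aux ξ a

theorem R_Φ (ξ : EvHom Δ.base Λ.tower) (c : EvHom Γ.base Γ.base) :
    Λ.R ξ ∘L Φ c = Φ (Λ.lam c) ∘L Λ.R ξ := Hilb.ext fun a => by
  rw [ContinuousLinearMap.comp_apply, ContinuousLinearMap.comp_apply, Φ_ι, R_ι, R_ι, Φ_ι,
    lam_comp, EvHom.comp_assoc]

/-- The data for the left action of `A`. -/
noncomputable def leftDatum : ExtDatum (Hilb Γ.base) (Hilb Λ.tower) (EvHom Δ.base Λ.tower) where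
  e := ι Λ.tower
  dense := ι_dense _
  R := Λ.R
  ω := Ωvec Γ
  R_ω ξ := by rw [Ωvec, R_ι, lam_id, EvHom.comp_id]
  S := leftMults Γ
  S_star := leftMults_star Γ
  comm ξ ζ := by
    rintro _ ⟨c, rfl⟩
    have h1 := Λ.R_Φ ξ c
    have h2 := congrArg adjoint (Λ.R_Φ ζ c.dag)
    rw [ContinuousLinearMap.adjoint_comp, ContinuousLinearMap.adjoint_comp, lam_dag, Φ_dag, Φ_dag,
      ContinuousLinearMap.adjoint_adjoint, ContinuousLinearMap.adjoint_adjoint] at h2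
    change (adjoint (Λ.R ζ) ∘L Λ.R ξ) ∘L Φ c = Φ c ∘L (adjoint (Λ.R ζ) ∘L Λ.R ξ)
    rw [ContinuousLinearMap.comp_assoc, h1, ← ContinuousLinearMap.comp_assoc,
      ← ContinuousLinearMap.comp_assoc, h2]

/-- `Φ` as a linear map. -/
noncomputable def ΦLin {y y' : Tower Δ} : EvHom y y' →ₗ[ℂ] (Hilb y →L[ℂ] Hilb y') where
  toFun := Φ
  map_add' a b := Hilb.ext fun ξ => by
    rw [add_apply, Φ_ι, Φ_ι, Φ_ι, EvHom.comp_add, map_add]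
  map_smul' c a := Hilb.ext fun ξ => by
    rw [smul_apply, Φ_ι, Φ_ι, EvHom.comp_smul, map_smul]; rfl

theorem Φ_mem (a : EvHom Δ.base Δ.base) : Φ a ∈ Δ.PB.alg :=
  (mem_vnGen (leftMults_star Δ)).2 (Set.subset_centralizer_centralizer ⟨a, rfl⟩)

/-- The data for the right action of `B`. -/
noncomputable def rightDatum : ExtDatum (Hilb Δ.base) (Hilb Λ.tower) (EvHom Δ.base Λ.tower) where
  e := ι Λ.tower
  dense := ι_dense _
  R := ΦLin
  ω := Ωvec Δ
  R_ω ξ := Φ_Ωvec Δ ξ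
  S := Set.range Δ.PB.ρ
  S_star := by
    rintro _ ⟨b, rfl⟩
    exact ⟨Star.star b, Δ.PB.ρ_star b⟩
  comm ξ ζ := by
    rintro _ ⟨b, rfl⟩
    have h : adjoint (Φ ζ) ∘L Φ ξ = Φ (ξ.comp ζ.dag) := by rw [Φ_comp, Φ_dag]
    exact ((congrArg (fun z => Commute z (Δ.PB.ρ b)) h).mpr
      (Δ.PB.ρ_comm b ⟨Φ (ξ.comp ζ.dag), Φ_mem _⟩).symm)

theorem left_SS (x : Γ.PB.E) : x.1 ∈ Λ.leftDatum.SS := (mem_vnGen (leftMults_star Γ)).1 x.2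

theorem right_SS (b : Δ.PB.E) : Δ.PB.ρ b ∈ Λ.rightDatum.SS :=
  Set.subset_centralizer_centralizer ⟨b, rfl⟩

/-- The left action of `A`, the normal extension of `a · ξ = Λ(a) ξ`. -/
noncomputable def leftAct : Γ.PB.E →⋆ₐ[ℂ] (Hilb Λ.tower →L[ℂ] Hilb Λ.tower) :=
  Λ.leftDatum.hom Γ.PB.alg.toStarSubalgebra fun x hx => Λ.left_SS ⟨x, hx⟩

/-- The right action of `B`, the normal extension of `ξ · b = ξ ∘ b`. -/
noncomputable def rightAct : Δ.PB.Eᵐᵒᵖ →⋆ₐ[ℂ] (Hilb Λ.tower →L[ℂ] Hilb Λ.tower) where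
  toFun b := Λ.rightDatum.act (Δ.PB.ρ b.unop)
  map_one' := by rw [MulOpposite.unop_one, TracialVN.ρ_one, ExtDatum.act_one]
  map_mul' a b := by
    rw [MulOpposite.unop_mul, TracialVN.ρ_mul,
      Λ.rightDatum.act_mul (Λ.right_SS _) (Λ.right_SS _)]
  map_zero' := by
    have h := Λ.rightDatum.act_smul 0 (Λ.right_SS 0)
    rw [← TracialVN.ρ_smul, zero_smul, zero_smul] at h
    exact h
  map_add' a b := by
    rw [MulOpposite.unop_add, TracialVN.ρ_add,
      Λ.rightDatum.act_add (Λ.right_SS _) (Λ.right_SS _)]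
  commutes' r := by
    rw [Algebra.algebraMap_eq_smul_one, Algebra.algebraMap_eq_smul_one, MulOpposite.unop_smul,
      MulOpposite.unop_one, TracialVN.ρ_smul, Λ.rightDatum.act_smul r (Λ.right_SS _),
      TracialVN.ρ_one, ExtDatum.act_one]
  map_star' b := by
    rw [MulOpposite.unop_star, TracialVN.ρ_star, Λ.rightDatum.act_adjoint (Λ.right_SS _)]
    rfl

theorem leftAct_Φ (c : EvHom Γ.base Γ.base) :
    Λ.leftDatum.act (Φ c) = Φ (Λ.lam c) := by
  refine Hilb.ext fun ξ => ?_
  have h := Λ.leftDatum.act_e (Set.subset_centralizer_centralizer ⟨c, rfl⟩) ξ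
  refine h.trans ?_
  have h2 := congrArg (fun z : Hilb Γ.base →L[ℂ] Hilb Λ.tower => z (Ωvec Γ)) (Λ.R_Φ ξ c)
  refine h2.trans ?_
  exact congrArg (Φ (Λ.lam c)) (Λ.leftDatum.R_ω ξ)

theorem rightAct_ι (b : Δ.PB.E) (ξ : EvHom Δ.base Λ.tower) :
    Λ.rightDatum.act (Δ.PB.ρ b) (ι Λ.tower ξ) = Φ ξ (b.1 (Ωvec Δ)) :=
  (Λ.rightDatum.act_e (Λ.right_SS b) ξ).trans (congrArg (Φ ξ) (Δ.PB.ρ_ω b))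

/-- The bimodule `PB(Λ) = H`, an `A`-`B`-bimodule. -/
noncomputable def PB : VNBimod.{w₁, w₂, w₂} Γ.PB Δ.PB where
  H := Hilb Λ.tower
  left := Λ.leftAct
  right := Λ.rightAct
  comm a b := by
    refine (Λ.leftDatum.act_comm (T := Λ.rightAct b) ?_ (Λ.left_SS a)).symm
    rintro _ ⟨c, rfl⟩
    rw [leftAct_Φ]
    refine Hilb.ext fun ξ => ?_
    have h := Λ.rightAct_ι b.unop
    change Λ.rightDatum.act (Δ.PB.ρ b.unop) (Φ (Λ.lam c) (ι Λ.tower ξ)) =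
      Φ (Λ.lam c) (Λ.rightDatum.act (Δ.PB.ρ b.unop) (ι Λ.tower ξ))
    rw [Φ_ι, h, h, Φ_comp]
    rfl
  left_normal := by
    refine IsNormal.of_dense₂ (fun x => Λ.leftDatum.norm_act_le (Λ.left_SS x)) (ι_dense Λ.tower) ?_
    rintro _ ⟨ζ, rfl⟩ _ ⟨ξ, rfl⟩ l K x₀ hK hx
    have h : ∀ x : Γ.PB.E, ⟪ι Λ.tower ζ, Λ.leftAct x (ι Λ.tower ξ)⟫_ℂ =
        ⟪adjoint (Λ.R ξ) (ι Λ.tower ζ), x.1 (Ωvec Γ)⟫_ℂ := fun x => by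
      rw [ContinuousLinearMap.adjoint_inner_left]
      exact congrArg _ (Λ.leftDatum.act_e (Λ.left_SS x) ξ)
    simp only [h]
    exact hx _ _
  right_normal := by
    refine IsNormal.of_dense₂ (fun x => (Λ.rightDatum.norm_act_le (Λ.right_SS x)).trans
      (Δ.PB.norm_ρ_le x)) (ι_dense Λ.tower) ?_
    rintro _ ⟨ζ, rfl⟩ _ ⟨ξ, rfl⟩ l K x₀ hK hx
    have h : ∀ x : Δ.PB.E, ⟪ι Λ.tower ζ, Λ.rightAct (MulOpposite.op x) (ι Λ.tower ξ)⟫_ℂ =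
        ⟪adjoint (Φ ξ) (ι Λ.tower ζ), x.1 (Ωvec Δ)⟫_ℂ := fun x => by
      rw [ContinuousLinearMap.adjoint_inner_left]
      exact congrArg _ (Λ.rightAct_ι x ξ)
    simp only [h]
    exact hx _ _

end OneCell

end OneCells

/-! ### Connes fusion -/

/-- A Hermitian positive semidefinite kernel. -/
structure PosKer (P : Type u) where
  k : P → P → ℂ
  herm : ∀ p q, conj (k q p) = k p q
  psd : ∀ (s : Finset P) (c : P → ℂ), 0 ≤ (∑ p ∈ s, ∑ q ∈ s, conj (c p) * c q * k p q).re

namespace PosKer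

variable {P : Type u} (κ : PosKer P)

/-- Finite formal linear combinations of elements of `P`, with the semi-inner product given by the
kernel. -/
def Pre (_ : PosKer P) : Type u := P →₀ ℂ

noncomputable instance : AddCommGroup κ.Pre := inferInstanceAs (AddCommGroup (P →₀ ℂ))

noncomputable instance : Module ℂ κ.Pre := inferInstanceAs (Module ℂ (P →₀ ℂ))

/-- The form `⟪∑ a_p p, ∑ b_q q⟫ = ∑ conj a_p * b_q * k p q`. -/
noncomputable def form (f g : P →₀ ℂ) : ℂ := f.sum fun p a => g.sum fun q b => conj a * b * κ.k p q

theorem form_conj (f g : P →₀ ℂ) : conj (κ.form g f) = κ.form f g := by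
  unfold form Finsupp.sum
  rw [map_sum, Finset.sum_congr rfl fun p _ => map_sum _ _ _, Finset.sum_comm]
  refine Finset.sum_congr rfl fun p _ => Finset.sum_congr rfl fun q _ => ?_
  rw [map_mul, map_mul, Complex.conj_conj, κ.herm]
  ring

theorem form_add (f f' g : P →₀ ℂ) : κ.form (f + f') g = κ.form f g + κ.form f' g := by
  classical
  refine Finsupp.sum_add_index' (fun p => ?_) fun p a b => ?_
  · simp
  · rw [← Finsupp.sum_add]
    refine Finset.sum_congr rfl fun q _ => ?_
    rw [map_add]; ring

theorem form_smul (f g : P →₀ ℂ) (c : ℂ) : κ.form (c • f) g = conj c * κ.form f g := by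
  unfold form
  rw [Finsupp.sum_smul_index fun p => by simp, Finsupp.mul_sum]
  refine Finset.sum_congr rfl fun p _ => ?_
  beta_reduce
  rw [Finsupp.mul_sum]
  refine Finset.sum_congr rfl fun q _ => ?_
  beta_reduce
  rw [map_mul]; ring

theorem form_nonneg (f : P →₀ ℂ) : 0 ≤ (κ.form f f).re := κ.psd f.support f

/-- The semi-inner product on formal linear combinations. -/
@[reducible] noncomputable def core : PreInnerProductSpace.Core ℂ κ.Pre where
  inner f g := κ.form f g
  conj_inner_symm f g := κ.form_conj f g
  re_inner_nonneg f := κ.form_nonneg f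
  add_left f f' g := κ.form_add f f' g
  smul_left f g c := κ.form_smul f g c

noncomputable instance : SeminormedAddCommGroup κ.Pre :=
  letI := κ.core
  InnerProductSpace.Core.toSeminormedAddCommGroup (𝕜 := ℂ)

noncomputable instance : InnerProductSpace ℂ κ.Pre := InnerProductSpace.ofCore κ.core

/-- The Hilbert space of the kernel: the completion of the formal linear combinations modulo
null vectors. -/
abbrev Hil : Type u := UniformSpace.Completion κ.Pre

/-- The canonical map. -/
noncomputable def emb : (P →₀ ℂ) →ₗ[ℂ] κ.Hil where
  toFun := ((↑) : κ.Pre → UniformSpace.Completion κ.Pre)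
  map_add' f g := UniformSpace.Completion.coe_add (α := κ.Pre) f g
  map_smul' c f := UniformSpace.Completion.coe_smul (X := κ.Pre) c f

theorem emb_dense : DenseRange κ.emb := UniformSpace.Completion.denseRange_coe (α := κ.Pre)

theorem inner_emb (f g : P →₀ ℂ) : ⟪κ.emb f, κ.emb g⟫_ℂ = κ.form f g :=
  UniformSpace.Completion.inner_coe (𝕜 := ℂ) (E := κ.Pre) f g

/-- The vector of `p ∈ P`. -/
noncomputable def δ (p : P) : κ.Hil := κ.emb (Finsupp.single p 1)

theorem inner_δ (p q : P) : ⟪κ.δ p, κ.δ q⟫_ℂ = κ.k p q := by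
  rw [δ, δ, inner_emb, form, Finsupp.sum_single_index (by simp), Finsupp.sum_single_index (by simp)]
  simp

theorem emb_eq (f : P →₀ ℂ) : κ.emb f = f.sum fun p c => c • κ.δ p := by
  conv_lhs => rw [← Finsupp.sum_single f]
  rw [map_finsuppSum]
  refine Finset.sum_congr rfl fun p _ => ?_
  change κ.emb (Finsupp.single p (f p)) = f p • κ.emb (Finsupp.single p 1)
  rw [← map_smul, Finsupp.smul_single, smul_eq_mul, mul_one]

theorem ext_δ {G : Type*} [NormedAddCommGroup G] [NormedSpace ℂ G] {S T : κ.Hil →L[ℂ] G}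
    (h : ∀ p, S (κ.δ p) = T (κ.δ p)) : S = T := by
  refine ContinuousLinearMap.coeFn_injective
    (κ.emb_dense.equalizer S.continuous T.continuous (funext fun f => ?_))
  simp only [Function.comp_apply, emb_eq, Finsupp.sum, map_sum, map_smul, h]

theorem ext_inner {a b : κ.Hil} (h : ∀ p, ⟪κ.δ p, a⟫_ℂ = ⟪κ.δ p, b⟫_ℂ) : a = b := by
  refine ext_inner_left ℂ fun v => ?_
  have h1 : Continuous fun v : κ.Hil => ⟪v, a⟫_ℂ := by fun_prop
  have h2 : Continuous fun v : κ.Hil => ⟪v, b⟫_ℂ := by fun_prop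
  refine congrFun (κ.emb_dense.equalizer h1 h2 (funext fun f => ?_)) v
  simp only [Function.comp_apply, emb_eq, Finsupp.sum, sum_inner, inner_smul_left, h]

theorem norm_emb_sq (f : P →₀ ℂ) : ‖κ.emb f‖ ^ 2 =
    (∑ p ∈ f.support, ∑ q ∈ f.support, conj (f p) * f q * κ.k p q).re := by
  rw [← inner_self_eq_norm_sq (𝕜 := ℂ), inner_emb]; rfl

/-- The linear map of formal linear combinations given by a map of the index sets. -/
noncomputable def pre {P' : Type v₁} (κ' : PosKer P') (φ : P → P') : (P →₀ ℂ) →ₗ[ℂ] κ'.Hil :=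
  Finsupp.linearCombination ℂ fun p => κ'.δ (φ p)

theorem norm_pre_sq {P' : Type v₁} (κ' : PosKer P') (φ : P → P') (f : P →₀ ℂ) :
    ‖pre κ' φ f‖ ^ 2 =
      (∑ p ∈ f.support, ∑ q ∈ f.support, conj (f p) * f q * κ'.k (φ p) (φ q)).re := by
  rw [← inner_self_eq_norm_sq (𝕜 := ℂ), pre, Finsupp.linearCombination_apply, Finsupp.sum,
    sum_inner]
  refine congrArg Complex.re (Finset.sum_congr rfl fun p _ => ?_)
  rw [inner_sum]
  refine Finset.sum_congr rfl fun q _ => ?_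
  rw [inner_smul_left, inner_smul_right, inner_δ]
  ring

end PosKer

section Fusion

variable {A : TracialVN.{v₁}} {B : TracialVN.{v₂}} {C : TracialVN.{v₃}}

/-- The bounded right `B`-linear operators `L²(B) → X`. -/
abbrev VNBimod.RLin (X : VNBimod.{v₁, v₂, u₁} A B) : Type _ :=
  {R : B.L →L[ℂ] X.H // ∀ b v, R (B.ρ b v) = X.right (MulOpposite.op b) (R v)}

/-- Bounded right `B`-linear operators. -/
def IsRLin {A' : TracialVN.{v₄}} (X : VNBimod.{v₁, v₂, u₁} A B) (X' : VNBimod.{v₄, v₂, u₂} A' B)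
    (T : X.H →L[ℂ] X'.H) : Prop := ∀ b v, T (X.right b v) = X'.right b (T v)

/-- Bounded left `B`-linear operators. -/
def IsLLin {C' : TracialVN.{v₄}} (Y : VNBimod.{v₂, v₃, u₁} B C) (Y' : VNBimod.{v₂, v₄, u₂} B C')
    (T : Y.H →L[ℂ] Y'.H) : Prop := ∀ b v, T (Y.left b v) = Y'.left b (T v)

namespace VNBimod

theorem right_adjoint (X : VNBimod.{v₁, v₂, u₁} A B) (b : B.Eᵐᵒᵖ) :
    adjoint (X.right b) = X.right (star b) := (map_star X.right b).symm

theorem left_adjoint (X : VNBimod.{v₁, v₂, u₁} A B) (a : A.E) :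
    adjoint (X.left a) = X.left (star a) := (map_star X.left a).symm

theorem isRLin_adjoint {A' : TracialVN.{v₄}} {X : VNBimod.{v₁, v₂, u₁} A B}
    {X' : VNBimod.{v₄, v₂, u₂} A' B} {T : X.H →L[ℂ] X'.H} (hT : IsRLin X X' T) :
    IsRLin X' X (adjoint T) := fun b v => ext_inner_left ℂ fun w => by
  rw [ContinuousLinearMap.adjoint_inner_right, ← ContinuousLinearMap.adjoint_inner_left,
    right_adjoint, ← hT, ← ContinuousLinearMap.adjoint_inner_right, ← right_adjoint,
    ContinuousLinearMap.adjoint_inner_left]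

theorem isLLin_adjoint {C' : TracialVN.{v₄}} {Y : VNBimod.{v₂, v₃, u₁} B C}
    {Y' : VNBimod.{v₂, v₄, u₂} B C'} {T : Y.H →L[ℂ] Y'.H} (hT : IsLLin Y Y' T) :
    IsLLin Y' Y (adjoint T) := fun b v => ext_inner_left ℂ fun w => by
  rw [ContinuousLinearMap.adjoint_inner_right, ← ContinuousLinearMap.adjoint_inner_left,
    left_adjoint, ← hT, ← ContinuousLinearMap.adjoint_inner_right, ← left_adjoint,
    ContinuousLinearMap.adjoint_inner_left]

theorem RLin.adjoint_apply {X : VNBimod.{v₁, v₂, u₁} A B} (R : X.RLin) (b : B.E) (v : X.H) :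
    adjoint R.1 (X.right (MulOpposite.op b) v) = B.ρ b (adjoint R.1 v) :=
  ext_inner_left ℂ fun w => by
    rw [ContinuousLinearMap.adjoint_inner_right, ← ContinuousLinearMap.adjoint_inner_left,
      right_adjoint, ← MulOpposite.op_star, ← R.2, ← ContinuousLinearMap.adjoint_inner_right,
      TracialVN.ρ_star, ContinuousLinearMap.adjoint_inner_left]

/-- The `B`-valued inner product `R* R'` of right `B`-linear operators `L²(B) → X`. -/
noncomputable def RLin.ip {X : VNBimod.{v₁, v₂, u₁} A B} (R R' : X.RLin) : B.E :=
  ⟨adjoint R.1 ∘L R'.1, B.mem_of_comm fun b => ContinuousLinearMap.ext fun v => by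
    rw [mul_apply_eq_comp, mul_apply_eq_comp, ContinuousLinearMap.comp_apply,
      ContinuousLinearMap.comp_apply, R'.2, R.adjoint_apply]⟩

theorem RLin.star_ip {X : VNBimod.{v₁, v₂, u₁} A B} (R R' : X.RLin) : star (R.ip R') = R'.ip R := by
  refine Subtype.ext ?_
  change adjoint (adjoint R.1 ∘L R'.1) = adjoint R'.1 ∘L R.1
  rw [ContinuousLinearMap.adjoint_comp, ContinuousLinearMap.adjoint_adjoint]

/-- The composite `T ∘ R`. -/
def RLin.push {A' : TracialVN.{v₄}} {X : VNBimod.{v₁, v₂, u₁} A B} {X' : VNBimod.{v₄, v₂, u₂} A' B}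
    {T : X.H →L[ℂ] X'.H} (hT : IsRLin X X' T) (R : X.RLin) : X'.RLin :=
  ⟨T ∘L R.1, fun b v => by
    rw [ContinuousLinearMap.comp_apply, R.2, hT, ContinuousLinearMap.comp_apply]⟩

/-- a finite matrix `(R_i* R_j)` is of the form `(∑ k, S_(k,i)* S_(k,j))` with entries in `B` -/
theorem RLin.exists_factor {X : VNBimod.{v₁, v₂, u₁} A B} {n : Type*} [Fintype n]
    (R : n → X.RLin) :
    ∃ S : n → n → B.E, ∀ i j, (R i).ip (R j) = ∑ k, star (S k i) * S k j := by
  classical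
  let pr : ∀ _ : n, PiLp 2 (fun _ : n => B.L) →L[ℂ] B.L := fun i => PiLp.proj 2 (fun _ : n => B.L) i
  let inc : ∀ _ : n, B.L →L[ℂ] PiLp 2 (fun _ : n => B.L) := fun i =>
    (PiLp.continuousLinearEquiv 2 ℂ (fun _ : n => B.L)).symm.toContinuousLinearMap ∘L
      ContinuousLinearMap.single ℂ (fun _ : n => B.L) i
  have hinc : ∀ i v j, inc i v j = if j = i then v else 0 := fun i v j => by
    change Pi.single (M := fun _ : n => B.L) i v j = _
    rw [Pi.single_apply]
  have hadj : ∀ i, adjoint (inc i) = pr i := fun i => by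
    refine ContinuousLinearMap.ext fun v => ext_inner_left ℂ fun w => ?_
    rw [ContinuousLinearMap.adjoint_inner_right, PiLp.inner_apply]
    simp only [hinc]
    rw [Finset.sum_eq_single i]
    · rw [if_pos rfl]; rfl
    · intro j _ hj
      rw [if_neg hj, inner_zero_left]
    · exact fun h => absurd (Finset.mem_univ _) h
  have hsum : ∀ v, ∑ k, inc k (pr k v) = v := fun v => by
    ext j
    rw [WithLp.ofLp_sum, Finset.sum_apply]
    simp only [hinc]
    rw [Finset.sum_ite_eq, if_pos (Finset.mem_univ _)]
    rfl
  let T : PiLp 2 (fun _ : n => B.L) →L[ℂ] X.H := ∑ i, (R i).1 ∘L pr i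
  have hT : ∀ v, T v = ∑ i, (R i).1 (pr i v) := fun v => by
    simp only [T, sum_apply, ContinuousLinearMap.comp_apply]
  have hTinc : ∀ i v, T (inc i v) = (R i).1 v := fun i v => by
    rw [hT, Finset.sum_eq_single i]
    · change (R i).1 (inc i v i) = _
      rw [hinc, if_pos rfl]
    · intro j _ hj
      change (R j).1 (inc i v j) = _
      rw [hinc, if_neg hj, map_zero]
    · exact fun h => absurd (Finset.mem_univ _) h
  let D : B.E → PiLp 2 (fun _ : n => B.L) →L[ℂ] PiLp 2 (fun _ : n => B.L) := fun b =>
    ∑ i, inc i ∘L B.ρ b ∘L pr i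
  have hD : ∀ b v, D b v = ∑ i, inc i (B.ρ b (pr i v)) := fun b v => by
    simp only [D, sum_apply, ContinuousLinearMap.comp_apply]
  have hprinc : ∀ i j v, pr i (inc j v) = if i = j then v else 0 := fun i j v => hinc j v i
  have hDinc : ∀ b i v, D b (inc i v) = inc i (B.ρ b v) := fun b i v => by
    rw [hD, Finset.sum_eq_single i]
    · rw [hprinc, if_pos rfl]
    · intro j _ hj
      rw [hprinc, if_neg hj, map_zero, map_zero]
    · exact fun h => absurd (Finset.mem_univ _) h
  have hprD : ∀ b i v, pr i (D b v) = B.ρ b (pr i v) := fun b i v => by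
    rw [hD, map_sum, Finset.sum_eq_single i]
    · rw [hprinc, if_pos rfl]
    · intro j _ hj
      rw [hprinc, if_neg (Ne.symm hj)]
    · exact fun h => absurd (Finset.mem_univ _) h
  have hTD : ∀ b v, T (D b v) = X.right (MulOpposite.op b) (T v) := fun b v => by
    rw [hD, map_sum, hT, map_sum]
    refine Finset.sum_congr rfl fun i _ => ?_
    rw [hTinc, (R i).2]
  have hprT : ∀ i v, pr i (adjoint T v) = adjoint (R i).1 v := fun i v => by
    refine ext_inner_left ℂ fun z => ?_
    rw [← hadj, ContinuousLinearMap.adjoint_inner_right, ContinuousLinearMap.adjoint_inner_right,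
      hTinc, ContinuousLinearMap.adjoint_inner_right]
  have hcomm : ∀ b, Commute (adjoint T ∘L T) (D b) := fun b => by
    refine ContinuousLinearMap.ext fun v => ?_
    rw [mul_apply_eq_comp, mul_apply_eq_comp, ContinuousLinearMap.comp_apply,
      ContinuousLinearMap.comp_apply, hTD, ← hsum (adjoint T (X.right _ _)), hD]
    refine Finset.sum_congr rfl fun i _ => ?_
    rw [hprT, hprT, RLin.adjoint_apply]
  obtain ⟨q, hq1, hq2, hq3⟩ := UC.exists_factor T
  have hqD : ∀ b v, q (D b v) = D b (q v) := fun b v =>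
    congrArg (fun z : PiLp 2 (fun _ : n => B.L) →L[ℂ] PiLp 2 (fun _ : n => B.L) => z v)
      (hq3 _ (hcomm b)).eq
  refine ⟨fun k i => ⟨pr k ∘L q ∘L inc i, B.mem_of_comm fun b => ContinuousLinearMap.ext fun v => ?_⟩,
    fun i j => Subtype.ext (ContinuousLinearMap.ext fun v => ext_inner_left ℂ fun z => ?_)⟩
  · rw [mul_apply_eq_comp, mul_apply_eq_comp]
    simp only [ContinuousLinearMap.comp_apply]
    rw [← hDinc, hqD, hprD]
  · have h1 : ((∑ k, star (⟨pr k ∘L q ∘L inc i, B.mem_of_comm fun b => ContinuousLinearMap.ext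
        fun v => by
          rw [mul_apply_eq_comp, mul_apply_eq_comp]
          simp only [ContinuousLinearMap.comp_apply]
          rw [← hDinc, hqD, hprD]⟩ : B.E) * ⟨pr k ∘L q ∘L inc j, B.mem_of_comm fun b =>
        ContinuousLinearMap.ext fun v => by
          rw [mul_apply_eq_comp, mul_apply_eq_comp]
          simp only [ContinuousLinearMap.comp_apply]
          rw [← hDinc, hqD, hprD]⟩ : B.E) : B.L →L[ℂ] B.L) v =
        ∑ k, adjoint (pr k ∘L q ∘L inc i) (pr k (q (inc j v))) := by
      rw [AddSubmonoidClass.coe_finsetSum, sum_apply]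
      rfl
    rw [h1, inner_sum]
    change ⟪z, adjoint (R i).1 ((R j).1 v)⟫_ℂ = _
    have h2 : ∀ k, ⟪z, adjoint (pr k ∘L q ∘L inc i) (pr k (q (inc j v)))⟫_ℂ =
        ⟪q (inc i z), inc k (pr k (q (inc j v)))⟫_ℂ := fun k => by
      rw [ContinuousLinearMap.adjoint_inner_right, ← ContinuousLinearMap.adjoint_inner_left (inc k),
        hadj]
      rfl
    have h3 := congrArg (fun z : PiLp 2 (fun _ : n => B.L) →L[ℂ] PiLp 2 (fun _ : n => B.L) =>
      z (inc j v)) hq2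
    simp only [mul_apply_eq_comp, ContinuousLinearMap.comp_apply] at h3
    rw [Finset.sum_congr rfl fun k _ => h2 k, ← inner_sum, hsum,
      ContinuousLinearMap.adjoint_inner_right, ← ContinuousLinearMap.adjoint_inner_right q, hq1, h3,
      ContinuousLinearMap.adjoint_inner_right, hTinc, hTinc]

/-- the form `∑ ⟪ζ_p, (R_p* R_q) ζ_q⟫` is positive -/
theorem RLin.form_nonneg {X : VNBimod.{v₁, v₂, u₁} A B} {Y : VNBimod.{v₂, v₃, u₂} B C}
    {P : Type*} (s : Finset P) (R : P → X.RLin) (ζ : P → Y.H) :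
    0 ≤ (∑ p ∈ s, ∑ q ∈ s, ⟪ζ p, Y.left ((R p).ip (R q)) (ζ q)⟫_ℂ).re := by
  obtain ⟨S, hS⟩ := RLin.exists_factor fun p : s => R p
  have h : ∑ p ∈ s, ∑ q ∈ s, ⟪ζ p, Y.left ((R p).ip (R q)) (ζ q)⟫_ℂ =
      ∑ k : s, ⟪∑ p : s, Y.left (S k p) (ζ p), ∑ p : s, Y.left (S k p) (ζ p)⟫_ℂ := by
    have hk : ∀ k : s, ⟪∑ p : s, Y.left (S k p) (ζ p), ∑ p : s, Y.left (S k p) (ζ p)⟫_ℂ =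
        ∑ p : s, ∑ q : s, ⟪Y.left (S k p) (ζ p), Y.left (S k q) (ζ q)⟫_ℂ := fun k => by
      rw [sum_inner]
      exact Finset.sum_congr rfl fun p _ => inner_sum _ _ _
    rw [Finset.sum_congr rfl fun k _ => hk k]
    conv_rhs => rw [Finset.sum_comm]
    rw [← Finset.sum_coe_sort s]
    refine Finset.sum_congr rfl fun p _ => ?_
    conv_rhs => rw [Finset.sum_comm]
    rw [← Finset.sum_coe_sort s]
    refine Finset.sum_congr rfl fun q _ => ?_
    rw [hS p q, map_sum, sum_apply, inner_sum]
    refine Finset.sum_congr rfl fun k _ => ?_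
    rw [map_mul, mul_apply_eq_comp, ← left_adjoint, ContinuousLinearMap.adjoint_inner_right]
  rw [h, Complex.re_sum]
  exact Finset.sum_nonneg fun k _ => inner_self_nonneg (𝕜 := ℂ)

end VNBimod
end Fusion

theorem IsNormal.of_kernel {A : TracialVN.{v₁}} {P : Type u} (κ : PosKer P)
    {π : A.E → κ.Hil →L[ℂ] κ.Hil} (hπ : ∀ x, ‖π x‖ ≤ ‖x‖)
    (h : ∀ p q, IsNormal fun x => ⟪κ.δ p, π x (κ.δ q)⟫_ℂ) (v v' : κ.Hil) :
    IsNormal fun x => ⟪v, π x v'⟫_ℂ := by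
  refine IsNormal.of_dense₂ hπ κ.emb_dense ?_ v v'
  rintro _ ⟨f, rfl⟩ _ ⟨g, rfl⟩ l K x₀ hK hx
  simp only [PosKer.emb_eq, Finsupp.sum, map_sum, map_smul, sum_inner, inner_sum, inner_smul_left,
    inner_smul_right]
  refine tendsto_finsetSum _ fun p _ => Tendsto.const_mul _ (tendsto_finsetSum _ fun q _ => ?_)
  exact (h _ _ l K x₀ hK hx).const_mul _

section Fusion

variable {A : TracialVN.{v₁}} {B : TracialVN.{v₂}} {C : TracialVN.{v₃}}

namespace VNBimod

/-- The semi-inner product `⟪R ⊗ ζ, R' ⊗ ζ'⟫ = ⟪ζ, (R* R') ζ'⟫` on the elementary tensors `R ⊗ ζ`,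
where `R : L²(B) → X` is bounded and right `B`-linear and `ζ ∈ Y`. -/
noncomputable def fusionKer (X : VNBimod.{v₁, v₂, u₁} A B) (Y : VNBimod.{v₂, v₃, u₂} B C) :
    PosKer (X.RLin × Y.H) where
  k p q := ⟪p.2, Y.left (p.1.ip q.1) q.2⟫_ℂ
  herm p q := by
    rw [inner_conj_symm, ← ContinuousLinearMap.adjoint_inner_right, left_adjoint, RLin.star_ip]
  psd s c := by
    have h := RLin.form_nonneg s (fun p : X.RLin × Y.H => p.1) (fun p => c p • p.2)
    refine h.trans_eq ?_
    congr 1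
    refine Finset.sum_congr rfl fun p _ => Finset.sum_congr rfl fun q _ => ?_
    rw [map_smul, inner_smul_left, inner_smul_right, mul_assoc]

theorem fusionKer_k (X : VNBimod.{v₁, v₂, u₁} A B) (Y : VNBimod.{v₂, v₃, u₂} B C)
    (p q : X.RLin × Y.H) : (fusionKer X Y).k p q = ⟪p.2, Y.left (p.1.ip q.1) q.2⟫_ℂ := rfl

section Map

variable {A' : TracialVN.{v₄}} {C' : TracialVN.{w}}
  {X : VNBimod.{v₁, v₂, u₁} A B} {X' : VNBimod.{v₄, v₂, u₂} A' B}
  {Y : VNBimod.{v₂, v₃, u₃} B C} {Y' : VNBimod.{v₂, w, w₁} B C'}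
  {T : X.H →L[ℂ] X'.H} (hT : IsRLin X X' T) {S : Y.H →L[ℂ] Y'.H}

/-- `R ⊗ ζ ↦ T R ⊗ S ζ` on elementary tensors. -/
def tmap (S : Y.H →L[ℂ] Y'.H) (p : X.RLin × Y.H) : X'.RLin × Y'.H := (p.1.push hT, S p.2)

theorem isRLin_id : IsRLin X X (ContinuousLinearMap.id ℂ X.H) := fun _ _ => rfl

theorem isLLin_id : IsLLin Y Y (ContinuousLinearMap.id ℂ Y.H) := fun _ _ => rfl

theorem norm_tmap₁ (f : X.RLin × Y.H →₀ ℂ) :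
    ‖PosKer.pre (fusionKer X' Y) (tmap hT (ContinuousLinearMap.id ℂ Y.H)) f‖ ≤
      ‖T‖ * ‖(fusionKer X Y).emb f‖ := by
  refine (pow_le_pow_iff_left₀ (norm_nonneg _) (by positivity) two_ne_zero).1 ?_
  obtain ⟨D, hD1, hD2, hD3⟩ := exists_defect T
  have hD : IsRLin X X D := fun b v => by
    refine congrArg (fun z : X.H →L[ℂ] X.H => z v) (hD3 (X.right b) ?_).eq
    refine ContinuousLinearMap.ext fun v => ?_
    change adjoint T (T (X.right b v)) = X.right b (adjoint T (T v))
    rw [hT, isRLin_adjoint hT]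
  have h := RLin.form_nonneg f.support (fun p : X.RLin × Y.H => p.1.push hD)
    (fun p => f p • p.2)
  have hip : ∀ R R' : X.RLin, (R.push hD).ip (R'.push hD) =
      ((‖T‖ ^ 2 : ℝ) : ℂ) • R.ip R' - (R.push hT).ip (R'.push hT) := fun R R' => by
    refine Subtype.ext (ContinuousLinearMap.ext fun v => ext_inner_left ℂ fun w => ?_)
    change ⟪w, adjoint (D ∘L R.1) (D (R'.1 v))⟫_ℂ = ⟪w, ((‖T‖ ^ 2 : ℝ) : ℂ) •
      adjoint R.1 (R'.1 v) - adjoint (T ∘L R.1) (T (R'.1 v))⟫_ℂ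
    have h2 := congrArg (fun z : X.H →L[ℂ] X.H => z (R'.1 v)) hD2
    simp only [mul_apply_eq_comp, sub_apply, smul_apply, one_apply_eq_self,
      ContinuousLinearMap.comp_apply] at h2
    rw [inner_sub_right, inner_smul_right, ContinuousLinearMap.adjoint_inner_right,
      ContinuousLinearMap.adjoint_inner_right, ContinuousLinearMap.adjoint_inner_right,
      ContinuousLinearMap.comp_apply, ContinuousLinearMap.comp_apply,
      ← ContinuousLinearMap.adjoint_inner_right D, hD1, h2, inner_sub_right, inner_smul_right,
      ContinuousLinearMap.adjoint_inner_right]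
  rw [mul_pow, PosKer.norm_pre_sq, PosKer.norm_emb_sq, ← Complex.re_ofReal_mul, ← sub_nonneg,
    ← Complex.sub_re]
  refine h.trans_eq (congrArg _ ?_)
  rw [Finset.mul_sum, ← Finset.sum_sub_distrib]
  refine Finset.sum_congr rfl fun p _ => ?_
  rw [Finset.mul_sum, ← Finset.sum_sub_distrib]
  refine Finset.sum_congr rfl fun q _ => ?_
  rw [hip, map_sub, map_smul, map_smul, sub_apply, smul_apply, inner_smul_right, inner_smul_left,
    inner_sub_right, inner_smul_right, fusionKer_k, fusionKer_k]
  simp only [tmap, ContinuousLinearMap.id_apply]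
  ring

theorem norm_tmap₂ (hS : IsLLin Y Y' S) (f : X.RLin × Y.H →₀ ℂ) :
    ‖PosKer.pre (fusionKer X Y') (tmap isRLin_id S) f‖ ≤ ‖S‖ * ‖(fusionKer X Y).emb f‖ := by
  refine (pow_le_pow_iff_left₀ (norm_nonneg _) (by positivity) two_ne_zero).1 ?_
  obtain ⟨D, hD1, hD2, hD3⟩ := exists_defect S
  have hD : ∀ b v, D (Y.left b v) = Y.left b (D v) := fun b v => by
    refine congrArg (fun z : Y.H →L[ℂ] Y.H => z v) (hD3 (Y.left b) ?_).eq
    refine ContinuousLinearMap.ext fun v => ?_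
    change adjoint S (S (Y.left b v)) = Y.left b (adjoint S (S v))
    rw [hS, isLLin_adjoint hS]
  have h := RLin.form_nonneg f.support (fun p : X.RLin × Y.H => p.1)
    (fun p => f p • D p.2)
  rw [mul_pow, PosKer.norm_pre_sq, PosKer.norm_emb_sq, ← Complex.re_ofReal_mul, ← sub_nonneg,
    ← Complex.sub_re]
  refine h.trans_eq (congrArg _ ?_)
  rw [Finset.mul_sum, ← Finset.sum_sub_distrib]
  refine Finset.sum_congr rfl fun p _ => ?_
  rw [Finset.mul_sum, ← Finset.sum_sub_distrib]
  refine Finset.sum_congr rfl fun q _ => ?_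
  have h2 := congrArg (fun z : Y.H →L[ℂ] Y.H => z (Y.left (p.1.ip q.1) q.2)) hD2
  simp only [mul_apply_eq_comp, sub_apply, smul_apply, one_apply_eq_self,
    ContinuousLinearMap.comp_apply] at h2
  have h3 : (fusionKer X Y').k (tmap isRLin_id S p) (tmap isRLin_id S q) =
      ⟪S p.2, S (Y.left (p.1.ip q.1) q.2)⟫_ℂ := by
    rw [hS]; rfl
  rw [map_smul, inner_smul_left, inner_smul_right, ← hD,
    ← ContinuousLinearMap.adjoint_inner_right D, hD1, h2, h3,
    inner_sub_right, inner_smul_right, ContinuousLinearMap.adjoint_inner_right, fusionKer_k]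
  ring

theorem norm_tmap (hS : IsLLin Y Y' S) (f : X.RLin × Y.H →₀ ℂ) :
    ‖PosKer.pre (fusionKer X' Y') (tmap hT S) f‖ ≤ ‖T‖ * ‖S‖ * ‖(fusionKer X Y).emb f‖ := by
  classical
  have h1 := norm_tmap₁ (Y := Y') hT (f.mapDomain (tmap isRLin_id S))
  have h2 : (fusionKer X Y').emb (f.mapDomain (tmap isRLin_id S)) =
      PosKer.pre (fusionKer X Y') (tmap isRLin_id S) f := by
    rw [PosKer.emb_eq, PosKer.pre, Finsupp.linearCombination_apply,
      Finsupp.sum_mapDomain_index (by simp) (by intros; rw [add_smul])]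
  have h3 : PosKer.pre (fusionKer X' Y') (tmap hT (ContinuousLinearMap.id ℂ Y'.H))
      (f.mapDomain (tmap isRLin_id S)) = PosKer.pre (fusionKer X' Y') (tmap hT S) f := by
    rw [PosKer.pre, Finsupp.linearCombination_mapDomain]
    rfl
  rw [h2, h3] at h1
  rw [mul_assoc]
  exact h1.trans (mul_le_mul_of_nonneg_left (norm_tmap₂ hS f) (norm_nonneg _))

/-- The operator `T ⊗ S` on Connes fusions, for `T` right `B`-linear and `S` left `B`-linear:
`R ⊗ ζ ↦ T R ⊗ S ζ`. -/
noncomputable def tensor (S : Y.H →L[ℂ] Y'.H) :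
    (fusionKer X Y).Hil →L[ℂ] (fusionKer X' Y').Hil :=
  (PosKer.pre (fusionKer X' Y') (tmap hT S)).extendOfNorm (fusionKer X Y).emb

theorem tensor_δ (hS : IsLLin Y Y' S) (p : X.RLin × Y.H) :
    tensor hT S ((fusionKer X Y).δ p) = (fusionKer X' Y').δ (p.1.push hT, S p.2) := by
  have h := LinearMap.extendOfNorm_eq (f := PosKer.pre (fusionKer X' Y') (tmap hT S))
    (fusionKer X Y).emb_dense ⟨_, norm_tmap hT hS⟩ (Finsupp.single p 1)
  refine h.trans ?_
  rw [PosKer.pre, Finsupp.linearCombination_single, one_smul]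
  rfl

theorem norm_tensor_le (hS : IsLLin Y Y' S) : ‖tensor (X := X) (Y := Y) hT S‖ ≤ ‖T‖ * ‖S‖ :=
  LinearMap.opNorm_extendOfNorm_le (fusionKer X Y).emb_dense (by positivity) (norm_tmap hT hS)

end Map

section Actions

variable (X : VNBimod.{v₁, v₂, u₁} A B) (Y : VNBimod.{v₂, v₃, u₂} B C)

theorem isRLin_left (a : A.E) : IsRLin X X (X.left a) := fun b v =>
  congrArg (fun z : X.H →L[ℂ] X.H => z v) (X.comm a b).eq

theorem isLLin_right (c : C.Eᵐᵒᵖ) : IsLLin Y Y (Y.right c) := fun b v =>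
  congrArg (fun z : Y.H →L[ℂ] Y.H => z v) (Y.comm b c).eq.symm

/-- `R* a R'`. -/
noncomputable def RLin.ipL {X : VNBimod.{v₁, v₂, u₁} A B} (R R' : X.RLin) (a : A.E) : B.E :=
  R.ip (R'.push (isRLin_left X a))

theorem RLin.ipL_apply {X : VNBimod.{v₁, v₂, u₁} A B} (R R' : X.RLin) (a : A.E) (v : B.L) :
    (R.ipL R' a).1 v = adjoint R.1 (X.left a (R'.1 v)) := rfl

theorem ipL_ext {b b' : B.E} (h : ∀ v, b.1 v = b'.1 v) :
    b = b' := Subtype.ext (ContinuousLinearMap.ext h)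

/-- The left action `a (R ⊗ ζ) = a R ⊗ ζ`. -/
noncomputable def fusionL (a : A.E) : (fusionKer X Y).Hil →L[ℂ] (fusionKer X Y).Hil :=
  tensor (isRLin_left X a) (ContinuousLinearMap.id ℂ Y.H)

/-- The right action `(R ⊗ ζ) c = R ⊗ ζ c`. -/
noncomputable def fusionR (c : C.Eᵐᵒᵖ) : (fusionKer X Y).Hil →L[ℂ] (fusionKer X Y).Hil :=
  tensor (isRLin_id (X := X)) (Y.right c)

theorem fusionL_δ (a : A.E) (p : X.RLin × Y.H) :
    fusionL X Y a ((fusionKer X Y).δ p) = (fusionKer X Y).δ (p.1.push (isRLin_left X a), p.2) :=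
  tensor_δ (isRLin_left X a) isLLin_id p

theorem fusionR_δ (c : C.Eᵐᵒᵖ) (p : X.RLin × Y.H) :
    fusionR X Y c ((fusionKer X Y).δ p) = (fusionKer X Y).δ (p.1, Y.right c p.2) :=
  tensor_δ isRLin_id (isLLin_right Y c) p

theorem inner_fusionL (a : A.E) (p q : X.RLin × Y.H) :
    ⟪(fusionKer X Y).δ p, fusionL X Y a ((fusionKer X Y).δ q)⟫_ℂ =
      ⟪p.2, Y.left (p.1.ipL q.1 a) q.2⟫_ℂ := by
  rw [fusionL_δ, PosKer.inner_δ]; rfl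

theorem inner_fusionR (c : C.Eᵐᵒᵖ) (p q : X.RLin × Y.H) :
    ⟪(fusionKer X Y).δ p, fusionR X Y c ((fusionKer X Y).δ q)⟫_ℂ =
      ⟪p.2, Y.left (p.1.ip q.1) (Y.right c q.2)⟫_ℂ := by
  rw [fusionR_δ, PosKer.inner_δ]; rfl

theorem fusion_ext {S T : (fusionKer X Y).Hil →L[ℂ] (fusionKer X Y).Hil}
    (h : ∀ p q, ⟪(fusionKer X Y).δ p, S ((fusionKer X Y).δ q)⟫_ℂ =
      ⟪(fusionKer X Y).δ p, T ((fusionKer X Y).δ q)⟫_ℂ) : S = T :=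
  (fusionKer X Y).ext_δ fun q => (fusionKer X Y).ext_inner fun p => h p q

theorem norm_fusionL_le (a : A.E) : ‖fusionL X Y a‖ ≤ ‖a‖ := by
  refine (norm_tensor_le (isRLin_left X a) isLLin_id).trans ?_
  refine (mul_le_of_le_one_right (norm_nonneg _) ContinuousLinearMap.norm_id_le).trans ?_
  exact NonUnitalStarAlgHom.norm_apply_le X.left a

theorem norm_fusionR_le (c : C.Eᵐᵒᵖ) : ‖fusionR X Y c‖ ≤ ‖c‖ := by
  refine (norm_tensor_le isRLin_id (isLLin_right Y c)).trans ?_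
  refine (mul_le_of_le_one_left (norm_nonneg _) ContinuousLinearMap.norm_id_le).trans ?_
  exact NonUnitalStarAlgHom.norm_apply_le Y.right c

/-- The left action on the Connes fusion as a `*`-homomorphism. -/
noncomputable def fusionLHom : A.E →⋆ₐ[ℂ] ((fusionKer X Y).Hil →L[ℂ] (fusionKer X Y).Hil) where
  toFun := fusionL X Y
  map_one' := fusion_ext X Y fun p q => by
    have h : p.1.ipL q.1 1 = p.1.ip q.1 := ipL_ext fun v => by
      rw [RLin.ipL_apply, map_one]; rfl
    rw [inner_fusionL, h, one_apply_eq_self, PosKer.inner_δ]; rfl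
  map_mul' a b := (fusionKer X Y).ext_δ fun q => by
    rw [mul_apply_eq_comp, fusionL_δ, fusionL_δ, fusionL_δ]
    congr 2
    refine Subtype.ext (ContinuousLinearMap.ext fun v => ?_)
    change X.left (a * b) (q.1.1 v) = X.left a (X.left b (q.1.1 v))
    rw [map_mul]; rfl
  map_zero' := fusion_ext X Y fun p q => by
    have h : p.1.ipL q.1 0 = 0 := ipL_ext fun v => by
      rw [RLin.ipL_apply, map_zero, zero_apply, map_zero]; rfl
    rw [inner_fusionL, h, map_zero, zero_apply, zero_apply, inner_zero_right, inner_zero_right]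
  map_add' a b := fusion_ext X Y fun p q => by
    have h : p.1.ipL q.1 (a + b) = p.1.ipL q.1 a + p.1.ipL q.1 b :=
      ipL_ext fun v => by
        rw [RLin.ipL_apply, map_add, add_apply, map_add]; rfl
    rw [inner_fusionL, h, map_add, add_apply, add_apply, inner_add_right, inner_add_right,
      inner_fusionL, inner_fusionL]
  commutes' r := fusion_ext X Y fun p q => by
    have h : p.1.ipL q.1 (algebraMap ℂ A.E r) = r • p.1.ip q.1 :=
      ipL_ext fun v => by
        rw [RLin.ipL_apply, AlgHomClass.commutes, Algebra.algebraMap_eq_smul_one, smul_apply,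
          one_apply_eq_self, map_smul]
        rfl
    rw [inner_fusionL, h, Algebra.algebraMap_eq_smul_one, map_smul, smul_apply, smul_apply,
      one_apply_eq_self, inner_smul_right, inner_smul_right, PosKer.inner_δ]
    rfl
  map_star' a := fusion_ext X Y fun p q => by
    have h : p.1.ipL q.1 (star a) = star (q.1.ipL p.1 a) := by
      refine ipL_ext fun v => ext_inner_left ℂ fun w => ?_
      change _ = ⟪w, adjoint (q.1.ipL p.1 a).1 v⟫_ℂ
      rw [RLin.ipL_apply, ContinuousLinearMap.adjoint_inner_right,
        ContinuousLinearMap.adjoint_inner_right, RLin.ipL_apply, ← left_adjoint,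
        ContinuousLinearMap.adjoint_inner_right, ContinuousLinearMap.adjoint_inner_left]
    rw [inner_fusionL, h, ← left_adjoint, ContinuousLinearMap.adjoint_inner_right,
      ContinuousLinearMap.star_eq_adjoint, ContinuousLinearMap.adjoint_inner_right]
    conv_rhs => rw [← inner_conj_symm, inner_fusionL, inner_conj_symm]

/-- The right action on the Connes fusion as a `*`-homomorphism. -/
noncomputable def fusionRHom : C.Eᵐᵒᵖ →⋆ₐ[ℂ] ((fusionKer X Y).Hil →L[ℂ] (fusionKer X Y).Hil) where
  toFun := fusionR X Y
  map_one' := fusion_ext X Y fun p q => by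
    rw [inner_fusionR, map_one, one_apply_eq_self, one_apply_eq_self, PosKer.inner_δ]; rfl
  map_mul' a b := (fusionKer X Y).ext_δ fun q => by
    rw [mul_apply_eq_comp, fusionR_δ, fusionR_δ, fusionR_δ, map_mul]; rfl
  map_zero' := fusion_ext X Y fun p q => by
    rw [inner_fusionR, map_zero, zero_apply, map_zero, zero_apply, inner_zero_right,
      inner_zero_right]
  map_add' a b := fusion_ext X Y fun p q => by
    rw [inner_fusionR, map_add, add_apply, map_add, add_apply, inner_add_right, inner_add_right,
      inner_fusionR, inner_fusionR]
  commutes' r := fusion_ext X Y fun p q => by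
    rw [inner_fusionR, AlgHomClass.commutes, Algebra.algebraMap_eq_smul_one,
      Algebra.algebraMap_eq_smul_one, smul_apply, smul_apply,
      one_apply_eq_self, one_apply_eq_self, map_smul, inner_smul_right, inner_smul_right,
      PosKer.inner_δ]
    rfl
  map_star' c := fusion_ext X Y fun p q => by
    rw [inner_fusionR, ← isLLin_right Y (star c), ← right_adjoint,
      ContinuousLinearMap.adjoint_inner_right, ← ContinuousLinearMap.adjoint_inner_left,
      left_adjoint, RLin.star_ip,
      ContinuousLinearMap.star_eq_adjoint, ContinuousLinearMap.adjoint_inner_right]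
    conv_rhs => rw [← inner_conj_symm, inner_fusionR, inner_conj_symm]

/-- The Connes fusion `X ⊗_B Y` of an `A`-`B`-bimodule `X` and a `B`-`C`-bimodule `Y`. -/
noncomputable def fusion : VNBimod A C where
  H := (fusionKer X Y).Hil
  left := fusionLHom X Y
  right := fusionRHom X Y
  comm a c := (fusionKer X Y).ext_δ fun p => by
    change fusionL X Y a (fusionR X Y c _) = fusionR X Y c (fusionL X Y a _)
    rw [fusionL_δ, fusionR_δ, fusionL_δ, fusionR_δ]
  left_normal := by
    refine IsNormal.of_kernel (fusionKer X Y) (norm_fusionL_le X Y) fun p q l K x₀ hK hx => ?_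
    change Tendsto (fun a => ⟪(fusionKer X Y).δ p, fusionL X Y a ((fusionKer X Y).δ q)⟫_ℂ) l
      (𝓝 ⟪(fusionKer X Y).δ p, fusionL X Y x₀ ((fusionKer X Y).δ q)⟫_ℂ)
    simp only [inner_fusionL]
    have h := Y.left_normal p.2 q.2 (l.map (p.1.ipL q.1)) (‖p.1.1‖ * (K * ‖q.1.1‖))
      (p.1.ipL q.1 x₀) ?_ fun v v' => ?_
    · exact tendsto_map'_iff.1 h
    · rw [eventually_map]
      filter_upwards [hK] with a ha
      refine (ContinuousLinearMap.opNorm_comp_le _ _).trans ?_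
      rw [LinearIsometryEquiv.norm_map]
      refine mul_le_mul_of_nonneg_left ?_ (norm_nonneg _)
      refine (ContinuousLinearMap.opNorm_comp_le _ _).trans ?_
      refine mul_le_mul_of_nonneg_right ?_ (norm_nonneg _)
      exact (NonUnitalStarAlgHom.norm_apply_le X.left a).trans ha
    · rw [tendsto_map'_iff]
      have h := X.left_normal (p.1.1 v) (q.1.1 v') l K x₀ hK hx
      refine (h.congr fun a => ?_).trans_eq (congrArg _ ?_)
      · exact (ContinuousLinearMap.adjoint_inner_right p.1.1 _ _).symm
      · exact (ContinuousLinearMap.adjoint_inner_right p.1.1 _ _).symm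
  right_normal := by
    refine IsNormal.of_kernel (fusionKer X Y)
      (fun c => norm_fusionR_le X Y (MulOpposite.op c)) fun p q l K x₀ hK hx => ?_
    have h : ∀ c : C.E, ⟪(fusionKer X Y).δ p, fusionRHom X Y (MulOpposite.op c)
        ((fusionKer X Y).δ q)⟫_ℂ =
          ⟪adjoint (Y.left (p.1.ip q.1)) p.2, Y.right (MulOpposite.op c) q.2⟫_ℂ := fun c => by
      rw [ContinuousLinearMap.adjoint_inner_left]
      exact inner_fusionR X Y _ p q
    simp only [h]
    exact Y.right_normal _ _ l K x₀ hK hx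

/-- The elementary tensor `R ⊗ ζ` in the Connes fusion. -/
noncomputable def tmul {X : VNBimod.{v₁, v₂, u₁} A B} {Y : VNBimod.{v₂, v₃, u₂} B C} (R : X.RLin)
    (ζ : Y.H) : (fusion X Y).H := (fusionKer X Y).δ (R, ζ)

end Actions

end VNBimod
end Fusion

theorem VNBimod.Hom.rlin {A : TracialVN.{v₁}} {B : TracialVN.{v₂}} {X : VNBimod.{v₁, v₂, u₁} A B}
    {X' : VNBimod.{v₁, v₂, w₁} A B} (T : X.Hom X') : IsRLin X X' T.op := T.map_right

theorem VNBimod.Hom.llin {A : TracialVN.{v₁}} {B : TracialVN.{v₂}} {X : VNBimod.{v₁, v₂, u₁} A B}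
    {X' : VNBimod.{v₁, v₂, w₁} A B} (T : X.Hom X') : IsLLin X X' T.op := T.map_left

/-- The tensor product `T ⊗ S` of intertwiners, an intertwiner of Connes fusions. -/
noncomputable def VNBimod.Hom.tensor {A : TracialVN.{v₁}} {B : TracialVN.{v₂}}
    {C : TracialVN.{v₃}} {X : VNBimod.{v₁, v₂, u₁} A B} {X' : VNBimod.{v₁, v₂, w₁} A B}
    {Y : VNBimod.{v₂, v₃, u₂} B C} {Y' : VNBimod.{v₂, v₃, w₂} B C} (T : X.Hom X') (S : Y.Hom Y') :
    (fusion X Y).Hom (fusion X' Y') where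
  op := VNBimod.tensor (X := X) (X' := X') (Y := Y) (Y' := Y') T.rlin S.op
  map_left a v := by
    refine congrArg (fun z : (fusionKer X Y).Hil →L[ℂ] (fusionKer X' Y').Hil => z v)
      ((fusionKer X Y).ext_δ (S := VNBimod.tensor T.rlin S.op ∘L fusionL X Y a)
        (T := fusionL X' Y' a ∘L VNBimod.tensor T.rlin S.op) fun p => ?_)
    rw [ContinuousLinearMap.comp_apply, ContinuousLinearMap.comp_apply, fusionL_δ,
      tensor_δ _ S.llin, tensor_δ _ S.llin, fusionL_δ]
    refine congrArg (fun z => (fusionKer X' Y').δ (z, S.op p.2))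
      (Subtype.ext (ContinuousLinearMap.ext fun v => ?_))
    exact T.map_left a (p.1.1 v)
  map_right c v := by
    refine congrArg (fun z : (fusionKer X Y).Hil →L[ℂ] (fusionKer X' Y').Hil => z v)
      ((fusionKer X Y).ext_δ (S := VNBimod.tensor T.rlin S.op ∘L fusionR X Y c)
        (T := fusionR X' Y' c ∘L VNBimod.tensor T.rlin S.op) fun p => ?_)
    rw [ContinuousLinearMap.comp_apply, ContinuousLinearMap.comp_apply, fusionR_δ,
      tensor_δ _ S.llin, tensor_δ _ S.llin, fusionR_δ, S.map_right]

theorem VNBimod.Hom.tensor_tmul {A : TracialVN.{v₁}} {B : TracialVN.{v₂}}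
    {C : TracialVN.{v₃}} {X : VNBimod.{v₁, v₂, u₁} A B} {X' : VNBimod.{v₁, v₂, w₁} A B}
    {Y : VNBimod.{v₂, v₃, u₂} B C} {Y' : VNBimod.{v₂, v₃, w₂} B C} (T : X.Hom X') (S : Y.Hom Y')
    (R : X.RLin) (ζ : Y.H) :
    (T.tensor S).op (VNBimod.tmul R ζ) = VNBimod.tmul (R.push T.rlin) (S.op ζ) :=
  tensor_δ T.rlin S.llin (R, ζ)

/-! ### The functor `PB` on `2`-cells -/

section TwoCells

variable {Δ : ZeroCell.{u₂, w₂}} {y y' : Tower Δ}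

/-- The terms of `EvHom.ofLevel`. -/
noncomputable def EvHom.ofLevelSeq (k : ℕ) (γ : y.obj k ⟶ y'.obj k) :
    ∀ n, y.obj n ⟶ y'.obj n
  | 0 => if h : k = 0 then h ▸ γ else 0
  | n + 1 => if h : k = n + 1 then h ▸ γ else
      CStarCat.dag (y.u n) ≫ (Δ.F n).map (EvHom.ofLevelSeq k γ n) ≫ y'.u n

theorem EvHom.ofLevelSeq_self (k : ℕ) (γ : y.obj k ⟶ y'.obj k) : EvHom.ofLevelSeq k γ k = γ := by
  cases k with
  | zero => simp [EvHom.ofLevelSeq]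
  | succ k => simp [EvHom.ofLevelSeq]

/-- A morphism `γ : y k ⟶ y' k` as an element of the inductive limit: the sequence which is `γ` in
degree `k` and the image of `γ` under the inclusions in all higher degrees. -/
noncomputable def EvHom.ofLevel (k : ℕ) (γ : y.obj k ⟶ y'.obj k) : EvHom y y' :=
  ⟨EvHom.ofLevelSeq k γ, by
    filter_upwards [eventually_ge_atTop k] with n hn
    have h : EvHom.ofLevelSeq k γ (n + 1) =
        CStarCat.dag (y.u n) ≫ (Δ.F n).map (EvHom.ofLevelSeq k γ n) ≫ y'.u n := by
      rw [EvHom.ofLevelSeq, dif_neg (by omega)]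
    rw [h, ← Category.assoc, y.u_isom, Category.id_comp]⟩

variable {Γ : ZeroCell.{u₁, w₁}} {Λ Ω : OneCell Γ Δ}

/-- The intertwiner `T` is `PB(η)`: the operators `Φ` of the morphisms
`η_k : Λ_k Γ_k ⋯ Γ_1 m₀ → Ω_k Γ_k ⋯ Γ_1 m₀` converge to `T` in the strong operator topology. -/
def IsPB (η : ∀ k, Λ.L k ⟶ Ω.L k) (T : Λ.PB.Hom Ω.PB) : Prop :=
  ∀ v : Hilb Λ.tower, Tendsto (fun k =>
    Φ (EvHom.ofLevel (y := Λ.tower) (y' := Ω.tower) k ((η k).app (Γ.x k))) v) atTop (𝓝 (T.op v))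

end TwoCells

section Product

variable {Γ : ZeroCell.{u₁, w₁}} {Δ : ZeroCell.{u₂, w₂}} {Θ : ZeroCell.{u₃, w₃}}

/-- For `ξ ∈ H_∞`, the right `B`-linear operator `L²(B) → H` extending `b ↦ ξ ∘ b`. -/
noncomputable def OneCell.Φvec (Λ : OneCell Γ Δ) (ξ : EvHom Δ.base Λ.tower) : Λ.PB.RLin :=
  ⟨Φ ξ, fun b v => (Λ.rightDatum.act_R (Λ.right_SS b) ξ v).symm⟩

theorem mulVec_aux {C : Type*} [Category* C] {D : Type*} [Category* D] {E : Type*} [Category* E]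
    {F : Type*} [Category* F] {G : C ⥤ D} {H : E ⥤ F} {L : C ⥤ E} {L' : D ⥤ F}
    (W : L ⋙ H ⟶ G ⋙ L') {a b : C} {z : E} {d : D} (ζ : z ⟶ L.obj a) (ξ : a ⟶ b)
    (w : G.obj b ⟶ d) :
    (H.map ζ ≫ W.app a) ≫ L'.map (G.map ξ ≫ w) = H.map (ζ ≫ L.map ξ) ≫ W.app b ≫ L'.map w := by
  have h := W.naturality ξ
  simp only [Functor.comp_map] at h
  simp only [Functor.map_comp, Category.assoc]
  rw [reassoc_of% h]

/-- The elements `Ω_k(ξ_k) ∘ ζ_k` of the dense subspace of `PB(Ω ⊠ Λ)`. -/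
noncomputable def OneCell.mulVec (Ω : OneCell Δ Θ) (Λ : OneCell Γ Δ) (ξ : EvHom Δ.base Λ.tower)
    (ζ : EvHom Θ.base Ω.tower) : EvHom Θ.base (Ω.box Λ).tower :=
  ⟨fun k => ζ.val k ≫ (Ω.L k).map (ξ.val k), by
    filter_upwards [ξ.ev, ζ.ev] with k h1 h2
    have h1' : ξ.val (k + 1) = (Δ.F k).map (ξ.val k) ≫ (Λ.W k).app (Γ.x k) :=
      (Category.id_comp (X := Δ.x (k + 1)) _).symm.trans h1
    have h2' : ζ.val (k + 1) = (Θ.F k).map (ζ.val k) ≫ (Ω.W k).app (Δ.x k) :=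
      (Category.id_comp (X := Θ.x (k + 1)) _).symm.trans h2
    refine (Category.id_comp (X := Θ.x (k + 1)) _).trans ?_
    rw [h1', h2']
    exact mulVec_aux (Ω.W k) (ζ.val k) (ξ.val k) ((Λ.W k).app (Γ.x k))⟩

end Product

end UC

open UC

/-! Part (i). For `ξ, ξ'` in the dense subspace of `PB(Λ)`, the operator `Φ_ξ* Φ_ξ'` on `L²(B)` is
left multiplication by `ξ*ξ' ∈ B_∞`, and this element acts on `PB(Ω)` as `Ω(ξ*ξ') = Ω(ξ)*Ω(ξ')`.
Hence the tensors `Φ_ξ ⊗ ζ` and the vectors `Ω(ξ)ζ` have the same Gram matrix (`inner_tmul_Φvec`),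
and `U` exists and is unitary once both families are total. In the target, each `Δ.x N` is a
generator (`ZeroCell.isGen_x`), so the identity of `Λ_N m_N` is a finite sum of composites through
`Δ.x N`, and every vector of level `N` is a finite sum of vectors `Ω(ξ)ζ` (`boxSpan_dense`). In the
fusion, a right `B`-linear `R` is approximated only at the trace vector. This suffices because a
vector `ζ` of the dense subspace is left bounded: `‖R ⊗ ζ‖` is at most a constant depending on `ζ`
times the norm of the value of `R` at the trace vector (`norm_tmul_ι_le`, `fusionSpan_dense`).

Part (ii). A tracial solution turns the loop operator into a trace-preserving, contractive
conditional expectation (`Tr_condExp`, `isom_ρ'`). A BQFS is therefore a bounded martingale: its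
matrix coefficients between vectors of level `k` do not change beyond level `k`. Applied to a fixed
vector it has orthogonal increments, so it converges strongly (`exists_limit_martingale`), which
gives `PB(η)` and `PB(κ)`.

The horizontal composite of `η⁽ᵏ⁾` and `κ⁽ᵏ⁾` sends `Ω¹(ξ)v` to `Ω²(η⁽ᵏ⁾ξ)(κ⁽ᵏ⁾v)`
(`Φ_boxMap_hcomp`), so these composites converge strongly to `X = U(PB(η) ⊗ PB(κ))U⁻¹`
(`tendsto_hcomp`). Loop operators preserve coefficients between vectors of level `k`, so the
iterated loops of the composites have coefficients converging to those of `X`. Morphism spaces are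
finite dimensional and coefficients separate points, so this is norm convergence at one object; the
norm of a natural transformation is attained at a generator, so it is convergence in C*-norm
(`exists_bqfs`). The limits have the coefficients of `X` at every level. They are therefore
quasi-flat, and their strong limit is `X`, which yields (a) and (b) together. -/

namespace UC

open CStarCat
open ContinuousLinearMap (adjoint)
open scoped InnerProductSpace

/-! ### C*-norms through sums of squares, and generating objects -/

section NormOrder

/-- `a* a ≤ ‖a‖²`, and a positive element has the form `g* g`. Together with the converse below,
this encodes a norm bound as an algebraic identity, which survives compression and summation. -/
theorem exists_defect_star {A : Type*} [CStarAlgebra A] (a : A) :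
    ∃ g : A, ((‖a‖ ^ 2 : ℝ) : ℂ) • (1 : A) = star a * a + star g * g := by
  let _ := CStarAlgebra.spectralOrder A
  have := CStarAlgebra.spectralOrderedRing A
  have h : 0 ≤ algebraMap ℝ A (‖a‖ ^ 2) - star a * a :=
    sub_nonneg.2 CStarAlgebra.star_mul_le_algebraMap_norm_sq
  obtain ⟨g, hg⟩ := CStarAlgebra.nonneg_iff_eq_star_mul_self.1 h
  refine ⟨g, ?_⟩
  rw [← hg, add_sub_cancel, Algebra.algebraMap_eq_smul_one, Complex.coe_smul]

theorem norm_sq_le_of_defect {A : Type*} [CStarAlgebra A] (a : A) {ι : Type*} (s : Finset ι)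
    (g : ι → A) {r : ℝ} (hr : 0 ≤ r)
    (h : (r : ℂ) • (1 : A) = star a * a + ∑ j ∈ s, star (g j) * g j) : ‖a‖ ^ 2 ≤ r := by
  let _ := CStarAlgebra.spectralOrder A
  have := CStarAlgebra.spectralOrderedRing A
  have h1 : star a * a ≤ algebraMap ℝ A r := by
    rw [Algebra.algebraMap_eq_smul_one, ← Complex.coe_smul, h]
    exact le_add_of_nonneg_right (Finset.sum_nonneg fun j _ => star_mul_self_nonneg (g j))
  have h2 := (CStarAlgebra.norm_le_iff_le_algebraMap (star a * a) hr (star_mul_self_nonneg a)).2 h1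
  rwa [CStarRing.norm_star_mul_self, ← sq] at h2

variable {C : Type u} [Category.{w} C] [Preadditive C] [Linear ℂ C] [CStarCat C]

/-- By the positivity axiom `f* f = h* h` for an endomorphism `h` of the source, so the statement
for a single C*-algebra applies to `h`, which has the norm of `f`. -/
theorem exists_defect_hom {X Y : C} (f : X ⟶ Y) :
    ∃ g : X ⟶ X, ((nrm f ^ 2 : ℝ) : ℂ) • 𝟙 X = f ≫ dag f + g ≫ dag g := by
  obtain ⟨h, hh⟩ := CStarCat.pos f
  have h1 : nrm h = nrm f := by
    have h2 := nrm_cstar f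
    rw [hh, nrm_cstar] at h2
    exact (pow_left_inj₀ (nrm_nonneg _) (nrm_nonneg _) two_ne_zero).1 h2
  let _ := endCStarAlgebra X
  obtain ⟨g, hg⟩ := exists_defect_star (A := End X) h
  refine ⟨g, ?_⟩
  rw [hh, ← h1]
  -- Multiplication in `End X` is in the order of functions, so `star h * h` unfolds to `h ≫ dag h`.
  exact hg

theorem nrm_sq_le_of_defect {X Y : C} (f : X ⟶ Y) {ι : Type*} (s : Finset ι) {Z : ι → C}
    (g : ∀ j, X ⟶ Z j) {r : ℝ} (hr : 0 ≤ r)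
    (h : (r : ℂ) • 𝟙 X = f ≫ dag f + ∑ j ∈ s, g j ≫ dag (g j)) : nrm f ^ 2 ≤ r := by
  obtain ⟨a, ha⟩ := CStarCat.pos f
  choose b hb using fun j => CStarCat.pos (g j)
  have h1 : nrm a ^ 2 = nrm f ^ 2 := by rw [← nrm_cstar, ← nrm_cstar, ha]
  rw [← h1]
  let _ := endCStarAlgebra X
  refine norm_sq_le_of_defect (A := End X) a s b hr ?_
  rw [ha, Finset.sum_congr rfl fun j _ => hb j] at h
  exact h

/-- Every object is a retract of a multiple of `m`, in the sense that its identity is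
`∑ p_j* p_j` for finitely many morphisms `p_j : x ⟶ m`. -/
def IsGen (m : C) : Prop :=
  ∀ x : C, ∃ (n : ℕ) (p : Fin n → (x ⟶ m)), ∑ j, p j ≫ dag (p j) = 𝟙 x

theorem StarLinear.sum_map {D : Type u₂} [Category.{w₂} D] [Preadditive D] [Linear ℂ D]
    [CStarCat D] (F : C ⥤ D) [StarLinear F] {x m : C} {n : ℕ} {p : Fin n → (x ⟶ m)}
    (hp : ∑ j, p j ≫ dag (p j) = 𝟙 x) : ∑ j, F.map (p j) ≫ dag (F.map (p j)) = 𝟙 (F.obj x) := by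
  rw [← F.map_id, ← hp, StarLinear.map_sum]
  simp [StarLinear.map_dag]

/-- the norm of a natural transformation is attained at a generator -/
theorem IsGen.nrm_app_le {D : Type u₂} [Category.{w₂} D] [Preadditive D] [Linear ℂ D]
    [CStarCat D] {F G : C ⥤ D} [StarLinear F] [StarLinear G] {m : C} (hm : IsGen m)
    (θ : F ⟶ G) (x : C) : nrm (θ.app x) ≤ nrm (θ.app m) := by
  obtain ⟨n, p, hp⟩ := hm x
  obtain ⟨g, hg⟩ := exists_defect_hom (θ.app m)
  refine (pow_le_pow_iff_left₀ (nrm_nonneg _) (nrm_nonneg _) two_ne_zero).1 ?_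
  -- The defect identity `‖θ_m‖² = θ_m* θ_m + g* g` is compressed by each `F(p_j)` and summed. Since
  -- `∑ p_j* p_j = 1`, this gives a defect identity at `x` with the same constant.
  refine nrm_sq_le_of_defect (θ.app x) Finset.univ (fun j => F.map (p j) ≫ g)
    (sq_nonneg _) ?_
  -- The adjoints `θ*` form a natural transformation too, because the functors preserve adjoints;
  -- hence `θ* θ` commutes with the image of `p_j*`.
  have hn : ∀ j, θ.app m ≫ dag (θ.app m) ≫ F.map (dag (p j)) =
      F.map (dag (p j)) ≫ θ.app x ≫ dag (θ.app x) := fun j => by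
    have h1 := congrArg dag (θ.naturality (p j))
    rw [dag_comp, dag_comp, ← StarLinear.map_dag, ← StarLinear.map_dag] at h1
    rw [h1, ← θ.naturality_assoc]
  have h1 : θ.app x ≫ dag (θ.app x) =
      ∑ j, F.map (p j) ≫ (θ.app m ≫ dag (θ.app m)) ≫ dag (F.map (p j)) := by
    conv_lhs => rw [← Category.id_comp (θ.app x ≫ dag (θ.app x)), ← StarLinear.sum_map F hp,
      Preadditive.sum_comp]
    refine Finset.sum_congr rfl fun j _ => ?_
    rw [Category.assoc, Category.assoc, ← StarLinear.map_dag, hn]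
  rw [h1, ← Finset.sum_add_distrib, ← StarLinear.sum_map F hp, Finset.smul_sum]
  refine Finset.sum_congr rfl fun j _ => ?_
  have h2 : (F.map (p j) ≫ g) ≫ dag (F.map (p j) ≫ g) =
      F.map (p j) ≫ (g ≫ dag g) ≫ dag (F.map (p j)) := by simp only [dag_comp, Category.assoc]
  rw [h2, ← Preadditive.comp_add, ← Preadditive.add_comp, ← hg, Linear.smul_comp,
    Category.id_comp, Linear.comp_smul]

/-- For a simple source, `f* f` is the scalar `‖f‖²`, so `f / ‖f‖` is an isometry into `m`.
Composing these isometries with the coordinate projections of a decomposition of `x` gives the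
required morphisms. -/
theorem IsGen.of_simple {M : WSSC.{u, w}} {m : M.Obj}
    (h : ∀ v, ∃ f : M.s v ⟶ m, f ≠ 0) : IsGen m := by
  choose f hf using h
  intro x
  obtain ⟨n, i, ⟨S⟩⟩ := FinSS.decomp x
  refine ⟨n, fun j => ((nrm (f (i j)) : ℂ)⁻¹) • (dag (S.inc j) ≫ f (i j)), ?_⟩
  rw [← S.total]
  refine Finset.sum_congr rfl fun j _ => ?_
  have h0 : (nrm (f (i j)) : ℂ) ≠ 0 := by
    exact_mod_cast fun h0 => hf _ (eq_zero_of_nrm _ h0)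
  rw [dag_smul, dag_comp, dag_dag, Linear.smul_comp, Linear.comp_smul, Category.assoc,
    ← Category.assoc (f (i j)), comp_dag_simple, Linear.smul_comp, Linear.comp_smul,
    Category.id_comp, smul_smul, smul_smul]
  rw [map_inv₀, Complex.conj_ofReal]
  push_cast
  field_simp
  rw [one_smul]

/-- The object `m₀` contains every simple object. In the inductive step, if a simple `v` had no
nonzero morphism to `Γ_(k+1) x_k`, then taking adjoints and using the adjunction would give
`Hom(x_k, G v) = 0`. As `x_k` generates, `G v` would vanish, contradicting faithfulness of the
adjoint `G`. -/
theorem ZeroCell.isGen_x (Γ : ZeroCell.{u, w}) (k : ℕ) : IsGen (Γ.x k) := by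
  induction k with
  | zero =>
    refine IsGen.of_simple fun v => ?_
    have S := (FinSS.directSum (Γ.M 0).s).choose_spec.some
    refine ⟨S.inc v, fun h => id_s_ne_zero v ?_⟩
    exact (S.isom v).symm.trans ((congrArg (fun z => z ≫ dag (S.inc v)) h).trans
      Limits.zero_comp)
  | succ k ih =>
    refine IsGen.of_simple fun v => ?_
    by_contra! hv
    obtain ⟨G, ⟨adj⟩, hG⟩ := (Γ.bifaithful k).adjoint_faithful
    have h0 : ∀ f : (Γ.F k).obj (Γ.x k) ⟶ (Γ.M (k + 1)).s v, f = 0 := fun f => by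
      exact (CStarCat.dag_dag f).symm.trans ((congrArg dag (hv (dag f))).trans dag_zero)
    have h1 : ∀ f : Γ.x k ⟶ G.obj ((Γ.M (k + 1)).s v), f = 0 := fun f =>
      (adj.homEquiv _ _).symm.injective ((h0 _).trans (h0 _).symm)
    obtain ⟨n, p, hp⟩ := ih (G.obj ((Γ.M (k + 1)).s v))
    have h2 : 𝟙 (G.obj ((Γ.M (k + 1)).s v)) = 0 := by
      rw [← hp]
      refine Finset.sum_eq_zero fun j _ => ?_
      rw [h1 (dag (p j)), Limits.comp_zero]
    refine id_s_ne_zero v (G.map_injective ?_)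
    -- `G` is not known to be additive, so `G.map 0` is treated like `G.map (𝟙 _)`: both factor
    -- through the identity of `G v`, which is zero.
    rw [← Category.comp_id (G.map (𝟙 _)), ← Category.comp_id (G.map 0), h2, Limits.comp_zero,
      Limits.comp_zero]

end NormOrder

/-! ### Faithfulness of the categorical trace -/

section Faithful

variable {M : WSSC.{u, w}}

/-- Along a decomposition of the source the trace is a sum of squared norms with strictly positive
weights, so every component of `f` vanishes. -/
theorem eq_zero_of_Tr {x y : M.Obj} (f : x ⟶ y) (h : (Tr M (f ≫ dag f)).re = 0) : f = 0 := by
  obtain ⟨n, i, ⟨S⟩⟩ := FinSS.decomp x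
  rw [Tr_pos_eq S, Complex.ofReal_re, Finset.sum_eq_zero_iff_of_nonneg fun j _ =>
    mul_nonneg (sq_nonneg _) (M.wt_pos _).le] at h
  rw [← Category.id_comp f, ← S.total, Preadditive.sum_comp]
  refine Finset.sum_eq_zero fun j _ => ?_
  have h1 := h j (Finset.mem_univ _)
  rw [mul_eq_zero, or_iff_left (M.wt_pos _).ne', sq_eq_zero_iff] at h1
  rw [Category.assoc, eq_zero_of_nrm _ h1, Limits.comp_zero]

/-- the functionals `f ↦ Tr(ζ* f ξ)`, with `ξ` and `ζ` defined on a generator, separate points -/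
theorem IsGen.eq_zero {m : M.Obj} (hm : IsGen m) {x y : M.Obj} (f : x ⟶ y)
    (h : ∀ (ξ : m ⟶ x) (ζ : m ⟶ y), Tr M ((ξ ≫ f) ≫ dag ζ) = 0) : f = 0 := by
  obtain ⟨n, p, hp⟩ := hm x
  rw [← Category.id_comp f, ← hp, Preadditive.sum_comp]
  refine Finset.sum_eq_zero fun j _ => ?_
  -- The hypothesis is used with `ξ = p_j*` and `ζ = f ∘ p_j*`, for which the functional is a
  -- squared trace norm.
  have h1 : dag (p j) ≫ f = 0 := eq_zero_of_Tr _ (by rw [h]; rfl)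
  rw [Category.assoc, h1, Limits.comp_zero]

end Faithful

/-! ### Conditional expectations from tracial solutions -/

namespace TracialSolution

variable {M : WSSC.{u₁, w₁}} {N : WSSC.{u₂, w₂}} {F : M.Obj ⥤ N.Obj} (t : TracialSolution M N F)

/-- The conditional expectation `α ↦ ρ'* F'(α) ρ'` attached to a tracial solution. -/
def condExp {a b : M.Obj} (α : F.obj a ⟶ F.obj b) : a ⟶ b :=
  t.ρ'.app a ≫ t.adj.map α ≫ dag (t.ρ'.app b)

/-- Naturality of the cup `ρ'` and of its adjoint, the cap, lets `F(f)` and `F(g)` slide out of the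
loop. -/
theorem condExp_bimod [StarLinear F] {a b c d : M.Obj} (f : a ⟶ b) (α : F.obj b ⟶ F.obj c)
    (g : c ⟶ d) : t.condExp (F.map f ≫ α ≫ F.map g) = f ≫ t.condExp α ≫ g := by
  have h1 := t.ρ'.naturality f
  have h2 := congrArg dag (t.ρ'.naturality (dag g))
  simp only [Functor.comp_map, Functor.comp_obj, Functor.id_map, Functor.id_obj, dag_comp,
    ← StarLinear.map_dag, dag_dag] at h1 h2
  simp only [condExp, Functor.map_comp, Category.assoc]
  rw [← h2, reassoc_of% h1]

theorem condExp_sum {a b : M.Obj} {ι : Type*} (s : Finset ι) (α : ι → (F.obj a ⟶ F.obj b)) :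
    t.condExp (∑ i ∈ s, α i) = ∑ i ∈ s, t.condExp (α i) := by
  simp only [condExp, StarLinear.map_sum, Preadditive.sum_comp, Preadditive.comp_sum]

/-- On the summand of `F v` that is a copy of `w`, the tracial axiom produces the scalar `(ν_w /
μ_v) c`. The trace of `1_v` is `μ_v`, so `μ_v` cancels and `ν_w c` remains, which is the trace
upstairs. -/
theorem Tr_condExp_simple (v : M.V) (α : F.obj (M.s v) ⟶ F.obj (M.s v)) :
    Tr M (t.condExp α) = Tr N α := by
  obtain ⟨n, i, ⟨S⟩⟩ := FinSS.decomp (F.obj (M.s v))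
  have hα : α = ∑ j, dag (S.inc j) ≫ (S.inc j ≫ α) := by
    conv_lhs => rw [← Category.id_comp α, ← S.total, Preadditive.sum_comp]
    simp
  rw [hα, condExp_sum, Tr_sum, Tr_sum]
  refine Finset.sum_congr rfl fun j _ => ?_
  obtain ⟨c, hc⟩ := exists_scalar ((S.inc j ≫ α) ≫ dag (S.inc j))
  rw [Tr_comm (dag (S.inc j)), hc, Tr_smul, Tr_id_s]
  have h := t.tracial v (i j) (S.inc j ≫ α) (S.inc j) c hc
  rw [condExp, h, Tr_smul, Tr_id_s]
  have hw : (M.wt v : ℂ) ≠ 0 := by exact_mod_cast (M.wt_pos v).ne'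
  push_cast
  field_simp

variable [StarLinear F]

/-- the conditional expectation preserves the traces -/
theorem Tr_condExp {a : M.Obj} (α : F.obj a ⟶ F.obj a) : Tr M (t.condExp α) = Tr N α := by
  obtain ⟨n, i, ⟨S⟩⟩ := FinSS.decomp a
  have h1 := Tr_decomp S (t.condExp α) (𝟙 a)
  have h2 : α = ∑ j, F.map (dag (S.inc j)) ≫ (F.map (S.inc j) ≫ α) := by
    conv_lhs => rw [← Category.id_comp α, ← F.map_id, ← S.total, StarLinear.map_sum,
      Preadditive.sum_comp]
    simp
  rw [Category.comp_id] at h1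
  rw [h1]
  conv_rhs => rw [h2, Tr_sum]
  refine Finset.sum_congr rfl fun j _ => ?_
  rw [Tr_comm (F.map (dag (S.inc j))), Category.id_comp, Category.assoc, Category.assoc,
    ← condExp_bimod, Tr_condExp_simple]

/-- `ρ'* ρ'` is the conditional expectation of the identity. At a simple object it is a scalar, and
trace preservation together with the weight relation `hF` forces this scalar to be `1`. The bimodule
property carries the result to sums. -/
theorem isom_ρ' (hF : ∀ v, adjWt M N F v = M.wt v) (x : M.Obj) : t.ρ'.app x ≫ dag (t.ρ'.app x) = 𝟙 x := by
  have h0 : ∀ a, t.condExp (𝟙 (F.obj a)) = t.ρ'.app a ≫ dag (t.ρ'.app a) := fun a => by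
    rw [condExp, t.adj.map_id]
    exact congrArg _ (Category.id_comp (X := t.adj.obj (F.obj a)) _)
  have hs : ∀ v, t.condExp (𝟙 (F.obj (M.s v))) = 𝟙 (M.s v) := fun v => by
    obtain ⟨c, hc⟩ := exists_scalar (t.condExp (𝟙 (F.obj (M.s v))))
    have h1 := t.Tr_condExp (𝟙 (F.obj (M.s v)))
    have hw : (M.wt v : ℂ) ≠ 0 := by exact_mod_cast (M.wt_pos v).ne'
    rw [Tr_id_map, hF, hc, Tr_smul, Tr_id_s] at h1
    rw [hc, (mul_eq_right₀ hw).1 h1, one_smul]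
  obtain ⟨n, i, ⟨S⟩⟩ := FinSS.decomp x
  have h2 : 𝟙 (F.obj x) = ∑ j, F.map (dag (S.inc j)) ≫ 𝟙 _ ≫ F.map (S.inc j) := by
    rw [← F.map_id, ← S.total, StarLinear.map_sum]
    simp
  refine (h0 x).symm.trans ?_
  rw [h2, condExp_sum, ← S.total]
  refine Finset.sum_congr rfl fun j _ => ?_
  rw [condExp_bimod, hs, Category.id_comp]

/-- The adjoint functor is contractive, being a `*`-functor, and the cup and cap have norm at most
`1`. -/
theorem nrm_condExp_le (hF : ∀ v, adjWt M N F v = M.wt v) {a b : M.Obj}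
    (α : F.obj a ⟶ F.obj b) : nrm (t.condExp α) ≤ nrm α := by
  have h1 : nrm (t.ρ'.app a) ≤ 1 := nrm_isom _ (t.isom_ρ' hF a)
  have h2 : nrm (dag (t.ρ'.app b)) ≤ 1 := by rw [nrm_dag]; exact nrm_isom _ (t.isom_ρ' hF b)
  refine (nrm_comp_le _ _).trans ((mul_le_of_le_one_left (nrm_nonneg _) h1).trans ?_)
  refine (nrm_comp_le _ _).trans ((mul_le_of_le_one_right (nrm_nonneg _) h2).trans ?_)
  exact StarLinear.nrm_map_le t.adj α

end TracialSolution

/-! ### Strong operator limits in Hilbert spaces -/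

section Limits

theorem exists_strong_limit {E : Type v₁} {F : Type v₂} {D : Type v₃} [NormedAddCommGroup E]
    [NormedSpace ℂ E] [CompleteSpace E] [NormedAddCommGroup F] [NormedSpace ℂ F] [CompleteSpace F]
    {e : D → E} (he : DenseRange e) (T : ℕ → E →L[ℂ] F) {K : ℝ} (hK : ∀ k, ‖T k‖ ≤ K)
    (h : ∀ ξ, CauchySeq fun k => T k (e ξ)) :
    ∃ S : E →L[ℂ] F, ∀ v, Tendsto (fun k => T k v) atTop (𝓝 (S v)) := by
  have hK0 : 0 ≤ K := (norm_nonneg _).trans (hK 0)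
  have hc : ∀ v, CauchySeq fun k => T k v := fun v => by
    refine Metric.cauchySeq_iff'.2 fun ε hε => ?_
    -- The tolerance makes `‖T_k (v - e ξ)‖ ≤ ε / 4` for all `k` at once; the `+ 1` keeps the
    -- denominator positive when `K = 0`.
    obtain ⟨ξ, hξ⟩ := he.exists_dist_lt v (ε := ε / 4 / (K + 1)) (by positivity)
    obtain ⟨N, hN⟩ := Metric.cauchySeq_iff'.1 (h ξ) (ε / 4) (by positivity)
    refine ⟨N, fun n hn => ?_⟩
    have hb : ∀ k, dist (T k v) (T k (e ξ)) ≤ ε / 4 := fun k => by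
      rw [dist_eq_norm, ← map_sub]
      rw [dist_eq_norm, lt_div_iff₀ (by positivity)] at hξ
      refine ((T k).le_opNorm _).trans ?_
      have := mul_le_mul_of_nonneg_right (hK k) (norm_nonneg (v - e ξ))
      nlinarith [norm_nonneg (v - e ξ)]
    have h1 := dist_triangle4 (T n v) (T n (e ξ)) (T N (e ξ)) (T N v)
    have h2 := hb N
    rw [dist_comm] at h2
    linarith [hb n, hN n hn]
  choose f hf using fun v => cauchySeq_tendsto_of_complete (hc v)
  -- The pointwise limit of bounded operators on a complete space is bounded, by Banach–Steinhaus.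
  exact ⟨continuousLinearMapOfTendsto (T) (tendsto_pi_nhds.2 hf), hf⟩

/-- `T_k v_k = T_k (v_k - w) + T_k w`, and the first term is killed by the uniform bound. This
allows operators and vectors to vary simultaneously. -/
theorem tendsto_apply_of_bounded {E : Type v₁} {F : Type v₂} [NormedAddCommGroup E]
    [NormedSpace ℂ E] [NormedAddCommGroup F] [NormedSpace ℂ F] {T : ℕ → E →L[ℂ] F} {K : ℝ}
    (hK : ∀ k, ‖T k‖ ≤ K) {S : E →L[ℂ] F} {v : ℕ → E} {w : E} (hv : Tendsto v atTop (𝓝 w))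
    (h : Tendsto (fun k => T k w) atTop (𝓝 (S w))) :
    Tendsto (fun k => T k (v k)) atTop (𝓝 (S w)) := by
  have h1 : Tendsto (fun k => T k (v k - w)) atTop (𝓝 0) := by
    have h2 : Tendsto (fun k => K * ‖v k - w‖) atTop (𝓝 0) := by
      simpa using (tendsto_iff_norm_sub_tendsto_zero.1 hv).const_mul K
    exact squeeze_zero_norm (fun k => ((T k).le_opNorm _).trans
      (mul_le_mul_of_nonneg_right (hK k) (norm_nonneg _))) h2
  simpa using h1.add h

theorem tendsto_of_dense {E : Type v₁} {F : Type v₂} {D : Type v₃} [NormedAddCommGroup E]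
    [NormedSpace ℂ E] [NormedAddCommGroup F] [NormedSpace ℂ F]
    {e : D → E} (he : DenseRange e) {T : ℕ → E →L[ℂ] F} {S : E →L[ℂ] F} {K : ℝ}
    (hK : ∀ k, ‖T k‖ ≤ K) (h : ∀ ξ, Tendsto (fun k => T k (e ξ)) atTop (𝓝 (S (e ξ)))) (v : E) :
    Tendsto (fun k => T k v) atTop (𝓝 (S v)) := by
  have hK0 : 0 ≤ K := (norm_nonneg _).trans (hK 0)
  refine Metric.tendsto_atTop.2 fun ε hε => ?_
  obtain ⟨ξ, hξ⟩ := he.exists_dist_lt v (ε := ε / 4 / (K + ‖S‖ + 1)) (by positivity)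
  obtain ⟨N, hN⟩ := Metric.tendsto_atTop.1 (h ξ) (ε / 4) (by positivity)
  refine ⟨N, fun n hn => ?_⟩
  rw [dist_eq_norm, lt_div_iff₀ (by positivity)] at hξ
  have hb : ∀ R : E →L[ℂ] F, ‖R‖ ≤ K + ‖S‖ → dist (R v) (R (e ξ)) ≤ ε / 4 := fun R hR => by
    rw [dist_eq_norm, ← map_sub]
    refine (R.le_opNorm _).trans ?_
    have := mul_le_mul_of_nonneg_right hR (norm_nonneg (v - e ξ))
    nlinarith [norm_nonneg (v - e ξ)]
  have h1 := dist_triangle4 (T n v) (T n (e ξ)) (S (e ξ)) (S v)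
  have h2 := hb S (by linarith)
  rw [dist_comm] at h2
  linarith [hb (T n) (by linarith [hK n, norm_nonneg S]), hN n hn]

/-- a bounded sequence of vectors with orthogonal increments converges -/
theorem cauchySeq_of_inner_eq {H : Type v₁} [NormedAddCommGroup H] [InnerProductSpace ℂ H]
    {v : ℕ → H} {K : ℝ} (hK : ∀ k, ‖v k‖ ≤ K) {N : ℕ}
    (h : ∀ k ≥ N, ∀ l ≥ k, ⟪v k, v l⟫_ℂ = ⟪v k, v k⟫_ℂ) : CauchySeq v := by
  -- The hypothesis says that `v_l - v_k` is orthogonal to `v_k`, so this is Pythagoras. The squared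
  -- norms are then increasing and bounded, hence Cauchy, and the identity transfers this to `v`.
  have hs : ∀ k ≥ N, ∀ l ≥ k, ‖v l - v k‖ ^ 2 = ‖v l‖ ^ 2 - ‖v k‖ ^ 2 := fun k hk l hl => by
    have h1 := norm_sub_sq (𝕜 := ℂ) (v l) (v k)
    have h2 : RCLike.re ⟪v l, v k⟫_ℂ = ‖v k‖ ^ 2 := by
      rw [inner_re_symm, h k hk l hl, inner_self_eq_norm_sq]
    rw [h1, h2]; ring
  have hm : Monotone fun n => ‖v (n + N)‖ ^ 2 := fun m n hmn => by
    have := hs (m + N) (by omega) (n + N) (by omega)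
    have h0 := sq_nonneg ‖v (n + N) - v (m + N)‖
    change ‖v (m + N)‖ ^ 2 ≤ ‖v (n + N)‖ ^ 2
    linarith
  have hb : BddAbove (Set.range fun n => ‖v (n + N)‖ ^ 2) :=
    ⟨K ^ 2, by rintro _ ⟨n, rfl⟩; exact pow_le_pow_left₀ (norm_nonneg _) (hK _) 2⟩
  have hc := (tendsto_atTop_ciSup hm hb).cauchySeq
  refine Metric.cauchySeq_iff'.2 fun ε hε => ?_
  obtain ⟨n, hn⟩ := Metric.cauchySeq_iff'.1 hc (ε ^ 2) (by positivity)
  refine ⟨n + N, fun k hk => ?_⟩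
  have h1 := hn (k - N) (by omega)
  rw [Nat.sub_add_cancel (by omega), Real.dist_eq, ← hs (n + N) (by omega) k hk,
    abs_of_nonneg (sq_nonneg _)] at h1
  rw [dist_eq_norm]
  exact lt_of_pow_lt_pow_left₀ 2 hε.le h1

end Limits

/-! ### Levels of the inductive limits, and martingales -/

section Towers

variable {Δ : ZeroCell.{u, w}} {y y' y'' : Tower Δ}

namespace EvHom

/-- The sequence is compatible with the inclusions from degree `N` on. -/
def CompatFrom (γ : EvHom y y') (N : ℕ) : Prop :=
  ∀ n ≥ N, y.u n ≫ γ.val (n + 1) = (Δ.F n).map (γ.val n) ≫ y'.u n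

theorem exists_compatFrom (γ : EvHom y y') : ∃ N, γ.CompatFrom N := eventually_atTop.1 γ.ev

theorem CompatFrom.mono {γ : EvHom y y'} {N N' : ℕ} (h : γ.CompatFrom N) (hN : N ≤ N') :
    γ.CompatFrom N' := fun n hn => h n (hN.trans hn)

theorem CompatFrom.comp {γ : EvHom y y'} {δ : EvHom y' y''} {N : ℕ} (h : γ.CompatFrom N)
    (h' : δ.CompatFrom N) : (γ.comp δ).CompatFrom N := fun n hn => by
  rw [comp_val, comp_val, reassoc_of% h n hn, h' n hn, Functor.map_comp, Category.assoc]

theorem CompatFrom.val_succ {γ : EvHom y y'} {N n : ℕ} (h : γ.CompatFrom N) (hn : N ≤ n) :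
    γ.val (n + 1) = CStarCat.dag (y.u n) ≫ (Δ.F n).map (γ.val n) ≫ y'.u n := by
  rw [← h n hn, ← Category.assoc, y.u_coisom, Category.id_comp]

theorem CompatFrom.base_val_succ {ξ : EvHom Δ.base y} {N n : ℕ} (h : ξ.CompatFrom N)
    (hn : N ≤ n) : ξ.val (n + 1) = (Δ.F n).map (ξ.val n) ≫ y.u n :=
  (Category.id_comp (X := Δ.x (n + 1)) _).symm.trans (h n hn)

/-- Each inclusion preserves the trace, by the weight relation of the `0`-cell. The inner product
can thus be read off at a prescribed level, and not merely at some sufficiently large one. -/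
theorem CompatFrom.form_eq {ξ η : EvHom Δ.base y} {N : ℕ} (hξ : ξ.CompatFrom N)
    (hη : η.CompatFrom N) : form ξ η = Tr (Δ.M N) (η.val N ≫ CStarCat.dag (ξ.val N)) := by
  have hc : ∀ k ≥ N, Tr (Δ.M k) (η.val k ≫ CStarCat.dag (ξ.val k)) =
      Tr (Δ.M N) (η.val N ≫ CStarCat.dag (ξ.val N)) := by
    intro k hk
    induction k, hk using Nat.le_induction with
    | base => rfl
    | succ k hk ih =>
      rw [← ih, hξ.base_val_succ hk, hη.base_val_succ hk]
      exact Tr_map_isom (Δ.F k) (Δ.wt_succ k) (η.val k) (ξ.val k) (y.u k) (y.u_isom k)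
  obtain ⟨k, h1, h2⟩ := ((EvHom.form_eq ξ η).and (eventually_ge_atTop N)).exists
  rw [h1, hc k h2]

theorem CompatFrom.nrm_le {γ : EvHom y y'} {N n : ℕ} (h : γ.CompatFrom N) (hn : N ≤ n) :
    nrm (γ.val n) ≤ nrm (γ.val N) := by
  induction n, hn using Nat.le_induction with
  | base => exact le_rfl
  | succ k hk ih =>
    have h1 : nrm (CStarCat.dag (y.u k)) ≤ 1 := by rw [nrm_dag]; exact nrm_isom _ (y.u_isom k)
    have h2 : nrm (y'.u k) ≤ 1 := nrm_isom _ (y'.u_isom k)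
    have h3 := StarLinear.nrm_map_le (Δ.F k) (γ.val k)
    rw [h.val_succ hk]
    refine (nrm_comp_le _ _).trans ((mul_le_of_le_one_left (nrm_nonneg _) h1).trans ?_)
    refine (nrm_comp_le _ _).trans ((mul_le_of_le_one_right (nrm_nonneg _) h2).trans ?_)
    exact h3.trans ih

theorem ofLevel_compat (k : ℕ) (γ : y.obj k ⟶ y'.obj k) : (ofLevel k γ).CompatFrom k := by
  intro n hn
  have h : ofLevelSeq k γ (n + 1) =
      CStarCat.dag (y.u n) ≫ (Δ.F n).map (ofLevelSeq k γ n) ≫ y'.u n := by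
    rw [ofLevelSeq, dif_neg (by omega)]
  change y.u n ≫ ofLevelSeq k γ (n + 1) = (Δ.F n).map (ofLevelSeq k γ n) ≫ y'.u n
  rw [h, ← Category.assoc, y.u_isom, Category.id_comp]

@[simp] theorem ofLevel_val_self (k : ℕ) (γ : y.obj k ⟶ y'.obj k) : (ofLevel k γ).val k = γ :=
  ofLevelSeq_self k γ

end EvHom

theorem norm_Φ_le (γ : EvHom y y') {K : ℝ} (hK : 0 ≤ K) (h : ∀ᶠ k in atTop, nrm (γ.val k) ≤ K) :
    ‖Φ γ‖ ≤ K :=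
  LinearMap.opNorm_extendOfNorm_le (f := Φ₀ γ) (ι_dense y) hK fun ξ => norm_ι_comp_le γ hK h ξ

/-- The inclusions do not increase the C*-norm, so the bound at level `k` holds at all higher levels
and passes to the completion. -/
theorem norm_Φ_ofLevel_le (k : ℕ) (γ : y.obj k ⟶ y'.obj k) : ‖Φ (EvHom.ofLevel k γ)‖ ≤ nrm γ := by
  refine norm_Φ_le _ (nrm_nonneg _) ?_
  filter_upwards [eventually_ge_atTop k] with n hn
  exact ((EvHom.ofLevel_compat k γ).nrm_le hn).trans_eq (by rw [EvHom.ofLevel_val_self])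

/-- Compatibility makes the sequences agree from level `N` on, and terms below `N` are invisible to
the inner product. A vector is thus determined by one component at a level from which it is
compatible. -/
theorem ι_eq_of_val {ξ η : EvHom Δ.base y} {N : ℕ} (hξ : ξ.CompatFrom N) (hη : η.CompatFrom N)
    (h : ξ.val N = η.val N) : ι y ξ = ι y η := by
  refine Hilb.ext_inner fun ζ => ?_
  obtain ⟨N', hζ⟩ := ζ.exists_compatFrom
  have hv : ∀ n ≥ N, ξ.val n = η.val n := fun n hn => by
    induction n, hn using Nat.le_induction with
    | base => exact h
    | succ n hn ih => rw [hξ.val_succ hn, hη.val_succ hn, ih]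
  rw [inner_ι, inner_ι, (hζ.mono (le_max_right N N')).form_eq (hξ.mono (le_max_left N N')),
    (hζ.mono (le_max_right N N')).form_eq (hη.mono (le_max_left N N')), hv _ (le_max_left _ _)]

theorem inner_Φ_ofLevel {k : ℕ} (γ : y.obj k ⟶ y'.obj k) {ξ : EvHom Δ.base y}
    {ζ : EvHom Δ.base y'} (hξ : ξ.CompatFrom k) (hζ : ζ.CompatFrom k) :
    ⟪ι y' ζ, Φ (EvHom.ofLevel k γ) (ι y ξ)⟫_ℂ =
      Tr (Δ.M k) ((ξ.val k ≫ γ) ≫ dag (ζ.val k)) := by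
  rw [Φ_ι, inner_ι, hζ.form_eq (hξ.comp (EvHom.ofLevel_compat k γ)), EvHom.comp_val,
    EvHom.ofLevel_val_self]

/-- The conditional expectation `Hom(y (k + 1), y' (k + 1)) → Hom(y k, y' k)`. -/
def towerExp {k : ℕ} (t : TracialSolution (Δ.M k) (Δ.M (k + 1)) (Δ.F k))
    (γ : y.obj (k + 1) ⟶ y'.obj (k + 1)) : y.obj k ⟶ y'.obj k :=
  t.condExp (y.u k ≫ γ ≫ dag (y'.u k))

/-- The bimodule property moves `ξ_k` and `ζ_k*` inside the expectation, and trace preservation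
removes it. What remains is written with `ξ_(k+1) = u ∘ Δ(ξ_k)` and the same for `ζ`. -/
theorem Tr_towerExp {k : ℕ} (t : TracialSolution (Δ.M k) (Δ.M (k + 1)) (Δ.F k))
    (γ : y.obj (k + 1) ⟶ y'.obj (k + 1)) {ξ : EvHom Δ.base y} {ζ : EvHom Δ.base y'}
    (hξ : ξ.CompatFrom k) (hζ : ζ.CompatFrom k) :
    Tr (Δ.M k) ((ξ.val k ≫ towerExp t γ) ≫ dag (ζ.val k)) =
      Tr (Δ.M (k + 1)) ((ξ.val (k + 1) ≫ γ) ≫ dag (ζ.val (k + 1))) := by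
  rw [Category.assoc, towerExp, ← t.condExp_bimod, t.Tr_condExp, hξ.base_val_succ le_rfl,
    hζ.base_val_succ le_rfl, StarLinear.map_dag]
  refine congrArg (Tr (Δ.M (k + 1))) ?_
  change _ = (((Δ.F k).map (ξ.val k) ≫ y.u k) ≫ γ) ≫ dag ((Δ.F k).map (ζ.val k) ≫ y'.u k)
  simp only [dag_comp, Category.assoc]

section Martingale

variable {t : ∀ k, TracialSolution (Δ.M k) (Δ.M (k + 1)) (Δ.F k)}
  {γ : ∀ k, y.obj k ⟶ y'.obj k}

/-- The martingale property in weak form: vectors already defined at level `k` see no difference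
between `γ_k` and the later terms, since each expectation preserves the coefficients. -/
theorem inner_Φ_martingale (hγ : ∀ k, towerExp (t k) (γ (k + 1)) = γ k) {k l : ℕ} (hl : k ≤ l)
    {ξ : EvHom Δ.base y} {ζ : EvHom Δ.base y'} (hξ : ξ.CompatFrom k) (hζ : ζ.CompatFrom k) :
    ⟪ι y' ζ, Φ (EvHom.ofLevel l (γ l)) (ι y ξ)⟫_ℂ =
      ⟪ι y' ζ, Φ (EvHom.ofLevel k (γ k)) (ι y ξ)⟫_ℂ := by
  induction l, hl using Nat.le_induction with
  | base => rfl
  | succ l hl ih =>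
    rw [← ih, inner_Φ_ofLevel _ (hξ.mono hl) (hζ.mono hl), ← hγ l,
      Tr_towerExp (t l) _ (hξ.mono hl) (hζ.mono hl),
      inner_Φ_ofLevel _ (hξ.mono (hl.trans l.le_succ)) (hζ.mono (hl.trans l.le_succ))]

/-- bounded martingales converge in the strong operator topology -/
theorem exists_limit_martingale (hγ : ∀ k, towerExp (t k) (γ (k + 1)) = γ k) {K : ℝ}
    (hK : ∀ k, nrm (γ k) ≤ K) : ∃ T : Hilb y →L[ℂ] Hilb y', ∀ v,
      Tendsto (fun k => Φ (EvHom.ofLevel k (γ k)) v) atTop (𝓝 (T v)) := by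
  have hb : ∀ k, ‖Φ (EvHom.ofLevel k (γ k))‖ ≤ K := fun k => (norm_Φ_ofLevel_le k _).trans (hK k)
  refine exists_strong_limit (ι_dense y) _ hb fun ξ => ?_
  obtain ⟨N, hN⟩ := ξ.exists_compatFrom
  refine cauchySeq_of_inner_eq (K := K * ‖ι y ξ‖) (fun k => (ContinuousLinearMap.le_opNorm _ _).trans
    (mul_le_mul_of_nonneg_right (hb k) (norm_nonneg _))) (N := N) fun k hk l hl => ?_
  conv_lhs => rw [Φ_ι (EvHom.ofLevel k (γ k))]
  conv_rhs => rw [Φ_ι (EvHom.ofLevel k (γ k))]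
  -- The test vector is the `k`-th term `γ_k ξ` itself, which is compatible from level `k` on; this
  -- gives `⟪γ_k ξ, γ_l ξ⟫ = ⟪γ_k ξ, γ_k ξ⟫`, that is, orthogonal increments.
  rw [inner_Φ_martingale hγ hl (hN.mono hk)
    ((hN.mono hk).comp (EvHom.ofLevel_compat k (γ k))), Φ_ι (EvHom.ofLevel k (γ k))]

end Martingale

end Towers

/-! ### Bimodule maps as strong limits, and `PB` of a BQFS -/

section Intertwiners

variable {Γ : ZeroCell.{u₁, w₁}} {Δ : ZeroCell.{u₂, w₂}} {Θ : ZeroCell.{u₃, w₃}}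

theorem Φ_eq_of_val {y y' : Tower Δ} {γ δ : EvHom y y'} {N : ℕ} (hγ : γ.CompatFrom N)
    (hδ : δ.CompatFrom N) (h : γ.val N = δ.val N) : Φ γ = Φ δ := by
  have hv : ∀ n ≥ N, γ.val n = δ.val n := fun n hn => by
    induction n, hn using Nat.le_induction with
    | base => exact h
    | succ n hn ih => rw [hγ.val_succ hn, hδ.val_succ hn, ih]
  refine Hilb.ext fun ξ => ?_
  obtain ⟨N', hξ⟩ := ξ.exists_compatFrom
  have h1 := hξ.mono (le_max_right N N')
  rw [Φ_ι, Φ_ι, ι_eq_of_val (h1.comp (hγ.mono (le_max_left N N')))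
    (h1.comp (hδ.mono (le_max_left N N')))]
  rw [EvHom.comp_val, EvHom.comp_val, hv _ (le_max_left _ _)]

theorem OneCell.lam_compat (Λ : OneCell Γ Δ) {a : EvHom Γ.base Γ.base} {N : ℕ}
    (ha : a.CompatFrom N) : (Λ.lam a).CompatFrom N := fun n hn => by
  have h1 : a.val (n + 1) = (Γ.F n).map (a.val n) :=
    (ha.base_val_succ hn).trans (Category.comp_id (Y := Γ.x (n + 1)) _)
  have h2 := (Λ.W n).naturality (a.val n)
  refine Eq.trans ?_ h2.symm
  exact congrArg (fun z => (Λ.W n).app (Γ.x n) ≫ (Λ.L (n + 1)).map z) h1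

theorem OneCell.leftAct_ι (Λ : OneCell Γ Δ) (a : Γ.PB.E) (ξ : EvHom Δ.base Λ.tower) :
    Λ.leftAct a (ι Λ.tower ξ) = Λ.R ξ (a.1 (Ωvec Γ)) :=
  Λ.leftDatum.act_e (Λ.left_SS a) ξ

theorem OneCell.rightAct_ι' (Λ : OneCell Γ Δ) (b : Δ.PB.Eᵐᵒᵖ) (ξ : EvHom Δ.base Λ.tower) :
    Λ.rightAct b (ι Λ.tower ξ) = Φ ξ (b.unop.1 (Ωvec Δ)) :=
  Λ.rightAct_ι b.unop ξ

/-- The trace property in vector form. Its use is that expressions containing `a*` become continuous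
functions of the vector `a Ω`. -/
theorem star_Ωvec (a : Γ.PB.E) : (star a).1 (Ωvec Γ) = J₀ Γ (a.1 (Ωvec Γ)) :=
  adjoint_Ωvec Γ ((mem_vnGen (leftMults_star Γ)).1 a.2)

/-- On a vector of the dense subspace, `b` acts by `ξ ↦ Φ_ξ (b Ω)`, and composing with `γ` replaces
`Φ_ξ` by `Φ_γ Φ_ξ`. The sources of the two `1`-cells may differ, as needed for maps from `PB(Ω)` to
`PB(Ω ⊠ Λ)`. -/
theorem Φ_rightAct {Γ' : ZeroCell.{u₃, w₃}} (Λ : OneCell Γ Δ) (Λ' : OneCell Γ' Δ)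
    (γ : EvHom Λ.tower Λ'.tower) (b : Δ.PB.Eᵐᵒᵖ) :
    Φ γ ∘L Λ.rightAct b = Λ'.rightAct b ∘L Φ γ := Hilb.ext fun ξ => by
  rw [ContinuousLinearMap.comp_apply, ContinuousLinearMap.comp_apply, Λ.rightAct_ι', Φ_ι,
    Λ'.rightAct_ι', Φ_comp]
  rfl

/-- an operator commuting with the actions of `A_∞` is left `A`-linear -/
theorem leftAct_of_lam {Δ' : ZeroCell.{u₃, w₃}} (Λ : OneCell Γ Δ) (Λ' : OneCell Γ Δ')
    (T : Hilb Λ.tower →L[ℂ] Hilb Λ'.tower)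
    (h : ∀ c ξ, T (Φ (Λ.lam c) (ι Λ.tower ξ)) = Φ (Λ'.lam c) (T (ι Λ.tower ξ)))
    (a : Γ.PB.E) : T ∘L Λ.leftAct a = Λ'.leftAct a ∘L T := by
  refine Hilb.ext fun ξ => Hilb.ext_inner fun ζ => ?_
  have h1 : adjoint (Λ'.leftAct a) = Λ'.leftAct (star a) := (map_star Λ'.leftAct a).symm
  rw [ContinuousLinearMap.comp_apply, ContinuousLinearMap.comp_apply,
    ← ContinuousLinearMap.adjoint_inner_left (Λ'.leftAct a), h1, Λ.leftAct_ι, Λ'.leftAct_ι, star_Ωvec]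
  have hJ := (J₀ Γ).continuous
  -- Both coefficients depend on `a` only through `v = a Ω`, and continuously so. It is enough to
  -- take `v` in `A_∞`, where the hypothesis applies.
  refine ι_ext_fun Γ (f := fun v => ⟪ι Λ'.tower ζ, T (Λ.R ξ v)⟫_ℂ)
    (g := fun v => ⟪Λ'.R ζ (J₀ Γ v), T (ι Λ.tower ξ)⟫_ℂ) (by fun_prop) (by fun_prop)
    (fun c => ?_) _
  simp only [J₀_ι, OneCell.R_ι]
  rw [← Φ_ι, h, ← Φ_ι, OneCell.lam_dag, Φ_dag, ContinuousLinearMap.adjoint_inner_left]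

variable {Λ Ω : OneCell Γ Δ} {t : ∀ k, TracialSolution (Δ.M k) (Δ.M (k + 1)) (Δ.F k)}

theorem ofLevel_lam {k : ℕ} (η : Λ.L k ⟶ Ω.L k) {c : EvHom Γ.base Γ.base} (hc : c.CompatFrom k) :
    Φ ((Λ.lam c).comp (EvHom.ofLevel (y := Λ.tower) (y' := Ω.tower) k (η.app (Γ.x k)))) =
      Φ ((EvHom.ofLevel (y := Λ.tower) (y' := Ω.tower) k (η.app (Γ.x k))).comp (Ω.lam c)) := by
  have h := EvHom.ofLevel_compat (y := Λ.tower) (y' := Ω.tower) k (η.app (Γ.x k))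
  refine Φ_eq_of_val ((Λ.lam_compat hc).comp h) (h.comp (Ω.lam_compat hc)) ?_
  have h1 := EvHom.ofLevel_val_self (y := Λ.tower) (y' := Ω.tower) k (η.app (Γ.x k))
  refine (congrArg (fun z => (Λ.lam c).val k ≫ z) h1).trans (Eq.trans ?_
    (congrArg (fun z => z ≫ (Ω.lam c).val k) h1).symm)
  exact η.naturality (c.val k)

/-- a strong limit of the operators of natural transformations is a bimodule map -/
theorem exists_hom_of_limit (η : ∀ k, Λ.L k ⟶ Ω.L k) (T : Hilb Λ.tower →L[ℂ] Hilb Ω.tower)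
    (hT : ∀ v, Tendsto (fun k => Φ (EvHom.ofLevel (y := Λ.tower) (y' := Ω.tower) k
      ((η k).app (Γ.x k))) v) atTop (𝓝 (T v))) : ∃ S : Λ.PB.Hom Ω.PB, S.op = T := by
  -- By naturality, the `k`-th operator commutes with elements of `A_∞` compatible from level `k`
  -- on. A fixed `c` therefore commutes with all late terms, hence with the limit.
  have hl := leftAct_of_lam Λ Ω T fun c ξ => by
    obtain ⟨N, hN⟩ := c.exists_compatFrom
    refine tendsto_nhds_unique (hT _) (Tendsto.congr' ?_ (((Φ (Ω.lam c)).continuous.tendsto _).comp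
      (hT (ι Λ.tower ξ))))
    filter_upwards [eventually_ge_atTop N] with k hk
    have h := congrArg (fun z : Hilb Λ.tower →L[ℂ] Hilb Ω.tower => z (ι Λ.tower ξ))
      (ofLevel_lam (η k) (hN.mono hk))
    rw [Φ_comp, Φ_comp] at h
    exact h.symm
  have hr : ∀ b v, T (Λ.rightAct b v) = Ω.rightAct b (T v) := fun b v => by
    refine tendsto_nhds_unique (hT _) (Tendsto.congr (fun k => ?_)
      (((Ω.rightAct b).continuous.tendsto _).comp (hT v)))
    exact (congrArg (fun z : Hilb Λ.tower →L[ℂ] Hilb Ω.tower => z v) (Φ_rightAct Λ Ω _ b)).symm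
  exact ⟨⟨T, fun a v => congrArg (fun z : Hilb Λ.tower →L[ℂ] Hilb Ω.tower => z v) (hl a), hr⟩, rfl⟩

/-- The component of the loop operator at `Γ.x k` is the conditional expectation of the tower by
definition, so quasi-flatness is exactly the martingale property. -/
theorem IsBQFS.towerExp_eq {η : ∀ k, Λ.L k ⟶ Ω.L k} (hη : IsBQFS t η) (k : ℕ) :
    towerExp (y := Λ.tower) (y' := Ω.tower) (t k) ((η (k + 1)).app (Γ.x (k + 1))) =
      (η k).app (Γ.x k) :=
  congrArg (fun z : Λ.L k ⟶ Ω.L k => z.app (Γ.x k)) (hη.quasiflat k)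

theorem IsBQFS.exists_isPB {η : ∀ k, Λ.L k ⟶ Ω.L k} (hη : IsBQFS t η) :
    ∃ T : Λ.PB.Hom Ω.PB, IsPB η T := by
  obtain ⟨K, hK⟩ := hη.bounded
  obtain ⟨T, hT⟩ := exists_limit_martingale (y := Λ.tower) (y' := Ω.tower)
    (γ := fun k => (η k).app (Γ.x k)) hη.towerExp_eq fun k => hK k (Γ.x k)
  obtain ⟨S, rfl⟩ := exists_hom_of_limit η T hT
  exact ⟨S, hT⟩

end Intertwiners

/-! ### Estimates for elementary tensors in a Connes fusion -/

section FusionTensors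

variable {A : TracialVN.{v₁}} {B : TracialVN.{v₂}} {C : TracialVN.{v₃}}
  {X : VNBimod.{v₁, v₂, u₁} A B} {Y : VNBimod.{v₂, v₃, u₂} B C}

namespace VNBimod

/-- Differences of right `B`-linear operators. -/
def RLin.sub (R R' : X.RLin) : X.RLin :=
  ⟨R.1 - R'.1, fun b v => by rw [sub_apply, R.2, R'.2, sub_apply, map_sub]⟩

theorem RLin.ip_sub (S R R' : X.RLin) : S.ip (R.sub R') = S.ip R - S.ip R' :=
  Subtype.ext (ContinuousLinearMap.ext fun v => map_sub (adjoint S.1) (R.1 v) (R'.1 v))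

theorem tmul_sub_left (R R' : X.RLin) (ζ : Y.H) :
    (fusionKer X Y).δ (R.sub R', ζ) = (fusionKer X Y).δ (R, ζ) - (fusionKer X Y).δ (R', ζ) :=
  (fusionKer X Y).ext_inner fun p => by
    rw [inner_sub_right, PosKer.inner_δ, PosKer.inner_δ, PosKer.inner_δ, fusionKer_k, fusionKer_k,
      fusionKer_k, RLin.ip_sub, map_sub, sub_apply, inner_sub_right]

theorem RLin.norm_ip_le (R R' : X.RLin) : ‖R.ip R'‖ ≤ ‖R.1‖ * ‖R'.1‖ := by
  have h := ContinuousLinearMap.opNorm_comp_le (adjoint R.1) R'.1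
  rw [LinearIsometryEquiv.norm_map] at h
  exact h

theorem norm_tmul_le (R : X.RLin) (ζ : Y.H) : ‖(fusionKer X Y).δ (R, ζ)‖ ≤ ‖R.1‖ * ‖ζ‖ := by
  refine (pow_le_pow_iff_left₀ (norm_nonneg _) (by positivity) two_ne_zero).1 ?_
  rw [← inner_self_eq_norm_sq (𝕜 := ℂ), PosKer.inner_δ, fusionKer_k]
  refine (RCLike.re_le_norm _).trans ((norm_inner_le_norm _ _).trans ?_)
  have h1 : ‖Y.left (R.ip R)‖ ≤ ‖R.1‖ * ‖R.1‖ :=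
    (NonUnitalStarAlgHom.norm_apply_le Y.left _).trans (R.norm_ip_le R)
  calc ‖ζ‖ * ‖Y.left (R.ip R) ζ‖ ≤ ‖ζ‖ * ((‖R.1‖ * ‖R.1‖) * ‖ζ‖) :=
        mul_le_mul_of_nonneg_left (((Y.left _).le_opNorm ζ).trans
          (mul_le_mul_of_nonneg_right h1 (norm_nonneg _))) (norm_nonneg _)
    _ = (‖R.1‖ * ‖ζ‖) ^ 2 := by ring

/-- the norm of `R ⊗ ζ` is that of `|R| ζ` -/
theorem exists_abs (R : X.RLin) : ∃ S : B.E, (∀ v, ‖S.1 v‖ = ‖R.1 v‖) ∧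
    ∀ ζ, ‖(fusionKer X Y).δ (R, ζ)‖ = ‖Y.left S ζ‖ := by
  -- The one-by-one case of the matrix factorization gives `R* R = S* S` with `S ∈ B`, so `S` plays
  -- the role of `|R|`.
  obtain ⟨S, hS⟩ := RLin.exists_factor fun _ : Unit => R
  have h1 : R.ip R = star (S () ()) * S () () := by rw [hS () ()]; simp
  refine ⟨S () (), fun v => ?_, fun ζ => ?_⟩
  · rw [← sq_eq_sq₀ (norm_nonneg _) (norm_nonneg _), ← inner_self_eq_norm_sq (𝕜 := ℂ),
      ← inner_self_eq_norm_sq (𝕜 := ℂ), ← ContinuousLinearMap.adjoint_inner_right,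
      ← ContinuousLinearMap.adjoint_inner_right R.1]
    exact congrArg (fun z : B.E => RCLike.re ⟪v, z.1 v⟫_ℂ) h1.symm
  · rw [← sq_eq_sq₀ (norm_nonneg _) (norm_nonneg _), ← inner_self_eq_norm_sq (𝕜 := ℂ),
      ← inner_self_eq_norm_sq (𝕜 := ℂ), PosKer.inner_δ, fusionKer_k, h1, map_mul,
      mul_apply_eq_comp, ← left_adjoint, ContinuousLinearMap.adjoint_inner_right]

/-- The operator `ζ ↦ R ⊗ ζ`. -/
noncomputable def tmulCLM (R : X.RLin) : Y.H →L[ℂ] (fusionKer X Y).Hil :=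
  LinearMap.mkContinuous
    { toFun := fun ζ => (fusionKer X Y).δ (R, ζ)
      map_add' := fun a b => (fusionKer X Y).ext_inner fun p => by
        rw [inner_add_right]
        simp only [PosKer.inner_δ, fusionKer_k, map_add, inner_add_right]
      map_smul' := fun c a => (fusionKer X Y).ext_inner fun p => by
        rw [RingHom.id_apply, inner_smul_right]
        simp only [PosKer.inner_δ, fusionKer_k, map_smul, inner_smul_right] }
    ‖R.1‖ (norm_tmul_le R)

theorem norm_tmulCLM_le (R : X.RLin) : ‖tmulCLM (Y := Y) R‖ ≤ ‖R.1‖ :=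
  LinearMap.mkContinuous_norm_le _ (norm_nonneg _) _

end VNBimod

/-- Norms of linear combinations depend only on the Gram matrix. This makes `U` well defined and
isometric at once. -/
theorem norm_linearCombination_eq {P : Type v₁} {H : Type v₂} {H' : Type v₃}
    [NormedAddCommGroup H] [InnerProductSpace ℂ H] [NormedAddCommGroup H'] [InnerProductSpace ℂ H']
    {a : P → H} {b : P → H'} (h : ∀ p q, ⟪a p, a q⟫_ℂ = ⟪b p, b q⟫_ℂ) (f : P →₀ ℂ) :
    ‖Finsupp.linearCombination ℂ a f‖ = ‖Finsupp.linearCombination ℂ b f‖ := by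
  rw [← sq_eq_sq₀ (norm_nonneg _) (norm_nonneg _), ← inner_self_eq_norm_sq (𝕜 := ℂ),
    ← inner_self_eq_norm_sq (𝕜 := ℂ)]
  simp only [Finsupp.linearCombination_apply, Finsupp.sum, sum_inner, inner_sum, inner_smul_left,
    inner_smul_right, h]

end FusionTensors

/-! ### The unitary from the Connes fusion to the bimodule of the composite `1`-cell -/

section FusionIso

variable {Γ : ZeroCell.{u₁, w₁}} {Δ : ZeroCell.{u₂, w₂}} {Θ : ZeroCell.{u₃, w₃}}

theorem EvHom.sum_val {y y' : Tower Δ} {ι : Type*} (s : Finset ι) (γ : ι → EvHom y y') (k : ℕ) :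
    (∑ i ∈ s, γ i).val k = ∑ i ∈ s, (γ i).val k := by
  classical
  induction s using Finset.induction_on with
  | empty => rfl
  | insert a t ha ih => rw [Finset.sum_insert ha, Finset.sum_insert ha, add_val, ih]

theorem EvHom.CompatFrom.sum {y y' : Tower Δ} {ι : Type*} {s : Finset ι} {γ : ι → EvHom y y'}
    {N : ℕ} (h : ∀ i ∈ s, (γ i).CompatFrom N) : (∑ i ∈ s, γ i).CompatFrom N := fun n hn => by
  rw [sum_val, sum_val, StarLinear.map_sum, Preadditive.comp_sum, Preadditive.sum_comp]
  exact Finset.sum_congr rfl fun i hi => h i hi n hn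

theorem app_map_comp {C : Type*} [Category* C] {D : Type*} [Category* D] {E : Type*} [Category* E]
    {F : Type*} [Category* F] {G : C ⥤ D} {H : E ⥤ F} {L : C ⥤ E} {L' : D ⥤ F}
    (W : L ⋙ H ⟶ G ⋙ L') {a b : C} {d : D} (ξ : a ⟶ b) (w : G.obj b ⟶ d) :
    W.app a ≫ L'.map (G.map ξ ≫ w) = H.map (L.map ξ) ≫ W.app b ≫ L'.map w := by
  have h := W.naturality ξ
  simp only [Functor.comp_map] at h
  simp only [Functor.map_comp]
  rw [reassoc_of% h]

namespace OneCell

variable (Ω : OneCell Δ Θ) (Λ : OneCell Γ Δ)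

/-- Once `ξ_(n+1)` is written as `W ∘ Δ(ξ_n)`, naturality of the connection of `Ω` at `ξ_n` produces
the connection of the composite `1`-cell. -/
theorem boxMap_aux {ξ : EvHom Δ.base Λ.tower} {N : ℕ} (h : ξ.CompatFrom N) (n : ℕ) (hn : N ≤ n) :
    (Ω.W n).app (Δ.x n) ≫ (Ω.L (n + 1)).map (ξ.val (n + 1)) =
      (Θ.F n).map ((Ω.L n).map (ξ.val n)) ≫ (Ω.W n).app ((Λ.L n).obj (Γ.x n)) ≫
        (Ω.L (n + 1)).map ((Λ.W n).app (Γ.x n)) := by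
  have h2 : ξ.val (n + 1) = (Δ.F n).map (ξ.val n) ≫ (Λ.W n).app (Γ.x n) := h.base_val_succ hn
  refine (congrArg (fun z => (Ω.W n).app (Δ.x n) ≫ (Ω.L (n + 1)).map z) h2).trans ?_
  exact app_map_comp (Ω.W n) (ξ.val n) ((Λ.W n).app (Γ.x n))

/-- The element `Ω(ξ)` with the components `Ω_k(ξ_k)`. -/
noncomputable def boxMap (ξ : EvHom Δ.base Λ.tower) : EvHom Ω.tower (Ω.box Λ).tower :=
  ⟨fun k => (Ω.L k).map (ξ.val k), by
    obtain ⟨N, hN⟩ := ξ.exists_compatFrom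
    filter_upwards [eventually_ge_atTop N] with n hn
    exact Ω.boxMap_aux Λ hN n hn⟩

theorem boxMap_compat {ξ : EvHom Δ.base Λ.tower} {N : ℕ} (h : ξ.CompatFrom N) :
    (Ω.boxMap Λ ξ).CompatFrom N := Ω.boxMap_aux Λ h

theorem boxMap_comp_dag (ξ ξ' : EvHom Δ.base Λ.tower) :
    (Ω.boxMap Λ ξ).comp (Ω.boxMap Λ ξ').dag = Ω.lam (ξ.comp ξ'.dag) := by
  ext k
  refine Eq.trans ?_ ((Ω.L k).map_comp (ξ.val k) (CStarCat.dag (ξ'.val k))).symm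
  exact congrArg (fun z => (Ω.L k).map (ξ.val k) ≫ z) (StarLinear.map_dag (ξ'.val k)).symm

theorem boxMap_comp_lam (ξ : EvHom Δ.base Λ.tower) (c : EvHom Γ.base Γ.base) :
    (Ω.boxMap Λ ξ).comp ((Ω.box Λ).lam c) = Ω.boxMap Λ (ξ.comp (Λ.lam c)) := by
  ext k
  exact ((Ω.L k).map_comp (ξ.val k) ((Λ.lam c).val k)).symm

theorem leftAct_Φ' (a : EvHom Δ.base Δ.base) : Ω.leftAct ⟨Φ a, Φ_mem a⟩ = Φ (Ω.lam a) :=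
  Ω.leftAct_Φ a

/-- `Φ_ξ* Φ_ξ'` is left multiplication by `ξ*ξ' ∈ B_∞`, whose left action on `PB(Ω)` is `Ω(ξ*ξ') =
Ω(ξ)*Ω(ξ')`, because `Ω` is a `*`-functor. -/
theorem inner_tmul_Φvec (ξ ξ' : EvHom Δ.base Λ.tower) (v v' : Hilb Ω.tower) :
    ⟪(VNBimod.fusionKer Λ.PB Ω.PB).δ (Λ.Φvec ξ, v),
      (VNBimod.fusionKer Λ.PB Ω.PB).δ (Λ.Φvec ξ', v')⟫_ℂ =
      ⟪Φ (Ω.boxMap Λ ξ) v, Φ (Ω.boxMap Λ ξ') v'⟫_ℂ := by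
  have h : (Λ.Φvec ξ).ip (Λ.Φvec ξ') = ⟨Φ (ξ'.comp ξ.dag), Φ_mem _⟩ := by
    refine Subtype.ext ?_
    change adjoint (Φ ξ) ∘L Φ ξ' = Φ (ξ'.comp ξ.dag)
    rw [Φ_comp, Φ_dag]
  rw [PosKer.inner_δ, VNBimod.fusionKer_k, h]
  change ⟪v, Ω.leftAct ⟨Φ (ξ'.comp ξ.dag), Φ_mem _⟩ v'⟫_ℂ = _
  rw [leftAct_Φ', ← ContinuousLinearMap.adjoint_inner_right, ← Φ_dag,
    ← ContinuousLinearMap.comp_apply, ← Φ_comp, boxMap_comp_dag]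

variable {A : TracialVN.{v₁}} {X : VNBimod.{v₁, w₂, v₂} A Δ.PB}

/-- the vectors of the dense subspace are left bounded -/
theorem norm_tmul_ι_le (R : X.RLin) (ζ : EvHom Θ.base Ω.tower) :
    ‖(VNBimod.fusionKer X Ω.PB).δ (R, (ι Ω.tower ζ : Hilb Ω.tower))‖ ≤
      ‖Ω.R ζ‖ * ‖R.1 (Ωvec Δ)‖ := by
  obtain ⟨S, h1, h2⟩ := VNBimod.exists_abs (Y := Ω.PB) R
  refine (h2 _).trans_le ?_
  rw [← h1]
  -- The left action on `ζ` is `S ↦ R_ζ (S Ω)` with `R_ζ` bounded, owing to the upper weight bound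
  -- of the `1`-cell. Only the value at the trace vector enters, not the operator norm.
  have h3 : ‖Ω.leftAct S (ι Ω.tower ζ)‖ ≤ ‖Ω.R ζ‖ * ‖S.1 (Ωvec Δ)‖ := by
    rw [leftAct_ι]
    exact (Ω.R ζ).le_opNorm _
  exact h3

theorem Φvec_Ωvec (ξ : EvHom Δ.base Λ.tower) :
    (Λ.Φvec ξ).1 (Ωvec Δ) = (ι Λ.tower ξ : Hilb Λ.tower) := Φ_Ωvec Δ ξ

/-- The elementary tensors `Φ_ξ ⊗ ζ`, extended linearly. -/
noncomputable def fusionSpan : (EvHom Δ.base Λ.tower × EvHom Θ.base Ω.tower →₀ ℂ) →ₗ[ℂ]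
    (VNBimod.fusionKer Λ.PB Ω.PB).Hil :=
  Finsupp.linearCombination ℂ fun p =>
    (VNBimod.fusionKer Λ.PB Ω.PB).δ (Λ.Φvec p.1, (ι Ω.tower p.2 : Hilb Ω.tower))

/-- The vectors `Ω(ξ) ζ`, extended linearly. -/
noncomputable def boxSpan : (EvHom Δ.base Λ.tower × EvHom Θ.base Ω.tower →₀ ℂ) →ₗ[ℂ]
    Hilb (Ω.box Λ).tower :=
  Finsupp.linearCombination ℂ fun p => Φ (Ω.boxMap Λ p.1) (ι Ω.tower p.2)

theorem fusionSpan_single (ξ : EvHom Δ.base Λ.tower) (ζ : EvHom Θ.base Ω.tower) :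
    Ω.fusionSpan Λ (Finsupp.single (ξ, ζ) 1) =
      (VNBimod.fusionKer Λ.PB Ω.PB).δ (Λ.Φvec ξ, (ι Ω.tower ζ : Hilb Ω.tower)) :=
  (Finsupp.linearCombination_single ℂ _ _).trans (one_smul ℂ _)

theorem boxSpan_single (ξ : EvHom Δ.base Λ.tower) (ζ : EvHom Θ.base Ω.tower) :
    Ω.boxSpan Λ (Finsupp.single (ξ, ζ) 1) = Φ (Ω.boxMap Λ ξ) (ι Ω.tower ζ) :=
  (Finsupp.linearCombination_single ℂ _ _).trans (one_smul ℂ _)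

/-- An arbitrary `R` need not be an operator-norm limit of the `Φ_ξ`, but its value at the trace
vector is a limit of vectors `ξ`. Left boundedness of `ζ` turns this into `Φ_ξ ⊗ ζ → R ⊗ ζ`. General
second legs follow from continuity of `ζ ↦ R ⊗ ζ`, and these tensors are total. -/
theorem fusionSpan_dense : DenseRange (Ω.fusionSpan Λ) := by
  let D := (LinearMap.range (Ω.fusionSpan Λ)).topologicalClosure
  have h0 : ∀ ξ ζ, (VNBimod.fusionKer Λ.PB Ω.PB).δ (Λ.Φvec ξ, (ι Ω.tower ζ : Hilb Ω.tower)) ∈ D :=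
    fun ξ ζ => Submodule.le_topologicalClosure _ ⟨_, Ω.fusionSpan_single Λ ξ ζ⟩
  have hD : IsClosed (D : Set (VNBimod.fusionKer Λ.PB Ω.PB).Hil) :=
    Submodule.isClosed_topologicalClosure _
  have h1 : ∀ (R : Λ.PB.RLin) (ζ : EvHom Θ.base Ω.tower),
      (VNBimod.fusionKer Λ.PB Ω.PB).δ (R, (ι Ω.tower ζ : Hilb Ω.tower)) ∈ D := fun R ζ => by
    refine hD.closure_subset (Metric.mem_closure_iff.2 fun ε hε => ?_)
    let r : Hilb Λ.tower := R.1 (Ωvec Δ)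
    obtain ⟨ξ, hξ⟩ := (ι_dense Λ.tower).exists_dist_lt r
      -- The tolerance compensates the left-boundedness constant of `ζ`; the `+ 1` avoids a zero
      -- denominator.
      (ε := ε / (‖Ω.R ζ‖ + 1)) (by positivity)
    refine ⟨_, h0 ξ ζ, ?_⟩
    rw [dist_eq_norm]
    refine lt_of_eq_of_lt (congrArg norm (VNBimod.tmul_sub_left (Y := Ω.PB) R (Λ.Φvec ξ)
      (ι Ω.tower ζ : Hilb Ω.tower)).symm) ?_
    refine (Ω.norm_tmul_ι_le _ ζ).trans_lt ?_
    have h2 : ‖(R.sub (Λ.Φvec ξ)).1 (Ωvec Δ)‖ = ‖r - ι Λ.tower ξ‖ :=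
      congrArg (fun z : Hilb Λ.tower => ‖r - z‖) (Φ_Ωvec Δ ξ)
    rw [dist_eq_norm, lt_div_iff₀ (by positivity)] at hξ
    rw [h2]
    nlinarith [norm_nonneg (r - ι Λ.tower ξ)]
  have h2 : ∀ p, (VNBimod.fusionKer Λ.PB Ω.PB).δ p ∈ D := fun p => by
    have hc := (VNBimod.tmulCLM (Y := Ω.PB) p.1).continuous
    exact (ι_dense Ω.tower).induction_on (p := fun v : Hilb Ω.tower =>
      (VNBimod.fusionKer Λ.PB Ω.PB).δ (p.1, v) ∈ D) p.2 (hD.preimage hc) (h1 p.1)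
  have h3 : ∀ f, (VNBimod.fusionKer Λ.PB Ω.PB).emb f ∈ D := fun f => by
    rw [PosKer.emb_eq]
    exact D.sum_mem fun p _ => D.smul_mem _ (h2 p)
  intro v
  have h4 : v ∈ D := (VNBimod.fusionKer Λ.PB Ω.PB).emb_dense.induction_on
    (p := fun v => v ∈ D) v hD h3
  exact h4

/-- Each vector of the dense subspace lies in the range itself. As `Δ.x N` generates, the identity
of `Λ_N m_N` is `∑ p_j* p_j` with `p_j` mapping to `Δ.x N`; inserting its image under `Ω_N` writes
`x` as the sum of the vectors `Ω(ξ_j) ζ_j` with `ξ_j = p_j*` and `ζ_j = Ω(p_j) x`. -/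
theorem boxSpan_dense : DenseRange (Ω.boxSpan Λ) := by
  refine (ι_dense (Ω.box Λ).tower).mono ?_
  rintro _ ⟨x, rfl⟩
  obtain ⟨N, hN⟩ := x.exists_compatFrom
  obtain ⟨n, p, hp⟩ := Δ.isGen_x N ((Λ.L N).obj (Γ.x N))
  let ξ : Fin n → EvHom Δ.base Λ.tower := fun j =>
    EvHom.ofLevel (y := Δ.base) (y' := Λ.tower) N (dag (p j))
  let ζ : Fin n → EvHom Θ.base Ω.tower := fun j =>
    EvHom.ofLevel (y := Θ.base) (y' := Ω.tower) N (x.val N ≫ (Ω.L N).map (p j))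
  have hξ : ∀ j, (ξ j).val N = dag (p j) := fun j => EvHom.ofLevel_val_self N _
  have hζ : ∀ j, (ζ j).val N = x.val N ≫ (Ω.L N).map (p j) := fun j => EvHom.ofLevel_val_self N _
  have hc : ∀ j, ((ζ j).comp (Ω.boxMap Λ (ξ j))).CompatFrom N := fun j =>
    (EvHom.ofLevel_compat N _).comp (Ω.boxMap_compat Λ (EvHom.ofLevel_compat N _))
  refine ⟨∑ j, Finsupp.single (ξ j, ζ j) 1, ?_⟩
  have h1 : ∀ j, Ω.boxSpan Λ (Finsupp.single (ξ j, ζ j) 1) =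
      ι (Ω.box Λ).tower ((ζ j).comp (Ω.boxMap Λ (ξ j))) := fun j => by
    rw [boxSpan_single, Φ_ι]
  rw [map_sum, Finset.sum_congr rfl fun j _ => h1 j, ← map_sum]
  refine ι_eq_of_val (EvHom.CompatFrom.sum fun j _ => hc j) hN ?_
  rw [EvHom.sum_val]
  have h2 : ∀ j, ((ζ j).comp (Ω.boxMap Λ (ξ j))).val N =
      x.val N ≫ (Ω.L N).map (p j ≫ dag (p j)) := fun j => by
    refine (congrArg₂ (fun a b => a ≫ (Ω.L N).map b) (hζ j) (hξ j)).trans ?_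
    rw [Functor.map_comp]
    exact Category.assoc _ _ _
  rw [Finset.sum_congr rfl fun j _ => h2 j]
  refine (Preadditive.comp_sum _ _ _).symm.trans ?_
  have h3 : ∑ j, (Ω.L N).map (p j ≫ dag (p j)) = 𝟙 ((Ω.L N).obj ((Λ.L N).obj (Γ.x N))) := by
    rw [← StarLinear.map_sum, hp]
    exact (Ω.L N).map_id _
  exact (congrArg (fun z => x.val N ≫ z) h3).trans (Category.comp_id _)

/-- The unitary `Φ_ξ ⊗ ζ ↦ Ω(ξ) ζ`. -/
noncomputable def fusionEquiv :
    (VNBimod.fusionKer Λ.PB Ω.PB).Hil ≃ₗᵢ[ℂ] Hilb (Ω.box Λ).tower :=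
  -- Both dense families are indexed by the same formal combinations, so the identity on these is
  -- the map to extend; equality of the Gram matrices makes it isometric.
  (LinearEquiv.refl ℂ _).extendOfIsometry (Ω.fusionSpan Λ) (Ω.boxSpan Λ)
    (Ω.fusionSpan_dense Λ) (Ω.boxSpan_dense Λ) fun f =>
      (norm_linearCombination_eq (fun p q => Ω.inner_tmul_Φvec Λ p.1 q.1 _ _) f).symm

theorem fusionEquiv_tmul_ι (ξ : EvHom Δ.base Λ.tower) (ζ : EvHom Θ.base Ω.tower) :
    Ω.fusionEquiv Λ ((VNBimod.fusionKer Λ.PB Ω.PB).δ (Λ.Φvec ξ, (ι Ω.tower ζ : Hilb Ω.tower))) =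
      Φ (Ω.boxMap Λ ξ) (ι Ω.tower ζ) := by
  have h := LinearEquiv.extendOfIsometry_eq (LinearEquiv.refl ℂ _) (Ω.fusionSpan Λ)
    (Ω.boxSpan Λ) (Ω.fusionSpan_dense Λ) (Ω.boxSpan_dense Λ) (fun f =>
      (norm_linearCombination_eq (fun p q => Ω.inner_tmul_Φvec Λ p.1 q.1 _ _) f).symm)
    (Finsupp.single (ξ, ζ) 1)
  rwa [LinearEquiv.refl_apply, fusionSpan_single, boxSpan_single] at h

theorem fusionEquiv_tmul (ξ : EvHom Δ.base Λ.tower) (v : Hilb Ω.tower) :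
    Ω.fusionEquiv Λ ((VNBimod.fusionKer Λ.PB Ω.PB).δ (Λ.Φvec ξ, v)) = Φ (Ω.boxMap Λ ξ) v := by
  have hc := (VNBimod.tmulCLM (Y := Ω.PB) (Λ.Φvec ξ)).continuous
  exact ι_ext_fun Θ (f := fun v : Hilb Ω.tower =>
      Ω.fusionEquiv Λ ((VNBimod.fusionKer Λ.PB Ω.PB).δ (Λ.Φvec ξ, v)))
    ((Ω.fusionEquiv Λ).continuous.comp hc) (Φ (Ω.boxMap Λ ξ)).continuous
    (fun ζ => Ω.fusionEquiv_tmul_ι Λ ξ ζ) v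

theorem fusion_ext_tmul {G : Type*} [NormedAddCommGroup G] [NormedSpace ℂ G]
    {S T : (VNBimod.fusionKer Λ.PB Ω.PB).Hil →L[ℂ] G}
    (h : ∀ ξ ζ, S ((VNBimod.fusionKer Λ.PB Ω.PB).δ (Λ.Φvec ξ, (ι Ω.tower ζ : Hilb Ω.tower))) =
      T ((VNBimod.fusionKer Λ.PB Ω.PB).δ (Λ.Φvec ξ, (ι Ω.tower ζ : Hilb Ω.tower)))) : S = T := by
  refine ContinuousLinearMap.coeFn_injective
    ((Ω.fusionSpan_dense Λ).equalizer S.continuous T.continuous (funext fun f => ?_))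
  simp only [Function.comp_apply, fusionSpan, Finsupp.linearCombination_apply, Finsupp.sum,
    map_sum, map_smul, h]

theorem boxSpan_ext_inner {a b : Hilb (Ω.box Λ).tower}
    (h : ∀ ξ ζ, ⟪Φ (Ω.boxMap Λ ξ) (ι Ω.tower ζ), a⟫_ℂ = ⟪Φ (Ω.boxMap Λ ξ) (ι Ω.tower ζ), b⟫_ℂ) :
    a = b := by
  refine ext_inner_left ℂ fun v => ?_
  have h1 : Continuous fun v : Hilb (Ω.box Λ).tower => ⟪v, a⟫_ℂ := by fun_prop
  have h2 : Continuous fun v : Hilb (Ω.box Λ).tower => ⟪v, b⟫_ℂ := by fun_prop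
  refine congrFun ((Ω.boxSpan_dense Λ).equalizer h1 h2 (funext fun f => ?_)) v
  simp only [Function.comp_apply, boxSpan, Finsupp.linearCombination_apply, Finsupp.sum, sum_inner,
    inner_smul_left, h]

/-- The bimodule isomorphism `PB(Λ) ⊗_B PB(Ω) → PB(Ω ⊠ Λ)`, `Φ_ξ ⊗ ζ ↦ Ω(ξ) ζ`. -/
noncomputable def fusionIso : (VNBimod.fusion Λ.PB Ω.PB).Iso (Ω.box Λ).PB where
  op := Ω.fusionEquiv Λ
  map_left a v := by
    refine congrArg (fun z : (VNBimod.fusionKer Λ.PB Ω.PB).Hil →L[ℂ] Hilb (Ω.box Λ).tower => z v)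
      (Ω.fusion_ext_tmul Λ
        (S := (Ω.fusionEquiv Λ : (VNBimod.fusionKer Λ.PB Ω.PB).Hil →L[ℂ] Hilb (Ω.box Λ).tower) ∘L
          VNBimod.fusionL Λ.PB Ω.PB a)
        (T := (Ω.box Λ).leftAct a ∘L
          (Ω.fusionEquiv Λ : (VNBimod.fusionKer Λ.PB Ω.PB).Hil →L[ℂ] Hilb (Ω.box Λ).tower))
        fun ξ ζ => Ω.boxSpan_ext_inner Λ fun ξ' ζ' => ?_)
    change ⟪_, Ω.fusionEquiv Λ (VNBimod.fusionL Λ.PB Ω.PB a _)⟫_ℂ =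
      ⟪_, (Ω.box Λ).leftAct a (Ω.fusionEquiv Λ _)⟫_ℂ
    rw [fusionEquiv_tmul_ι]
    -- The test vector is written as the image of a tensor, so that unitarity moves the coefficient
    -- into the fusion, where it is given by `Φ_ξ'* a Φ_ξ ∈ B`.
    conv_lhs => rw [← fusionEquiv_tmul_ι]
    rw [LinearIsometryEquiv.inner_map_map, VNBimod.inner_fusionL]
    change ⟪ι Ω.tower ζ', Ω.leftAct _ (ι Ω.tower ζ)⟫_ℂ = _
    rw [leftAct_ι, Φ_ι, Φ_ι, leftAct_ι]
    have h1 : ((Λ.Φvec ξ').ipL (Λ.Φvec ξ) a).1 (Ωvec Δ) =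
        Φ ξ'.dag (Λ.R ξ (a.1 (Ωvec Γ))) := by
      change adjoint (Φ ξ') (Λ.leftAct a (Φ ξ (Ωvec Δ))) = _
      rw [Φ_Ωvec, leftAct_ι, Φ_dag]
    rw [h1]
    -- Both sides are continuous in `a Ω ∈ L²(A)`. For `c ∈ A_∞` the equality is `Ω(ξ'* Λ(c) ξ) =
    -- Ω(ξ')* ΩΛ(c) Ω(ξ)`.
    refine ι_ext_fun Γ (f := fun v => ⟪ι Ω.tower ζ', Ω.R ζ (Φ ξ'.dag (Λ.R ξ v))⟫_ℂ)
      (g := fun v => ⟪ι (Ω.box Λ).tower (ζ'.comp (Ω.boxMap Λ ξ')),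
        (Ω.box Λ).R (ζ.comp (Ω.boxMap Λ ξ)) v⟫_ℂ) (by fun_prop) (by fun_prop) (fun c => ?_) _
    simp only [R_ι]
    rw [inner_ι_comp, Φ_ι, R_ι, EvHom.comp_assoc ζ, boxMap_comp_lam, EvHom.comp_assoc ζ,
      boxMap_comp_dag]
  map_right b v := by
    refine congrArg (fun z : (VNBimod.fusionKer Λ.PB Ω.PB).Hil →L[ℂ] Hilb (Ω.box Λ).tower => z v)
      (Ω.fusion_ext_tmul Λ
        (S := (Ω.fusionEquiv Λ : (VNBimod.fusionKer Λ.PB Ω.PB).Hil →L[ℂ] Hilb (Ω.box Λ).tower) ∘L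
          VNBimod.fusionR Λ.PB Ω.PB b)
        (T := (Ω.box Λ).rightAct b ∘L
          (Ω.fusionEquiv Λ : (VNBimod.fusionKer Λ.PB Ω.PB).Hil →L[ℂ] Hilb (Ω.box Λ).tower))
        fun ξ ζ => ?_)
    change Ω.fusionEquiv Λ (VNBimod.fusionR Λ.PB Ω.PB b _) =
      (Ω.box Λ).rightAct b (Ω.fusionEquiv Λ _)
    rw [VNBimod.fusionR_δ]
    -- The vector `ζ b` need not belong to the dense subspace, so the formula for an arbitrary
    -- second leg is required.
    refine (Ω.fusionEquiv_tmul Λ ξ (Ω.rightAct b (ι Ω.tower ζ))).trans ?_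
    rw [fusionEquiv_tmul_ι]
    exact congrArg (fun z : Hilb Ω.tower →L[ℂ] Hilb (Ω.box Λ).tower => z (ι Ω.tower ζ))
      (Φ_rightAct Ω (Ω.box Λ) (Ω.boxMap Λ ξ) b)

end OneCell

end FusionIso

/-! ### Convergence in morphism spaces and in spaces of natural transformations -/

section HomNorm

variable {C : Type u} [Category.{w} C] [Preadditive C] [Linear ℂ C] [CStarCat C]

/-- The C*-norm on a space of morphisms. -/
@[reducible] def homNormed (X Y : C) : NormedAddCommGroup (X ⟶ Y) :=
  AddGroupNorm.toNormedAddCommGroup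
    { toFun := fun f => nrm f
      map_zero' := nrm_zero
      add_le' := nrm_add_le
      neg' := nrm_neg
      eq_zero_of_map_eq_zero' := eq_zero_of_nrm }

attribute [local instance] homNormed CStarCat.finite_hom

/-- The morphism spaces are normed spaces. -/
@[reducible] def homNormedSpace (X Y : C) : NormedSpace ℂ (X ⟶ Y) where
  norm_smul_le c f := (nrm_smul c f).le

attribute [local instance] homNormedSpace

/-- The coefficient map is linear and injective on a finite-dimensional space, hence a closed
embedding for the topology of pointwise convergence. Convergence of all coefficients is therefore
norm convergence, with a limit in the same space. -/
theorem IsGen.exists_tendsto {M : WSSC.{u, w}} {m : M.Obj} (hm : IsGen m) {a b : M.Obj}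
    {f : ℕ → (a ⟶ b)} {L : (m ⟶ a) → (m ⟶ b) → ℂ}
    (h : ∀ ξ ζ, Tendsto (fun l => Tr M ((ξ ≫ f l) ≫ dag ζ)) atTop (𝓝 (L ξ ζ))) :
    ∃ g : a ⟶ b, Tendsto f atTop (𝓝 g) ∧ ∀ ξ ζ, Tr M ((ξ ≫ g) ≫ dag ζ) = L ξ ζ := by
  let Ψ : (a ⟶ b) →ₗ[ℂ] ((m ⟶ a) × (m ⟶ b) → ℂ) :=
    { toFun := fun f p => Tr M ((p.1 ≫ f) ≫ dag p.2)
      map_add' := fun f g => funext fun p => by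
        rw [Preadditive.comp_add, Preadditive.add_comp, Tr_add]; rfl
      map_smul' := fun c f => funext fun p => by
        rw [Linear.comp_smul, Linear.smul_comp, Tr_smul]; rfl }
  have hΨ : LinearMap.ker Ψ = ⊥ := (LinearMap.ker_eq_bot').2 fun f hf =>
    hm.eq_zero f fun ξ ζ => congrFun hf (ξ, ζ)
  have hcl := LinearMap.isClosedEmbedding_of_injective (𝕜 := ℂ) hΨ
  have h1 : Tendsto (fun l => Ψ (f l)) atTop (𝓝 fun p => L p.1 p.2) :=
    tendsto_pi_nhds.2 fun p => h p.1 p.2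
  obtain ⟨g, hg⟩ := hcl.isClosed_range.mem_of_tendsto h1
    (Eventually.of_forall fun l => ⟨f l, rfl⟩)
  refine ⟨g, hcl.isInducing.tendsto_nhds_iff.2 (by rw [hg]; exact h1), fun ξ ζ => ?_⟩
  exact congrFun hg (ξ, ζ)

theorem tendsto_comp {X Y Z W : C} {f : ℕ → (Y ⟶ Z)} {g : Y ⟶ Z} (h : Tendsto f atTop (𝓝 g))
    (a : X ⟶ Y) (b : Z ⟶ W) : Tendsto (fun l => a ≫ f l ≫ b) atTop (𝓝 (a ≫ g ≫ b)) := by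
  let A : (Y ⟶ Z) →ₗ[ℂ] (X ⟶ W) :=
    { toFun := fun f => a ≫ f ≫ b
      map_add' := fun f g => by simp
      map_smul' := fun c f => by simp }
  exact ((LinearMap.continuous_of_finiteDimensional A).tendsto g).comp h

/-- a sequence of natural transformations which converges at a generator converges -/
theorem IsGen.exists_ntTendsto {M : WSSC.{u₁, w₁}} {N : WSSC.{u₂, w₂}} {F G : M.Obj ⥤ N.Obj}
    [StarLinear F] [StarLinear G] {m : M.Obj} (hm : IsGen m) {α : ℕ → (F ⟶ G)}
    {g : F.obj m ⟶ G.obj m} (h : Tendsto (fun l => (α l).app m) atTop (𝓝 g)) :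
    ∃ ψ : F ⟶ G, NTTendsto α ψ ∧ ψ.app m = g := by
  have h1 : ∀ x, ∃ f : F.obj x ⟶ G.obj x, Tendsto (fun l => (α l).app x) atTop (𝓝 f) := fun x => by
    obtain ⟨n, p, hp⟩ := hm x
    -- By naturality and `∑ p_j* p_j = 1`, the component at `x` is recovered from the one at `m` by
    -- this formula, which is continuous in the latter.
    refine ⟨∑ j, F.map (p j) ≫ g ≫ G.map (dag (p j)),
      (tendsto_finsetSum Finset.univ fun j _ =>
        tendsto_comp h (F.map (p j)) (G.map (dag (p j)))).congr fun l => ?_⟩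
    have h2 : ∀ j, F.map (p j) ≫ (α l).app m ≫ G.map (dag (p j)) =
        (α l).app x ≫ G.map (p j ≫ dag (p j)) := fun j => by
      rw [← Category.assoc, (α l).naturality, Category.assoc, Functor.map_comp]
    rw [Finset.sum_congr rfl fun j _ => h2 j, ← Preadditive.comp_sum, ← StarLinear.map_sum, hp,
      G.map_id, Category.comp_id]
  choose ψ hψ using h1
  let Ψ : F ⟶ G :=
    { app := ψ
      naturality := fun x y f => by
        have h2 := tendsto_comp (hψ y) (F.map f) (𝟙 (G.obj y))
        have h3 := tendsto_comp (hψ x) (𝟙 (F.obj x)) (G.map f)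
        simp only [Category.comp_id, Category.id_comp, (α _).naturality] at h2 h3
        exact tendsto_nhds_unique h2 h3 }
  refine ⟨Ψ, fun ε hε => ?_, tendsto_nhds_unique (hψ m) h⟩
  obtain ⟨l₀, hl₀⟩ := Metric.tendsto_atTop.1 (hψ m) ε hε
  refine ⟨l₀, fun l hl x => ?_⟩
  -- The norm of the difference is largest at `m`, so convergence there is uniform over all objects.
  have h2 := hm.nrm_app_le (α l - Ψ) x
  rw [NatTrans.app_sub, NatTrans.app_sub] at h2
  have h3 := (hl₀ l hl).le
  rw [dist_eq_norm] at h3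
  exact h2.trans h3

theorem IsGen.nt_ext {M : WSSC.{u₁, w₁}} {N : WSSC.{u₂, w₂}} {F G : M.Obj ⥤ N.Obj}
    [StarLinear F] [StarLinear G] {m : M.Obj} (hm : IsGen m) {α β : F ⟶ G}
    (h : α.app m = β.app m) : α = β := by
  ext x
  have h1 := hm.nrm_app_le (α - β) x
  rw [NatTrans.app_sub, NatTrans.app_sub, h, sub_self, nrm_zero] at h1
  exact sub_eq_zero.1 (eq_zero_of_nrm _ (le_antisymm h1 (nrm_nonneg _)))

theorem NTTendsto.nrm_le {M : WSSC.{u₁, w₁}} {N : WSSC.{u₂, w₂}} {F G : M.Obj ⥤ N.Obj}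
    {α : ℕ → (F ⟶ G)} {β : F ⟶ G} (h : NTTendsto α β) {K : ℝ} (hK : ∀ l x, nrm ((α l).app x) ≤ K)
    (x : M.Obj) : nrm (β.app x) ≤ K := by
  refine le_of_forall_pos_le_add fun ε hε => ?_
  obtain ⟨l, hl⟩ := h ε hε
  have h1 := nrm_add_le ((α l).app x) (-((α l).app x - β.app x))
  have h2 : (α l).app x + -((α l).app x - β.app x) = β.app x := by abel
  rw [nrm_neg, h2] at h1
  linarith [hK l x, hl l le_rfl x]

end HomNorm

/-! ### Limits of iterated loop operators -/

section LoopLimits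

variable {Γ : ZeroCell.{u₁, w₁}} {Δ : ZeroCell.{u₂, w₂}} {Λ Ω : OneCell Γ Δ}
  {t : ∀ k, TracialSolution (Δ.M k) (Δ.M (k + 1)) (Δ.F k)}

/-- The element of the inductive limit given by a natural transformation in degree `k`. -/
noncomputable def ntMap (k : ℕ) (η : Λ.L k ⟶ Ω.L k) : EvHom Λ.tower Ω.tower :=
  EvHom.ofLevel (y := Λ.tower) (y' := Ω.tower) k (η.app (Γ.x k))

theorem ntMap_compat (k : ℕ) (η : Λ.L k ⟶ Ω.L k) : (ntMap k η).CompatFrom k :=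
  EvHom.ofLevel_compat k _

theorem ntMap_val_self (k : ℕ) (η : Λ.L k ⟶ Ω.L k) : (ntMap k η).val k = η.app (Γ.x k) :=
  EvHom.ofLevel_val_self k _

theorem norm_ntMap_le (k : ℕ) (η : Λ.L k ⟶ Ω.L k) : ‖Φ (ntMap k η)‖ ≤ nrm (η.app (Γ.x k)) :=
  norm_Φ_ofLevel_le k _

theorem inner_ntMap {k : ℕ} (η : Λ.L k ⟶ Ω.L k) {ξ : EvHom Δ.base Λ.tower}
    {ζ : EvHom Δ.base Ω.tower} (hξ : ξ.CompatFrom k) (hζ : ζ.CompatFrom k) :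
    ⟪ι Ω.tower ζ, Φ (ntMap k η) (ι Λ.tower ξ)⟫_ℂ =
      Tr (Δ.M k) ((ξ.val k ≫ η.app (Γ.x k)) ≫ dag (ζ.val k)) :=
  inner_Φ_ofLevel _ hξ hζ

theorem inner_ntMap_loop {k : ℕ} (η : Λ.L (k + 1) ⟶ Ω.L (k + 1)) {ξ : EvHom Δ.base Λ.tower}
    {ζ : EvHom Δ.base Ω.tower} (hξ : ξ.CompatFrom k) (hζ : ζ.CompatFrom k) :
    ⟪ι Ω.tower ζ, Φ (ntMap k (loop k (t k) η)) (ι Λ.tower ξ)⟫_ℂ =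
      ⟪ι Ω.tower ζ, Φ (ntMap (k + 1) η) (ι Λ.tower ξ)⟫_ℂ := by
  rw [inner_ntMap _ hξ hζ, inner_ntMap _ (hξ.mono k.le_succ) (hζ.mono k.le_succ)]
  exact Tr_towerExp (y := Λ.tower) (y' := Ω.tower) (t k) (η.app (Γ.x (k + 1))) hξ hζ

/-- Every loop operator preserves the coefficients between vectors of the lower level. Hence the
iterated loop in degree `k` has the coefficients that the original transformation has between
vectors of level `k`. -/
theorem inner_ntMap_loopIter {k l : ℕ} (η : Λ.L (k + l) ⟶ Ω.L (k + l)) {ξ : EvHom Δ.base Λ.tower}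
    {ζ : EvHom Δ.base Ω.tower} (hξ : ξ.CompatFrom k) (hζ : ζ.CompatFrom k) :
    ⟪ι Ω.tower ζ, Φ (ntMap k (loopIter t k l η)) (ι Λ.tower ξ)⟫_ℂ =
      ⟪ι Ω.tower ζ, Φ (ntMap (k + l) η) (ι Λ.tower ξ)⟫_ℂ := by
  induction l with
  | zero => rfl
  | succ l ih =>
    rw [loopIter, ih, inner_ntMap_loop _ (hξ.mono (Nat.le_add_right k l))
      (hζ.mono (Nat.le_add_right k l))]
    -- `k + (l + 1)` and `k + l + 1` agree by definition.
    rfl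

/-- A loop is a contractive expectation applied after composition with unitaries. Limits of iterated
loops thus inherit the bound of the original sequence. -/
theorem nrm_loop_le {k : ℕ} (η : Λ.L (k + 1) ⟶ Ω.L (k + 1)) (x : (Γ.M k).Obj) :
    nrm ((loop k (t k) η).app x) ≤ nrm (η.app ((Γ.F k).obj x)) := by
  have h1 : nrm ((Λ.W k).app x) ≤ 1 := nrm_isom _ (Λ.W_isom k x)
  have h2 : nrm (dag ((Ω.W k).app x)) ≤ 1 := by rw [nrm_dag]; exact nrm_isom _ (Ω.W_isom k x)
  refine ((t k).nrm_condExp_le (Δ.wt_succ k)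
    ((Λ.W k).app x ≫ η.app ((Γ.F k).obj x) ≫ dag ((Ω.W k).app x))).trans ?_
  refine (nrm_comp_le _ _).trans ((mul_le_of_le_one_left (nrm_nonneg _) h1).trans ?_)
  exact (nrm_comp_le _ _).trans (mul_le_of_le_one_right (nrm_nonneg _) h2)

theorem nrm_loopIter_le {k l : ℕ} {K : ℝ} (η : Λ.L (k + l) ⟶ Ω.L (k + l))
    (h : ∀ x, nrm (η.app x) ≤ K) (x : (Γ.M k).Obj) : nrm ((loopIter t k l η).app x) ≤ K := by
  induction l with
  | zero => exact h x
  | succ l ih => exact ih _ fun x => (nrm_loop_le η x).trans (h _)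

/-- If a bounded sequence of natural transformations converges strongly to `X`, then its iterated
images under the loop operators converge to a BQFS which represents `X`. -/
theorem exists_bqfs {χ : ∀ k, Λ.L k ⟶ Ω.L k} {K : ℝ} (hK : ∀ k x, nrm ((χ k).app x) ≤ K)
    {X : Hilb Λ.tower →L[ℂ] Hilb Ω.tower}
    (hX : ∀ v, Tendsto (fun k => Φ (ntMap k (χ k)) v) atTop (𝓝 (X v))) :
    ∃ ψ : ∀ k, Λ.L k ⟶ Ω.L k, (∀ k, NTTendsto (fun l => loopIter t k l (χ (k + l))) (ψ k)) ∧
      IsBQFS t ψ ∧ ∀ v, Tendsto (fun k => Φ (ntMap k (ψ k)) v) atTop (𝓝 (X v)) := by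
  have h1 : ∀ k, ∃ ψ : Λ.L k ⟶ Ω.L k, NTTendsto (fun l => loopIter t k l (χ (k + l))) ψ ∧
      ∀ (ξ : EvHom Δ.base Λ.tower) (ζ : EvHom Δ.base Ω.tower), ξ.CompatFrom k → ζ.CompatFrom k →
        ⟪ι Ω.tower ζ, Φ (ntMap k ψ) (ι Λ.tower ξ)⟫_ℂ = ⟪ι Ω.tower ζ, X (ι Λ.tower ξ)⟫_ℂ :=
      fun k => by
    let vξ : (Δ.x k ⟶ (Λ.L k).obj (Γ.x k)) → EvHom Δ.base Λ.tower :=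
      fun ξ => EvHom.ofLevel (y := Δ.base) (y' := Λ.tower) k ξ
    let vζ : (Δ.x k ⟶ (Ω.L k).obj (Γ.x k)) → EvHom Δ.base Ω.tower :=
      fun ζ => EvHom.ofLevel (y := Δ.base) (y' := Ω.tower) k ζ
    have hξ : ∀ ξ, (vξ ξ).CompatFrom k := fun ξ => EvHom.ofLevel_compat k _
    have hζ : ∀ ζ, (vζ ζ).CompatFrom k := fun ζ => EvHom.ofLevel_compat k _
    have hv : ∀ (η : Λ.L k ⟶ Ω.L k) ξ ζ, Tr (Δ.M k) ((ξ ≫ η.app (Γ.x k)) ≫ dag ζ) =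
        ⟪ι Ω.tower (vζ ζ), Φ (ntMap k η) (ι Λ.tower (vξ ξ))⟫_ℂ := fun η ξ ζ => by
      rw [inner_ntMap η (hξ ξ) (hζ ζ)]
      exact (congrArg₂ (fun a b => Tr (Δ.M k) ((a ≫ η.app (Γ.x k)) ≫ dag b))
        (EvHom.ofLevel_val_self (y := Δ.base) (y' := Λ.tower) k ξ)
        (EvHom.ofLevel_val_self (y := Δ.base) (y' := Ω.tower) k ζ)).symm
    -- The coefficients of the `l`-th iterated loop are those of the transformation in degree `k +
    -- l`, which converge to the coefficients of `X`.
    obtain ⟨g, hg, hg'⟩ := (Δ.isGen_x k).exists_tendsto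
      (f := fun l => (loopIter t k l (χ (k + l))).app (Γ.x k))
      (L := fun ξ ζ => ⟪ι Ω.tower (vζ ζ), X (ι Λ.tower (vξ ξ))⟫_ℂ) fun ξ ζ => by
        simp only [hv, inner_ntMap_loopIter _ (hξ ξ) (hζ ζ)]
        refine Tendsto.inner tendsto_const_nhds ((hX _).comp (f := fun l => k + l) ?_)
        exact tendsto_atTop_mono (fun l => Nat.le_add_left l k) tendsto_id
    obtain ⟨ψ, hψ, rfl⟩ := (Γ.isGen_x k).exists_ntTendsto hg
    refine ⟨ψ, hψ, fun ξ ζ h1 h2 => ?_⟩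
    -- A vector compatible from level `k` on is determined by its `k`-th component, so the standard
    -- representatives cover all cases.
    have h3 : ι Λ.tower ξ = ι Λ.tower (vξ (ξ.val k)) :=
      ι_eq_of_val h1 (hξ _) (EvHom.ofLevel_val_self k _).symm
    have h4 : ι Ω.tower ζ = ι Ω.tower (vζ (ζ.val k)) :=
      ι_eq_of_val h2 (hζ _) (EvHom.ofLevel_val_self k _).symm
    rw [h3, h4]
    exact (hv ψ (ξ.val k) (ζ.val k)).symm.trans (hg' (ξ.val k) (ζ.val k))
  choose ψ hψ hinner using h1
  have hq : IsBQFS t ψ := by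
    -- The loop of `ψ_(k+1)` and `ψ_k` both have the coefficients of `X` between vectors of level
    -- `k`. Such coefficients determine the component at the generator `Γ.x k`, and that component
    -- determines the transformation.
    refine ⟨fun k => (Γ.isGen_x k).nt_ext (sub_eq_zero.1 ((Δ.isGen_x k).eq_zero _ fun ξ ζ => ?_)),
      K, fun k x => (hψ k).nrm_le (fun l x => nrm_loopIter_le _ (hK _) x) x⟩
    have h2 := EvHom.ofLevel_compat (y := Δ.base) (y' := Λ.tower) k ξ
    have h3 := EvHom.ofLevel_compat (y := Δ.base) (y' := Ω.tower) k ζ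
    have h4 := inner_ntMap_loop (t := t) (ψ (k + 1)) h2 h3
    have h5 : ∀ ω : Λ.L k ⟶ Ω.L k, Tr (Δ.M k) ((ξ ≫ ω.app (Γ.x k)) ≫ dag ζ) =
        ⟪ι Ω.tower (EvHom.ofLevel (y := Δ.base) (y' := Ω.tower) k ζ),
          Φ (ntMap k ω) (ι Λ.tower (EvHom.ofLevel (y := Δ.base) (y' := Λ.tower) k ξ))⟫_ℂ :=
        fun ω => by
      rw [inner_ntMap _ h2 h3]
      exact (congrArg₂ (fun a b => Tr (Δ.M k) ((a ≫ ω.app (Γ.x k)) ≫ dag b))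
        (EvHom.ofLevel_val_self (y := Δ.base) (y' := Λ.tower) k ξ)
        (EvHom.ofLevel_val_self (y := Δ.base) (y' := Ω.tower) k ζ)).symm
    rw [hinner (k + 1) _ _ (h2.mono k.le_succ) (h3.mono k.le_succ), ← hinner k _ _ h2 h3] at h4
    replace h4 := ((h5 _).trans h4).trans (h5 _).symm
    rw [Preadditive.comp_sub, Preadditive.sub_comp, sub_eq_add_neg, ← neg_one_smul ℂ, Tr_add,
      Tr_smul]
    refine (congrArg (fun z => z + -1 * Tr (Δ.M k) ((ξ ≫ (ψ k).app (Γ.x k)) ≫ dag ζ)) h4).trans ?_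
    ring
  refine ⟨ψ, hψ, hq, ?_⟩
  obtain ⟨T, hT⟩ := hq.exists_isPB
  -- For fixed dense vectors the coefficients of `ψ_k` equal those of `X` for all large `k`, so the
  -- martingale limit of `ψ` has the same coefficients as `X`.
  have h2 : (T.op : Hilb Λ.tower →L[ℂ] Hilb Ω.tower) = X :=
    Hilb.ext fun ξ => Hilb.ext_inner fun ζ => by
      obtain ⟨N, hN⟩ := ξ.exists_compatFrom
      obtain ⟨N', hN'⟩ := ζ.exists_compatFrom
      refine tendsto_nhds_unique (Tendsto.inner tendsto_const_nhds (hT (ι Λ.tower ξ)))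
        (tendsto_const_nhds.congr' ?_)
      filter_upwards [eventually_ge_atTop N, eventually_ge_atTop N'] with k h3 h4
      exact (hinner k ξ ζ (hN.mono h3) (hN'.mono h4)).symm
  rw [← h2]
  exact hT

end LoopLimits

/-! ### Horizontal composition and Connes fusion -/

section Interchange

variable {Γ : ZeroCell.{u₁, w₁}} {Δ : ZeroCell.{u₂, w₂}} {Θ : ZeroCell.{u₃, w₃}}

namespace OneCell

section

variable {A : TracialVN.{v₁}} {X : VNBimod.{v₁, w₂, v₂} A Δ.PB} (Ω : OneCell Δ Θ)

/-- Elementary tensors `R_k ⊗ v_k` converge if the `R_k` are bounded and converge at the trace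
vector, and the `v_k` converge. -/
theorem tendsto_tmul {R : ℕ → X.RLin} {S : X.RLin} {K : ℝ} (hK : ∀ k, ‖(R k).1‖ ≤ K)
    (hR : Tendsto (fun k => (R k).1 (Ωvec Δ)) atTop (𝓝 (S.1 (Ωvec Δ)))) {v : ℕ → Hilb Ω.tower}
    {w : Hilb Ω.tower} (hv : Tendsto v atTop (𝓝 w)) :
    Tendsto (fun k => (VNBimod.fusionKer X Ω.PB).δ (R k, v k)) atTop
      (𝓝 ((VNBimod.fusionKer X Ω.PB).δ (S, w))) := by
  have hT : ∀ k, ‖VNBimod.tmulCLM (Y := Ω.PB) (R k)‖ ≤ K := fun k =>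
    (VNBimod.norm_tmulCLM_le _).trans (hK k)
  -- The uniform bound on `R_k` reduces the moving vectors `v_k` to the fixed `w`, and then `w` to a
  -- vector `ζ` of the dense subspace. For such `ζ`, left boundedness needs only convergence of
  -- `R_k` at the trace vector.
  refine tendsto_apply_of_bounded (E := Hilb Ω.tower)
    (T := fun k => VNBimod.tmulCLM (Y := Ω.PB) (R k)) (S := VNBimod.tmulCLM (Y := Ω.PB) S) hT hv ?_
  refine tendsto_of_dense (E := Hilb Ω.tower) (ι_dense Ω.tower)
    (T := fun k => VNBimod.tmulCLM (Y := Ω.PB) (R k)) (S := VNBimod.tmulCLM (Y := Ω.PB) S) hT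
    (fun ζ => tendsto_iff_norm_sub_tendsto_zero.2 ?_) w
  have h1 : Tendsto (fun k => ‖Ω.R ζ‖ * ‖(R k).1 (Ωvec Δ) - S.1 (Ωvec Δ)‖) atTop (𝓝 0) := by
    simpa using (tendsto_iff_norm_sub_tendsto_zero.1 hR).const_mul ‖Ω.R ζ‖
  refine squeeze_zero (fun k => norm_nonneg _) (fun k => ?_) h1
  refine (congrArg norm (VNBimod.tmul_sub_left (Y := Ω.PB) (R k) S
    (ι Ω.tower ζ : Hilb Ω.tower)).symm).trans_le ?_
  exact Ω.norm_tmul_ι_le _ ζ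

end

variable {Λ₁ Λ₂ : OneCell Γ Δ} {Ω₁ Ω₂ : OneCell Δ Θ}

/-- The horizontal composition of natural transformations, between tensor products of `1`-cells. -/
def hcomp {k : ℕ} (η : Λ₁.L k ⟶ Λ₂.L k) (κ : Ω₁.L k ⟶ Ω₂.L k) :
    (Ω₁.box Λ₁).L k ⟶ (Ω₂.box Λ₂).L k :=
  η ◫ κ

theorem nrm_hcomp_le {k : ℕ} {η : Λ₁.L k ⟶ Λ₂.L k} {κ : Ω₁.L k ⟶ Ω₂.L k} {K K' : ℝ}
    (h : ∀ x, nrm (η.app x) ≤ K) (h' : ∀ x, nrm (κ.app x) ≤ K') (x : (Γ.M k).Obj) :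
    nrm ((hcomp η κ).app x) ≤ K' * K :=
  (nrm_comp_le _ _).trans (mul_le_mul (h' _) ((StarLinear.nrm_map_le _ _).trans (h x))
    (nrm_nonneg _) ((nrm_nonneg _).trans (h' ((Λ₁.L k).obj x))))

/-- The interchange law at a finite level. Naturality of `κ` at `ξ_k` gives `κ ∘ Ω₁(ξ) = Ω₂(ξ) ∘ κ`,
and `Ω₂(η)` then combines with `Ω₂(ξ)`. -/
theorem Φ_boxMap_hcomp {k : ℕ} (η : Λ₁.L k ⟶ Λ₂.L k) (κ : Ω₁.L k ⟶ Ω₂.L k)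
    {ξ : EvHom Δ.base Λ₁.tower} (hξ : ξ.CompatFrom k) (v : Hilb Ω₁.tower) :
    Φ (ntMap k (hcomp η κ)) (Φ (Ω₁.boxMap Λ₁ ξ) v) =
      Φ (Ω₂.boxMap Λ₂ (ξ.comp (ntMap k η))) (Φ (ntMap k κ) v) := by
  have h : Φ ((Ω₁.boxMap Λ₁ ξ).comp (ntMap k (hcomp η κ))) =
      Φ ((ntMap k κ).comp (Ω₂.boxMap Λ₂ (ξ.comp (ntMap k η)))) := by
    refine Φ_eq_of_val ((Ω₁.boxMap_compat Λ₁ hξ).comp (ntMap_compat k _))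
      ((ntMap_compat k _).comp (Ω₂.boxMap_compat Λ₂ (hξ.comp (ntMap_compat k _)))) ?_
    have h1 := ntMap_val_self k (hcomp η κ)
    have h2 := ntMap_val_self k κ
    have h3 := ntMap_val_self k η
    refine (congrArg (fun z => (Ω₁.L k).map (ξ.val k) ≫ z) h1).trans (Eq.trans ?_
      (congrArg₂ (fun a b => a ≫ (Ω₂.L k).map (ξ.val k ≫ b)) h2 h3).symm)
    refine Eq.trans ?_ (congrArg (fun z => κ.app (Δ.x k) ≫ z)
      ((Ω₂.L k).map_comp (ξ.val k) (η.app (Γ.x k)))).symm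
    have h4 := κ.naturality (ξ.val k)
    exact (Category.assoc _ _ _).symm.trans
      ((congrArg (fun z => z ≫ (Ω₂.L k).map (η.app (Γ.x k))) h4).trans (Category.assoc _ _ _))
  rw [Φ_comp, Φ_comp] at h
  exact congrArg (fun z : Hilb Ω₁.tower →L[ℂ] Hilb (Ω₂.box Λ₂).tower => z v) h

/-- The tensor product of intertwiners, as an operator between the spaces of the tensor products of
`1`-cells. -/
noncomputable def boxOp (T : Λ₁.PB.Hom Λ₂.PB) (T' : Ω₁.PB.Hom Ω₂.PB) :
    Hilb (Ω₁.box Λ₁).tower →L[ℂ] Hilb (Ω₂.box Λ₂).tower :=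
  (Ω₂.fusionEquiv Λ₂ : (VNBimod.fusionKer Λ₂.PB Ω₂.PB).Hil →L[ℂ] Hilb (Ω₂.box Λ₂).tower) ∘L
    (T.tensor T').op ∘L
    ((Ω₁.fusionEquiv Λ₁).symm : Hilb (Ω₁.box Λ₁).tower →L[ℂ]
      (VNBimod.fusionKer Λ₁.PB Ω₁.PB).Hil)

theorem boxOp_fusionEquiv (T : Λ₁.PB.Hom Λ₂.PB) (T' : Ω₁.PB.Hom Ω₂.PB)
    (z : (VNBimod.fusionKer Λ₁.PB Ω₁.PB).Hil) :
    boxOp T T' (Ω₁.fusionEquiv Λ₁ z) = Ω₂.fusionEquiv Λ₂ ((T.tensor T').op z) :=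
  congrArg (fun z => Ω₂.fusionEquiv Λ₂ ((T.tensor T').op z))
    ((Ω₁.fusionEquiv Λ₁).symm_apply_apply z)

theorem boxOp_boxMap (T : Λ₁.PB.Hom Λ₂.PB) (T' : Ω₁.PB.Hom Ω₂.PB) (ξ : EvHom Δ.base Λ₁.tower)
    (v : Hilb Ω₁.tower) : boxOp T T' (Φ (Ω₁.boxMap Λ₁ ξ) v) =
      Ω₂.fusionEquiv Λ₂ ((VNBimod.fusionKer Λ₂.PB Ω₂.PB).δ
        ((Λ₁.Φvec ξ).push T.rlin, T'.op v)) := by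
  rw [← fusionEquiv_tmul, boxOp_fusionEquiv]
  exact congrArg (Ω₂.fusionEquiv Λ₂) (VNBimod.Hom.tensor_tmul T T' (Λ₁.Φvec ξ) v)

variable {η : ∀ k, Λ₁.L k ⟶ Λ₂.L k} {κ : ∀ k, Ω₁.L k ⟶ Ω₂.L k}

/-- For large `k` the `k`-th term is the image under the unitary of the tensor of `Φ` at `η_k ξ`
with `κ_k v`. The first legs are bounded by `K ‖Φ ξ‖` and at the trace vector equal `η_k ξ`, which
tends to `T ξ`; the second legs tend to `T' v`. -/
theorem tendsto_hcomp_boxMap {K : ℝ} (hη : ∀ k x, nrm ((η k).app x) ≤ K) {T : Λ₁.PB.Hom Λ₂.PB}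
    {T' : Ω₁.PB.Hom Ω₂.PB} (hT : IsPB η T) (hT' : IsPB κ T') (ξ : EvHom Δ.base Λ₁.tower)
    (v : Hilb Ω₁.tower) :
    Tendsto (fun k => Φ (ntMap k (hcomp (η k) (κ k))) (Φ (Ω₁.boxMap Λ₁ ξ) v)) atTop
      (𝓝 (boxOp T T' (Φ (Ω₁.boxMap Λ₁ ξ) v))) := by
  rw [boxOp_boxMap]
  have hR : Tendsto (fun k => (Λ₂.Φvec (ξ.comp (ntMap k (η k)))).1 (Ωvec Δ)) atTop
      (𝓝 (((Λ₁.Φvec ξ).push T.rlin).1 (Ωvec Δ))) := by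
    have h1 : ((Λ₁.Φvec ξ).push T.rlin).1 (Ωvec Δ) = T.op (ι Λ₁.tower ξ : Hilb Λ₁.tower) :=
      congrArg (fun z : Hilb Λ₁.tower => T.op z) (Λ₁.Φvec_Ωvec ξ)
    have h2 : ∀ k, (Λ₂.Φvec (ξ.comp (ntMap k (η k)))).1 (Ωvec Δ) =
        Φ (ntMap k (η k)) (ι Λ₁.tower ξ) := fun k =>
      (Λ₂.Φvec_Ωvec _).trans (Φ_ι _ _).symm
    rw [h1]
    exact (hT (ι Λ₁.tower ξ)).congr fun k => (h2 k).symm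
  have hb : ∀ k, ‖(Λ₂.Φvec (ξ.comp (ntMap k (η k)))).1‖ ≤ K * ‖Φ ξ‖ := fun k => by
    change ‖Φ (ξ.comp (ntMap k (η k)))‖ ≤ _
    rw [Φ_comp]
    exact (ContinuousLinearMap.opNorm_comp_le _ _).trans (mul_le_mul_of_nonneg_right
      ((norm_ntMap_le k (η k)).trans (hη k _)) (norm_nonneg _))
  have h := ((Ω₂.fusionEquiv Λ₂).continuous.tendsto _).comp (Ω₂.tendsto_tmul hb hR (hT' v))
  obtain ⟨N, hN⟩ := ξ.exists_compatFrom
  refine h.congr' ?_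
  filter_upwards [eventually_ge_atTop N] with k hk
  exact (Ω₂.fusionEquiv_tmul Λ₂ _ _).trans (Φ_boxMap_hcomp (η k) (κ k) (hN.mono hk) v).symm

theorem tendsto_hcomp {K K' : ℝ} (hη : ∀ k x, nrm ((η k).app x) ≤ K)
    (hκ : ∀ k x, nrm ((κ k).app x) ≤ K') {T : Λ₁.PB.Hom Λ₂.PB} {T' : Ω₁.PB.Hom Ω₂.PB}
    (hT : IsPB η T) (hT' : IsPB κ T') (v : Hilb (Ω₁.box Λ₁).tower) :
    Tendsto (fun k => Φ (ntMap k (hcomp (η k) (κ k))) v) atTop (𝓝 (boxOp T T' v)) := by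
  refine tendsto_of_dense (Ω₁.boxSpan_dense Λ₁)
    -- The operators are bounded by `K' * K` uniformly in `k`, so convergence on the spanning
    -- vectors is enough.
    (fun k => (norm_ntMap_le k _).trans (nrm_hcomp_le (hη k) (hκ k) _)) (fun f => ?_) v
  simp only [boxSpan, Finsupp.linearCombination_apply, Finsupp.sum, map_sum, map_smul]
  exact tendsto_finsetSum _ fun p _ => (tendsto_hcomp_boxMap hη hT hT' p.1 _).const_smul _

/-- The horizontal composition of BQFSs, and its compatibility with Connes fusion. -/
theorem exists_box_bqfs {tΔ : ∀ k, TracialSolution (Δ.M k) (Δ.M (k + 1)) (Δ.F k)}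
    {tΘ : ∀ k, TracialSolution (Θ.M k) (Θ.M (k + 1)) (Θ.F k)} (hη : IsBQFS tΔ η)
    (hκ : IsBQFS tΘ κ) :
    ∃ ψ : ∀ k, (Ω₁.box Λ₁).L k ⟶ (Ω₂.box Λ₂).L k,
      (∀ k, NTTendsto (fun l => loopIter (Λ := Ω₁.box Λ₁) (Ω := Ω₂.box Λ₂) tΘ k l
        (hcomp (η (k + l)) (κ (k + l)))) (ψ k)) ∧
      IsBQFS tΘ ψ ∧
      ∃ (T : Λ₁.PB.Hom Λ₂.PB) (T' : Ω₁.PB.Hom Ω₂.PB) (X : (Ω₁.box Λ₁).PB.Hom (Ω₂.box Λ₂).PB),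
        IsPB η T ∧ IsPB κ T' ∧ IsPB ψ X ∧
        ∀ z, X.op ((Ω₁.fusionIso Λ₁).op z) = (Ω₂.fusionIso Λ₂).op ((T.tensor T').op z) := by
  obtain ⟨T, hT⟩ := hη.exists_isPB
  obtain ⟨T', hT'⟩ := hκ.exists_isPB
  obtain ⟨K, hK⟩ := hη.bounded
  obtain ⟨K', hK'⟩ := hκ.bounded
  -- No quasi-flatness of the horizontal composites is needed here: their boundedness and strong
  -- convergence suffice, and the limit of iterated loops makes the sequence quasi-flat without
  -- changing the limit operator.
  obtain ⟨ψ, h1, h2, h3⟩ := exists_bqfs (t := tΘ)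
    (fun k => nrm_hcomp_le (hK k) (hK' k)) (tendsto_hcomp hK hK' hT hT')
  obtain ⟨X, hX⟩ := exists_hom_of_limit ψ (boxOp T T') h3
  refine ⟨ψ, h1, h2, T, T', X, hT, hT', fun v => ?_, fun z => ?_⟩
  · rw [hX]
    exact h3 v
  · exact (congrArg (fun S : Hilb (Ω₁.box Λ₁).tower →L[ℂ] Hilb (Ω₂.box Λ₂).tower =>
      S (Ω₁.fusionEquiv Λ₁ z)) hX).trans (boxOp_fusionEquiv T T' z)

end OneCell

end Interchange

end UC

theorem mainTheorem5 (Γ : ZeroCell.{u₁, w₁}) (Δ : ZeroCell.{u₂, w₂}) (Θ : ZeroCell.{u₃, w₃}) :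
    ∃ U : ∀ (Λ : OneCell Γ Δ) (Ω : OneCell Δ Θ),
        (VNBimod.fusion Λ.PB Ω.PB).Iso (Ω.box Λ).PB,
      (∀ (Λ : OneCell Γ Δ) (Ω : OneCell Δ Θ) (ξ : EvHom Δ.base Λ.tower)
          (ζ : EvHom Θ.base Ω.tower),
        (U Λ Ω).op (VNBimod.tmul (Λ.Φvec ξ) (ι Ω.tower ζ : Hilb Ω.tower)) =
          (ι (Ω.box Λ).tower (Ω.mulVec Λ ξ ζ) : Hilb (Ω.box Λ).tower)) ∧
      ∀ (tΔ : ∀ k, TracialSolution (Δ.M k) (Δ.M (k + 1)) (Δ.F k))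
        (tΘ : ∀ k, TracialSolution (Θ.M k) (Θ.M (k + 1)) (Θ.F k))
        (Λ₁ Λ₂ : OneCell Γ Δ) (Ω₁ Ω₂ : OneCell Δ Θ)
        (η : ∀ k, Λ₁.L k ⟶ Λ₂.L k) (κ : ∀ k, Ω₁.L k ⟶ Ω₂.L k),
        IsBQFS tΔ η → IsBQFS tΘ κ →
        ∃ ψ : ∀ k, (Ω₁.box Λ₁).L k ⟶ (Ω₂.box Λ₂).L k,
          (∀ k, NTTendsto
            (fun l => loopIter (Λ := Ω₁.box Λ₁) (Ω := Ω₂.box Λ₂) tΘ k l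
              (η (k + l) ◫ κ (k + l))) (ψ k)) ∧
          IsBQFS tΘ ψ ∧
          ∃ (T : Λ₁.PB.Hom Λ₂.PB) (T' : Ω₁.PB.Hom Ω₂.PB)
            (X : (Ω₁.box Λ₁).PB.Hom (Ω₂.box Λ₂).PB),
            IsPB η T ∧ IsPB κ T' ∧ IsPB ψ X ∧
            ∀ z, X.op ((U Λ₁ Ω₁).op z) = (U Λ₂ Ω₂).op ((T.tensor T').op z) := by
  -- The composite of `ζ` with `boxMap` has the same components as `mulVec`, so the two agree
  -- definitionally.
  refine ⟨fun Λ Ω => Ω.fusionIso Λ, fun Λ Ω ξ ζ => (Ω.fusionEquiv_tmul_ι Λ ξ ζ).trans (Φ_ι _ _), ?_⟩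
  intro tΔ tΘ Λ₁ Λ₂ Ω₁ Ω₂ η κ hη hκ
  exact OneCell.exists_box_bqfs hη hκ
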